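/- **Setting.** Let $K$ be a nonarchimedean local field with ring of integers $R$ and residue field of cardinality $q$, let $\mu$ be the additive Haar measure on $K$ with $\mu(R)=1$, let $|x|=\mu(xR)/\mu(R)$ be the canonical absolute value, let $N\ge 2$, let $\|x\|=\max_i|x_i|$ on $K^N$, and let $|dx|$ be the product measure $\mu^N$. Let $\mathcal N=\{0\}\cup\bigcup_{n\ge1}\{n,\tfrac1n\}$ and let $\rho:\mathcal N\to\mathbb C$ satisfy $$\limsup_{n\to\infty}\frac{\log|\rho(1/n)|}{\log n}\le 1,\qquad \limsup_{n\to\infty}\frac{\log|\rho(n)|}{\log n}=-\infty\qquad(\log 0:=-\infty).$$ Let $a,b,\beta\in\mathbb C$, let $q_1,\dots,q_N>0$ be real numbers, and put $\boldsymbol c=(q_iq_j)_{i<j}$. Define $$Z_N^\rho(K,a,b,\beta\boldsymbol c)=\int_{K^N}\rho(\|x\|)\Big(\max_{i<j}|x_i-x_j|\Big)^a\Big(\min_{i<j}|x_i-x_j|\Big)^b\prod_{i<j}|x_i-x_j|^{q_iq_j\beta}\,|dx|,$$ $$H_q^\rho(z)=\frac{1-q^{-z}}{1-q^{-(z-1)}}\sum_{m\in\mathbb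 Z}\rho(q^m)q^{mz}.$$ **Splitting filtrations.** A splitting filtration of order $N$ is a tuple $\pi=(\pi_0,\dots,\pi_L)$ of partitions of $[N]=\{1,\dots,N\}$, each $\pi_{\ell+1}$ a proper refinement of $\pi_\ell$, with $\pi_0=\{[N]\}$ and $\pi_L$ the partition into singletons; put $L(\pi)=L$. Let $\mathcal S_N$ be the (finite) set of them. The set $\mathcal B(\pi)$ of branches consists of all parts $\lambda$ of $\pi_0,\dots,\pi_{L-1}$ with $\#\lambda>1$; $\pi$ is reduced if each branch lies in exactly one of $\pi_0,\dots,\pi_{L-1}$, and $\mathcal R_N\subset\mathcal S_N$ is the set of reduced ones. For $\lambda\in\mathcal B(\pi)$ let $\ell_\pi(\lambda)$ be the largest $\ell<L$ with $\lambda\in\pi_\ell$, and let $\deg_\pi(\lambda)$ be the number of parts of $\pi_{\ell_\pi(\lambda)+1}$ contained in $\lambda$. With $(n)_k=n(n-1)\cdots(n-k+1)$ and $\operatorname{rank}(\pi_\ell)=N-\#\pi_\ell$, put $$M_{\pi,q}=\prod_{\lambda\in\mathcal B(\pi)}(q-1)_{\deg_\pi(\lambda)-1},\qquad \varepsilon_\lambda=\sum_{i<j,\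 i,j\in\lambda}q_iq_j,\qquad e_\lambda=\#\lambda-1+\beta\varepsilon_\lambda,$$ $$J_{\pi,q}(b,\beta\boldsymbol c)=\frac{M_{\pi,q}}{q^{N-1}}\prod_{\ell=1}^{L(\pi)-1}\frac1{q^{\,b+\sum_{\lambda\in\mathcal B(\pi)\cap\pi_\ell}e_\lambda}-1},\qquad I_{\pi,q}(\beta\boldsymbol c)=\frac{M_{\pi,q}}{q^{N-1}}\prod_{\lambda\in\mathcal B(\pi)\setminus\{[N]\}}\frac1{q^{e_\lambda}-1}.$$ **Abscissae** (in $[-\infty,\infty]$, with $\inf\varnothing=+\infty$): $$\mathcal{RP}(a,b)=-\frac{N-1+\operatorname{Re}(a+b)}{\sum_{i<j}q_iq_j},\quad \mathcal{BP}_\pi=-\inf_{\lambda\in\mathcal B(\pi)\setminus\{[N]\}}\frac{\#\lambda-1}{\varepsilon_\lambda},\quad \mathcal{LP}_\pi(b)=-\inf_{1\le\ell\le L(\pi)-1}\frac{\operatorname{rank}(\pi_\ell)+\operatorname{Re}(b)}{\sum_{\lambda\in\mathcal B(\pi)\cap\pi_\ell}\varepsilon_\lambda}.$$ **Claim.** (a)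 If $\operatorname{Re}(\beta)>\sup\big\{\mathcal{RP}(a,b),\ \sup_{\pi\in\mathcal S_N,\,M_{\pi,q}>0}\mathcal{LP}_\pi(b)\big\}$, then the integral $Z_N^\rho(K,a,b,\beta\boldsymbol c)$ and the series defining $H_q^\rho\big(N+a+b+\sum_{i<j}q_iq_j\beta\big)$ converge absolutely, and $$Z_N^\rho(K,a,b,\beta\boldsymbol c)=H_q^\rho\Big(N+a+b+\sum_{i<j}q_iq_j\beta\Big)\cdot\sum_{\pi\in\mathcal S_N,\ M_{\pi,q}>0}J_{\pi,q}(b,\beta\boldsymbol c).$$ (b) If $\operatorname{Re}(\beta)>\sup\big\{\mathcal{RP}(a,0),\ \sup_{\pi\in\mathcal R_N,\,M_{\pi,q}>0}\mathcal{BP}_\pi\big\}$, then the integral $Z_N^\rho(K,a,0,\beta\boldsymbol c)$ and the series defining $H_q^\rho\big(N+a+\sum_{i<j}q_iq_j\beta\big)$ converge absolutely, and $$Z_N^\rho(K,a,0,\beta\boldsymbol c)=H_q^\rho\Big(N+a+\sum_{i<j}q_iq_j\beta\Big)\cdot\sum_{\pi\in\mathcal R_N,\ M_{\pi,q}>0}I_{\pi,q}(\beta\boldsymbol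 c).$$ -/

import Mathlib

open scoped ValuativeRel BigOperators

namespace LogCoulomb

/-! ### Nonarchimedean local fields: Haar measure, canonical absolute value, norm -/

section Field

variable (K : Type*) [Field K] [ValuativeRel K] [TopologicalSpace K]
  [IsNonarchimedeanLocalField K]

/-- The ring of integers `R` of `K`, as a compact set with nonempty interior. -/
def integers : TopologicalSpace.PositiveCompacts K where
  carrier := (𝒪[K] : Set K)
  isCompact' := IsNonarchimedeanLocalField.isCompact_closedBall K 1
  interior_nonempty' := by
    refine ⟨0, mem_interior_iff_mem_nhds.mpr ?_⟩
    refine (IsValuativeTopology.mem_nhds_zero_iff _).mpr ⟨1, fun x hx => ?_⟩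
    have hx' : ValuativeRel.valuation K x < 1 := by simpa using hx
    exact hx'.le

variable [MeasurableSpace K] [BorelSpace K]

/-- The additive Haar measure `μ` on `K` normalized by `μ(R) = 1`. -/
noncomputable def haar : MeasureTheory.Measure K :=
  MeasureTheory.Measure.addHaarMeasure (integers K)

/-- The product Haar measure `|dx|` on `K^N`. -/
noncomputable def haarPi (N : ℕ) : MeasureTheory.Measure (Fin N → K) :=
  MeasureTheory.Measure.pi fun _ => haar K

variable {K}

/-- The canonical absolute value `|x| = μ(xR) / μ(R)`. -/
noncomputable def canonicalAbs (x : K) : ℝ :=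
  (haar K ((fun y => x * y) '' (𝒪[K] : Set K)) / haar K (𝒪[K] : Set K)).toReal

/-- The norm `‖x‖ = max_i |x_i|` on `K^N`. -/
noncomputable def supNorm {N : ℕ} (x : Fin N → K) : ℝ := ⨆ i, canonicalAbs (x i)

end Field

/-! ### Index pairs `i < j` and the integral -/

/-- The set of pairs `(i, j)` with `i < j`; points of `ℂ^(N choose 2)` are functions on it. -/
abbrev Pair (N : ℕ) : Type := {p : Fin N × Fin N // p.1 < p.2}

/-- The set `𝒩 = {0} ∪ ⋃_{n ≥ 1} {n, 1/n}`. -/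
def normValues : Set ℝ := {0} ∪ ⋃ n ∈ Set.Ici (1 : ℕ), {(n : ℝ), 1 / (n : ℝ)}

open Classical in
/-- The value `ρ(t)` of `ρ : 𝒩 → ℂ` at a real number `t ∈ 𝒩` (and `0` if `t ∉ 𝒩`). -/
noncomputable def evalAt (ρ : normValues → ℂ) (t : ℝ) : ℂ :=
  if h : t ∈ normValues then ρ ⟨t, h⟩ else 0

/-- The growth and decay conditions on `ρ`; here `ENNReal.log` is the extended logarithm, with
`log 0 = -∞`, and the upper limits are taken in `[-∞, ∞]`. -/
def GrowthDecay (ρ : normValues → ℂ) : Prop :=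
  Filter.limsup (fun n : ℕ => ENNReal.log ‖evalAt ρ (1 / (n : ℝ))‖ₑ / ((Real.log n : ℝ) : EReal))
      Filter.atTop ≤ 1 ∧
  Filter.limsup (fun n : ℕ => ENNReal.log ‖evalAt ρ (n : ℝ)‖ₑ / ((Real.log n : ℝ) : EReal))
      Filter.atTop = ⊥

section Integral

variable {K : Type*} [Field K] [ValuativeRel K] [TopologicalSpace K]
  [IsNonarchimedeanLocalField K] [MeasurableSpace K] [BorelSpace K] {N : ℕ}

/-- `max_{i<j} |x_i - x_j|`. -/
noncomputable def maxDist (x : Fin N → K) : ℝ :=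
  ⨆ p : Pair N, canonicalAbs (x p.1.1 - x p.1.2)

/-- `min_{i<j} |x_i - x_j|`. -/
noncomputable def minDist (x : Fin N → K) : ℝ :=
  ⨅ p : Pair N, canonicalAbs (x p.1.1 - x p.1.2)

/-- The integrand of `Z_N^ρ(K, a, b, s)`. -/
noncomputable def integrand (ρ : normValues → ℂ) (a b : ℂ) (s : Pair N → ℂ) (x : Fin N → K) : ℂ :=
  evalAt ρ (supNorm x) * (maxDist x : ℂ) ^ a * (minDist x : ℂ) ^ b *
    ∏ p : Pair N, (canonicalAbs (x p.1.1 - x p.1.2) : ℂ) ^ s p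

variable (K)

/-- `Z_N^ρ(K, a, b, s)`. -/
noncomputable def Z (ρ : normValues → ℂ) (a b : ℂ) (s : Pair N → ℂ) : ℂ :=
  ∫ x : Fin N → K, integrand ρ a b s x ∂(haarPi K N)

end Integral

/-- The terms `ρ(q^m) q^(mz)` of the series in the root function. -/
noncomputable def rootTerm (q : ℕ) (ρ : normValues → ℂ) (z : ℂ) (m : ℤ) : ℂ :=
  evalAt ρ ((q : ℝ) ^ m) * (q : ℂ) ^ ((m : ℂ) * z)

/-- The root function `H_q^ρ(z)`. -/
noncomputable def rootFun (q : ℕ) (ρ : normValues → ℂ) (z : ℂ) : ℂ :=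
  (1 - (q : ℂ) ^ (-z)) / (1 - (q : ℂ) ^ (-(z - 1))) * ∑' m : ℤ, rootTerm q ρ z m

/-! ### Splitting filtrations -/

/-- A splitting filtration of order `N`: a strictly decreasing tuple (for refinement) of
partitions of `[N]` from the one-part partition to the partition into singletons. -/
@[ext]
structure SplittingFiltration (N : ℕ) where
  length : ℕ
  level : Fin (length + 1) → Finpartition (Finset.univ : Finset (Fin N))
  level_strictAnti : StrictAnti level
  level_zero : (level 0).parts = {Finset.univ}
  level_last : level (Fin.last length) = ⊥

namespace SplittingFiltration

variable {N : ℕ}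

instance finite : Finite (SplittingFiltration N) := by
  have hlt (π : SplittingFiltration N) :
      π.length < Fintype.card (Finpartition (Finset.univ : Finset (Fin N))) := by
    have h := Fintype.card_le_of_injective _ π.level_strictAnti.injective
    rw [Fintype.card_fin] at h
    exact h
  refine Finite.of_injective
    (β := Σ L : Fin (Fintype.card (Finpartition (Finset.univ : Finset (Fin N)))),
      Fin (L.1 + 1) → Finpartition (Finset.univ : Finset (Fin N)))
    (fun π => ⟨⟨π.length, hlt π⟩, π.level⟩) ?_
  rintro ⟨L, l, h1, h2, h3⟩ ⟨L', l', h1', h2', h3'⟩ h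
  simp only [Sigma.mk.injEq, Fin.mk.injEq] at h
  obtain ⟨rfl, h⟩ := h
  obtain rfl := eq_of_heq h
  rfl

noncomputable instance : Fintype (SplittingFiltration N) := Fintype.ofFinite _

variable (π : SplittingFiltration N)

/-- The set `ℬ(π)` of branches: the parts with more than one element of the levels
`level 0, …, level (L - 1)`. -/
def branches : Finset (Finset (Fin N)) :=
  Finset.univ.filter fun lam => (∃ l : Fin π.length, lam ∈ (π.level l.castSucc).parts) ∧ 1 < lam.card

/-- `π` is reduced if each branch lies in exactly one level. -/
def IsReduced : Prop :=
  ∀ lam ∈ π.branches, ∃! l : Fin π.length, lam ∈ (π.level l.castSucc).parts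

/-- The indices of the levels containing `lam`. -/
def levelsOf (lam : Finset (Fin N)) : Finset (Fin π.length) :=
  Finset.univ.filter fun l => lam ∈ (π.level l.castSucc).parts

theorem levelsOf_nonempty (lam : π.branches) : (π.levelsOf lam).Nonempty := by
  obtain ⟨l, hl⟩ := (Finset.mem_filter.mp lam.2).2.1
  exact ⟨l, Finset.mem_filter.mpr ⟨Finset.mem_univ _, hl⟩⟩

/-- The branch depth: the largest index of a level containing `lam`. -/
def depth (lam : π.branches) : Fin π.length :=
  (π.levelsOf lam).max' (π.levelsOf_nonempty lam)

/-- The branch degree: the number of parts of the level after the last one containing `lam` that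
are contained in `lam`. -/
def deg (lam : π.branches) : ℕ :=
  ((π.level (π.depth lam).succ).parts.filter fun lam' => lam' ⊆ lam.1).card

/-- The multiplicity `M_{π,q}`, a product of falling factorials. -/
def mult (q : ℕ) : ℕ := ∏ lam : π.branches, (q - 1).descFactorial (π.deg lam - 1)

/-- The rank `N - #(level l)` of the level `l`. -/
noncomputable def rank (l : Fin π.length) : ℝ := (N : ℝ) - ((π.level l.castSucc).parts.card : ℝ)

/-- `ℬ(π) ∩ (level l)`. -/
def branchesAt (l : Fin π.length) : Finset (Finset (Fin N)) :=
  π.branches ∩ (π.level l.castSucc).parts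

/-- `ℬ(π)` without the branch `[N]`. -/
def properBranches : Finset (Finset (Fin N)) := π.branches \ {Finset.univ}

end SplittingFiltration

open Classical in
/-- The set `ℛ_N` of reduced splitting filtrations. -/
noncomputable def reducedFiltrations (N : ℕ) : Finset (SplittingFiltration N) :=
  Finset.univ.filter fun π => π.IsReduced

section Functions

variable {N : ℕ}

/-- The pairs `i < j` with `i, j ∈ lam`. -/
def pairsIn (lam : Finset (Fin N)) : Finset (Pair N) :=
  Finset.univ.filter fun p => p.1.1 ∈ lam ∧ p.1.2 ∈ lam

/-- The branch exponent `e_lam(s)`. -/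
noncomputable def branchExponent (lam : Finset (Fin N)) (s : Pair N → ℂ) : ℂ :=
  ((lam.card : ℂ) - 1) + ∑ p ∈ pairsIn lam, s p

/-- The branch function `I_{π,q}(s)`. -/
noncomputable def branchFun (π : SplittingFiltration N) (q : ℕ) (s : Pair N → ℂ) : ℂ :=
  (π.mult q : ℂ) / (q : ℂ) ^ (N - 1) *
    ∏ lam ∈ π.properBranches, 1 / ((q : ℂ) ^ branchExponent lam s - 1)

/-- The level exponent `E_{π,l}(s)`. -/
noncomputable def levelExponent (π : SplittingFiltration N) (l : Fin π.length)
    (s : Pair N → ℂ) : ℂ :=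
  ∑ lam ∈ π.branchesAt l, branchExponent lam s

/-- The level function `J_{π,q}(b, s)`; the product is over `1 ≤ l ≤ L(π) - 1`. -/
noncomputable def levelFun (π : SplittingFiltration N) (q : ℕ) (b : ℂ) (s : Pair N → ℂ) : ℂ :=
  (π.mult q : ℂ) / (q : ℂ) ^ (N - 1) *
    ∏ l : Fin π.length with 1 ≤ l.val, 1 / ((q : ℂ) ^ (b + levelExponent π l s) - 1)

end Functions

/-! ### Abscissae

They take values in `[-∞, ∞]`, since an infimum over an empty index set is `+∞`. -/

section Abscissae

variable {N : ℕ} (c : Fin N → ℝ)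

/-- The tuple `(q_i q_j)_{i<j}` of products of the charges. -/
def chargeProd (p : Pair N) : ℝ := c p.1.1 * c p.1.2

/-- `ε_lam`: the sum of `q_i q_j` over `i < j` in `lam`. -/
def eps (lam : Finset (Fin N)) : ℝ := ∑ p ∈ pairsIn lam, chargeProd c p

/-- The root abscissa. -/
noncomputable def rootAbscissa (a b : ℂ) : EReal :=
  ((-(((N : ℝ) - 1 + (a + b).re) / ∑ p : Pair N, chargeProd c p) : ℝ) : EReal)

/-- The branch abscissa. -/
noncomputable def branchAbscissa (π : SplittingFiltration N) : EReal :=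
  -⨅ lam ∈ π.properBranches, ((((lam.card : ℝ) - 1) / eps c lam : ℝ) : EReal)

/-- The level abscissa; the infimum is over `1 ≤ l ≤ L(π) - 1`. -/
noncomputable def levelAbscissa (π : SplittingFiltration N) (b : ℂ) : EReal :=
  -⨅ (l : Fin π.length) (_ : 1 ≤ l.val),
    (((π.rank l + b.re) / ∑ lam ∈ π.branchesAt l, eps c lam : ℝ) : EReal)

/-- The point `β c` of `ℂ^(N choose 2)` with coordinates `q_i q_j β`. -/
noncomputable def scaled (β : ℂ) (p : Pair N) : ℂ := (chargeProd c p : ℂ) * β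

end Abscissae

end LogCoulomb

/-! The integral is reduced to the unit polydisc $R^N$, where the integrand is self-similar under
expansion in digits; iterating the self-similarity produces the splitting filtrations.

Reduction. Apart from $\rho(\|x\|)$ the integrand is homogeneous of degree $w=a+b+\sum s_p$ under
powers of the uniformizer. Cutting $K^N$ into spheres $\|x\|=q^m$, each a ball minus the next
smaller ball, gives $(1-q^{-z})\sum_m\rho(q^m)q^{mz}$ times the integral over $R^N$, with $z=N+w$
(`integral_supNorm_mul`). The growth conditions on $\rho$ make the series converge absolutely for
$\operatorname{Re}z>1$ (`summable_rootTerm`).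

Self-similarity. For a partition $P$ let $F_P$ be the `potential` that keeps only the pairs inside
parts of $P$. Write $x=d+\varpi y$ with digits $d$. A pair with different digits is at distance 1,
and a pair with equal digits is at $q^{-1}$ times its distance in $y$. Hence
$F_P(x)=q^{-w(Q)}F_Q(y)$, where $Q$ refines $P$ by the colouring $d$ (`potential_digitEquiv`). Put
$B(P)=q^{-w(P)}\int F_P$ and $h(P)=q^{N-\#P+w(P)}$. Exactly $q^{\#P}\prod_{\lambda\in
P}(q-1)_{k_\lambda-1}$ colourings refine $P$ to a given $Q$, where $k_\lambda$ is the number of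
parts of $Q$ inside $\lambda$ (`card_refineBy_eq`). Moving the term $Q=P$ to the left gives
$(h(P)-1)B(P)=\sum_{Q<P}\mathrm{stepMult}(P,Q)B(Q)$ with $B(\bot)=1$. Unrolled from the one-part
partition, this is a sum over strict chains, that is, over splitting filtrations
(`eq_sum_of_recursion`). The root level contributes $1/(q^{z-1}-1)$, which combines with the
denominator of $H_q^\rho$ to leave $q^{-(N-1)}$ (`root_factor`).

Reduced form. When $b=0$, $h(P)$ is a product of factors $g(\lambda)$ over the branches of $P$. A
function `treeFun` of single branches is defined by recursion on their size, and its product over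
the parts solves the recursion for $B$, which has only one solution. The same product also solves a
recursion in which every step splits all branches at once, and the chains of that recursion are the
reduced filtrations (`eq_sum_reducedFiltrations`).

Convergence. In the inequality for integrals of $|F_P|$, truncated away from the diagonals, the
self-coefficient is $q^{-\operatorname{Re}(N-\#P+w(P))}$. It is less than 1 for every $P\ne\bot$
because every $P$ is a level of some filtration with $M_{\pi,q}>0$, and for (b) every proper branch
occurs in such a reduced filtration; so the abscissae control all the exponents. -/

namespace LogCoulomb

open MeasureTheory ValuativeRel Topology
open scoped Pointwise

set_option linter.unusedSectionVars false

/-! ### Uniformizer, digits and topology of the local field -/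

section FieldStructure

variable (K : Type*) [Field K] [ValuativeRel K] [TopologicalSpace K]
  [IsNonarchimedeanLocalField K]

/-- A uniformizer of `K`. -/
noncomputable def uniformizer : K :=
  ((IsDiscreteValuationRing.exists_irreducible 𝒪[K]).choose : 𝒪[K])

/-- A system of representatives for the residue field. -/
noncomputable def digit (t : 𝓀[K]) : K :=
  (Function.surjInv (IsLocalRing.residue_surjective (R := 𝒪[K])) t : 𝒪[K])

variable {K}

theorem mem_integers_iff {x : K} : x ∈ 𝒪[K] ↔ valuation K x ≤ 1 := Iff.rfl

theorem uniformizer_mem : uniformizer K ∈ 𝒪[K] := Subtype.prop _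

theorem uniformizer_ne_zero : uniformizer K ≠ 0 := by
  have h := (IsDiscreteValuationRing.exists_irreducible 𝒪[K]).choose_spec.ne_zero
  simpa [uniformizer] using h

theorem digit_mem (t : 𝓀[K]) : digit K t ∈ 𝒪[K] := Subtype.prop _

theorem residue_digit (t : 𝓀[K]) :
    IsLocalRing.residue 𝒪[K] ⟨digit K t, digit_mem t⟩ = t :=
  Function.surjInv_eq _ t

theorem residue_eq_zero_iff_uniformizer_dvd (x : 𝒪[K]) :
    IsLocalRing.residue 𝒪[K] x = 0 ↔ ∃ y ∈ 𝒪[K], (x : K) = uniformizer K * y := by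
  rw [IsLocalRing.residue_eq_zero_iff,
    (IsDiscreteValuationRing.exists_irreducible 𝒪[K]).choose_spec.maximalIdeal_eq,
    Ideal.mem_span_singleton']
  constructor
  · rintro ⟨y, rfl⟩
    exact ⟨y, y.2, by simp [uniformizer, mul_comm]⟩
  · rintro ⟨y, hy, h⟩
    exact ⟨⟨y, hy⟩, Subtype.ext (by simp [h, uniformizer, mul_comm])⟩

theorem exists_digit_add {x : K} (hx : x ∈ 𝒪[K]) :
    ∃ t, ∃ y ∈ 𝒪[K], x = digit K t + uniformizer K * y := by
  set x' : 𝒪[K] := ⟨x, hx⟩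
  refine ⟨IsLocalRing.residue 𝒪[K] x', ?_⟩
  have h : IsLocalRing.residue 𝒪[K]
      (x' - ⟨digit K (IsLocalRing.residue 𝒪[K] x'), digit_mem _⟩) = 0 := by
    rw [map_sub, residue_digit, sub_self]
  obtain ⟨y, hy, h⟩ := (residue_eq_zero_iff_uniformizer_dvd _).1 h
  refine ⟨y, hy, ?_⟩
  rw [← h]
  simp [x']

theorem digit_add_mem (t : 𝓀[K]) {y : K} (hy : y ∈ 𝒪[K]) :
    digit K t + uniformizer K * y ∈ 𝒪[K] :=
  add_mem (digit_mem t) (mul_mem uniformizer_mem hy)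

theorem valuation_uniformizer_lt_one : valuation K (uniformizer K) < 1 := by
  refine lt_of_le_of_ne uniformizer_mem fun h => ?_
  have hirr := (IsDiscreteValuationRing.exists_irreducible 𝒪[K]).choose_spec
  apply hirr.not_isUnit
  rw [Valuation.Integers.isUnit_iff_valuation_eq_one (Valuation.integer.integers (valuation K))]
  exact h

/-- The difference has residue $t-t'\ne0$, so it is a unit of the ring of integers. -/
theorem valuation_digit_sub {t t' : 𝓀[K]} (h : t ≠ t') {y y' : K} (hy : y ∈ 𝒪[K])
    (hy' : y' ∈ 𝒪[K]) :
    valuation K (digit K t + uniformizer K * y - (digit K t' + uniformizer K * y')) = 1 := by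
  set z : 𝒪[K] := ⟨digit K t, digit_mem t⟩ + ⟨uniformizer K, uniformizer_mem⟩ * ⟨y, hy⟩ -
    (⟨digit K t', digit_mem t'⟩ + ⟨uniformizer K, uniformizer_mem⟩ * ⟨y', hy'⟩)
  have hu : IsLocalRing.residue 𝒪[K] ⟨uniformizer K, uniformizer_mem⟩ = 0 :=
    (residue_eq_zero_iff_uniformizer_dvd _).2 ⟨1, one_mem _, by simp⟩
  have hz : IsUnit z := by
    rw [← IsLocalRing.residue_ne_zero_iff_isUnit]
    simp only [z, map_sub, map_add, map_mul, residue_digit, hu, zero_mul, add_zero]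
    exact sub_ne_zero.2 h
  rw [Valuation.Integers.isUnit_iff_valuation_eq_one
    (Valuation.integer.integers (valuation K))] at hz
  exact hz

theorem exists_zpow_mul_unit {x : K} (hx : x ≠ 0) :
    ∃ (n : ℤ) (u : K), valuation K u = 1 ∧ x = uniformizer K ^ n * u := by
  have key : ∀ x : K, x ≠ 0 → x ∈ 𝒪[K] →
      ∃ (n : ℤ) (u : K), valuation K u = 1 ∧ x = uniformizer K ^ n * u := by
    intro x hx hxR
    obtain ⟨n, u, h⟩ := IsDiscreteValuationRing.eq_unit_mul_pow_irreducible
      (x := (⟨x, hxR⟩ : 𝒪[K])) (by simpa using hx)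
      (IsDiscreteValuationRing.exists_irreducible 𝒪[K]).choose_spec
    refine ⟨n, (u : 𝒪[K]), ?_, ?_⟩
    · exact (Valuation.Integers.isUnit_iff_valuation_eq_one
        (Valuation.integer.integers (valuation K))).1 u.isUnit
    · have := congrArg (Subtype.val) h
      simpa [uniformizer, mul_comm] using this
  by_cases h : x ∈ 𝒪[K]
  · exact key x hx h
  · have h' : x⁻¹ ∈ 𝒪[K] := by
      rw [mem_integers_iff, map_inv₀]
      rw [mem_integers_iff, not_le] at h
      exact inv_le_one_of_one_le₀ h.le
    obtain ⟨n, u, hu, h2⟩ := key _ (inv_ne_zero hx) h'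
    refine ⟨-n, u⁻¹, by simp [hu], ?_⟩
    rw [← inv_inv x, h2, mul_inv, zpow_neg]

/-- The fractional ideal generated by a power of the uniformizer. -/
def ballSet (K : Type*) [Field K] [ValuativeRel K] [TopologicalSpace K]
    [IsNonarchimedeanLocalField K] (n : ℤ) : Set K :=
  {x | valuation K x ≤ valuation K (uniformizer K) ^ n}

theorem valuation_uniformizer_pos : 0 < valuation K (uniformizer K) :=
  zero_lt_iff.2 ((valuation K).ne_zero_iff.2 uniformizer_ne_zero)

theorem ballSet_zero : ballSet K 0 = (𝒪[K] : Set K) := by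
  ext x; simp [ballSet, mem_integers_iff]

theorem ballSet_antitone : Antitone (ballSet K) := fun _ _ hmn x hx =>
  le_trans (show valuation K x ≤ _ from hx) (zpow_le_zpow_right_of_le_one₀ valuation_uniformizer_pos
    valuation_uniformizer_lt_one.le hmn)

theorem isCompact_ballSet (n : ℤ) : IsCompact (ballSet K n) := by
  have := IsNonarchimedeanLocalField.isCompact_closedBall K (valuation K (uniformizer K) ^ n)
  exact this

theorem ballSet_mem_nhds (n : ℤ) : ballSet K n ∈ 𝓝 (0 : K) := by
  refine (IsValuativeTopology.mem_nhds_zero_iff _).2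
    ⟨Units.mk0 (valuation K (uniformizer K) ^ n) (zpow_pos valuation_uniformizer_pos n).ne', ?_⟩
  intro x hx
  have : valuation K x < valuation K (uniformizer K) ^ n := by simpa using hx
  exact this.le

theorem isOpen_ballSet (n : ℤ) : IsOpen (ballSet K n) := by
  let H : AddSubgroup K :=
    { carrier := ballSet K n
      zero_mem' := by simp [ballSet]
      add_mem' := fun hx hy => le_trans ((valuation K).map_add _ _) (max_le hx hy)
      neg_mem' := fun hx => by simpa [ballSet, Valuation.map_neg] using hx }
  exact H.isOpen_of_mem_nhds (g := 0) (ballSet_mem_nhds n)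

theorem nhds_zero_hasBasis : (𝓝 (0 : K)).HasBasis (fun _ : ℕ => True) (fun n => ballSet K n) := by
  refine ⟨fun s => ⟨fun hs => ?_, fun ⟨n, _, hn⟩ => Filter.mem_of_superset (ballSet_mem_nhds n) hn⟩⟩
  obtain ⟨γ, hγ⟩ := (IsValuativeTopology.mem_nhds_zero_iff _).1 hs
  obtain ⟨r, hr⟩ := ValuativeRel.valuation_surjective γ.1
  have hr0 : r ≠ 0 := by
    rintro rfl
    exact γ.ne_zero (by rw [← hr, map_zero])
  obtain ⟨n, u, hu, rfl⟩ := exists_zpow_mul_unit hr0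
  -- The basic neighbourhood is given by a strict inequality, so the exponent $n$ of $r$ must be
  -- raised by one; truncating at 0 only shrinks the ball.
  refine ⟨(n + 1).toNat, trivial, fun x hx => hγ ?_⟩
  have h1 : valuation K x ≤ valuation K (uniformizer K) ^ (n + 1) :=
    ballSet_antitone (Int.self_le_toNat (n + 1)) hx
  have h2 : valuation K x < γ.1 := by
    rw [← hr, map_mul, hu, mul_one, map_zpow₀]
    exact h1.trans_lt (zpow_lt_zpow_right_of_lt_one₀ valuation_uniformizer_pos
      valuation_uniformizer_lt_one (by omega))
  simpa using h2

theorem exists_mem_ballSet (x : K) : ∃ n : ℕ, x ∈ ballSet K (-(n : ℤ)) := by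
  by_cases hx : x = 0
  · exact ⟨0, by simp [hx, ballSet]⟩
  obtain ⟨n, u, hu, rfl⟩ := exists_zpow_mul_unit hx
  refine ⟨(-n).toNat, ?_⟩
  have : uniformizer K ^ n * u ∈ ballSet K n := by simp [ballSet, hu]
  exact ballSet_antitone (by omega) this

instance sigmaCompactSpace : SigmaCompactSpace K :=
  ⟨⟨fun n => ballSet K (-(n : ℤ)), fun _ => isCompact_ballSet _,
    Set.eq_univ_of_forall fun x => Set.mem_iUnion.2 (exists_mem_ballSet x)⟩⟩

/-- Second countability makes subtraction jointly measurable, hence the distances $|x_i-x_j|$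
measurable on $K^N$. -/
instance secondCountableTopology : SecondCountableTopology K := by
  let := IsTopologicalAddGroup.rightUniformSpace K
  have := isUniformAddGroup_of_addCommGroup (G := K)
  have : (𝓝 (0 : K)).IsCountablyGenerated := nhds_zero_hasBasis.isCountablyGenerated
  have : (uniformity K).IsCountablyGenerated := IsUniformAddGroup.uniformity_countably_generated
  let := UniformSpace.pseudoMetricSpace K
  exact EMetric.secondCountable_of_sigmaCompact K

/-! ### Haar measure and the canonical absolute value -/

variable [MeasurableSpace K] [BorelSpace K]

instance isAddHaarMeasure_haar : (haar K).IsAddHaarMeasure := by unfold haar; infer_instance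

instance regular_haar : (haar K).Regular := by unfold haar; infer_instance

instance sigmaFinite_haar : SigmaFinite (haar K) := by unfold haar; infer_instance

theorem haar_integers : haar K (𝒪[K] : Set K) = 1 := Measure.addHaarMeasure_self

variable (K) in
/-- The cardinality of the residue field. -/
noncomputable abbrev residueCard : ℕ := Nat.card 𝓀[K]

omit [MeasurableSpace K] [BorelSpace K] in
theorem one_lt_residueCard : 1 < residueCard K := Finite.one_lt_card

omit [MeasurableSpace K] [BorelSpace K] in
theorem residueCard_pos : (0 : ℝ) < residueCard K := by
  exact_mod_cast zero_lt_one.trans (one_lt_residueCard (K := K))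

theorem canonicalAbs_eq_distribHaarChar (x : Kˣ) :
    canonicalAbs (x : K) = distribHaarChar K x := by
  have h : (fun y : K => (x : K) * y) '' (𝒪[K] : Set K) = x • (𝒪[K] : Set K) := rfl
  rw [canonicalAbs, h, ← distribHaarChar_mul (haar K), haar_integers]
  simp

theorem haar_smul (x : Kˣ) (s : Set K) :
    haar K (x • s) = ENNReal.ofReal (canonicalAbs (x : K)) * haar K s := by
  rw [canonicalAbs_eq_distribHaarChar, ← distribHaarChar_mul (haar K)]
  simp

theorem canonicalAbs_pos {x : K} (hx : x ≠ 0) : 0 < canonicalAbs x := by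
  have := canonicalAbs_eq_distribHaarChar (Units.mk0 x hx)
  rw [Units.val_mk0] at this
  rw [this]
  exact_mod_cast distribHaarChar_pos

theorem canonicalAbs_nonneg (x : K) : 0 ≤ canonicalAbs x := ENNReal.toReal_nonneg

theorem canonicalAbs_of_valuation_eq_one {u : K} (hu : valuation K u = 1) :
    canonicalAbs u = 1 := by
  have h : (fun y : K => u * y) '' (𝒪[K] : Set K) = (𝒪[K] : Set K) := by
    ext x
    constructor
    · rintro ⟨y, hy, rfl⟩
      exact mul_mem (mem_integers_iff.2 hu.le) hy
    · intro hx
      have h0 : u ≠ 0 := by rintro rfl; simp at hu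
      exact ⟨u⁻¹ * x, mul_mem (mem_integers_iff.2 (by simp [hu])) hx, by simp [h0]⟩
  rw [canonicalAbs, h, haar_integers]
  simp

/-- $R$ is the disjoint union of $q$ translates of $\varpi R$, one for each digit. -/
theorem haar_uniformizer_smul :
    (residueCard K : ENNReal) * haar K ((Units.mk0 (uniformizer K) uniformizer_ne_zero) •
      (𝒪[K] : Set K)) = 1 := by
  classical
  let := Fintype.ofFinite 𝓀[K]
  set S : Set K := (Units.mk0 (uniformizer K) uniformizer_ne_zero) • (𝒪[K] : Set K) with hS
  have hmem : ∀ x, x ∈ S ↔ ∃ y ∈ 𝒪[K], uniformizer K * y = x := fun x => Iff.rfl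
  have hU : (𝒪[K] : Set K) = ⋃ t : 𝓀[K], (fun x => digit K t + x) '' S := by
    ext x
    simp only [Set.mem_iUnion, Set.mem_image, hmem]
    constructor
    · intro hx
      obtain ⟨t, y, hy, rfl⟩ := exists_digit_add hx
      exact ⟨t, _, ⟨y, hy, rfl⟩, rfl⟩
    · rintro ⟨t, _, ⟨y, hy, rfl⟩, rfl⟩
      exact digit_add_mem t hy
  have hSo : IsOpen S := by
    have : IsOpen (𝒪[K] : Set K) := ballSet_zero (K := K) ▸ isOpen_ballSet 0
    exact this.smul _
  rw [← haar_integers (K := K), hU, measure_iUnion]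
  · simp_rw [Set.image_add_left, measure_preimage_add]
    simp
  · intro t t' htt'
    refine Set.disjoint_left.2 ?_
    rintro _ ⟨_, ⟨y, hy, rfl⟩, rfl⟩ ⟨_, ⟨y', hy', rfl⟩, h⟩
    have := valuation_digit_sub htt' hy hy'
    have h' : digit K t' + uniformizer K * y' = digit K t + uniformizer K * y := h
    simp [h'] at this
  · intro t
    exact ((Homeomorph.addLeft (digit K t)).isOpenMap _ hSo).measurableSet

theorem canonicalAbs_uniformizer : canonicalAbs (uniformizer K) = (residueCard K : ℝ)⁻¹ := by
  have h := haar_uniformizer_smul (K := K)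
  rw [haar_smul, haar_integers, mul_one] at h
  have h2 := congrArg ENNReal.toReal h
  rw [ENNReal.toReal_mul, ENNReal.toReal_ofReal (canonicalAbs_nonneg _)] at h2
  simp only [ENNReal.toReal_natCast, ENNReal.toReal_one, Units.val_mk0] at h2
  exact eq_inv_of_mul_eq_one_right h2

/-- Multiplication by $\varpi$ fixes $\{0\}$ but multiplies its measure, which is finite, by
$q^{-1}\neq1$. -/
theorem haar_singleton_zero : haar K {(0 : K)} = 0 := by
  have h1 : haar K {(0 : K)} ≠ ⊤ := by
    refine ne_top_of_le_ne_top (b := haar K (𝒪[K] : Set K)) (by simp [haar_integers]) ?_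
    exact measure_mono (by simp)
  have h2 := haar_smul (Units.mk0 (uniformizer K) uniformizer_ne_zero) {(0 : K)}
  rw [Set.smul_set_singleton, smul_zero, Units.val_mk0, canonicalAbs_uniformizer] at h2
  by_contra h0
  have h3 : ENNReal.ofReal (residueCard K : ℝ)⁻¹ = 1 := by
    have := ENNReal.mul_left_inj (c := haar K {(0 : K)}) h0 h1
      (a := ENNReal.ofReal (residueCard K : ℝ)⁻¹) (b := 1)
    rw [one_mul] at this
    exact this.1 h2.symm
  rw [ENNReal.ofReal_eq_one, inv_eq_one] at h3
  have := one_lt_residueCard (K := K)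
  rw [Nat.cast_eq_one] at h3
  omega

theorem canonicalAbs_zero : canonicalAbs (0 : K) = 0 := by
  have h : (fun y : K => 0 * y) '' (𝒪[K] : Set K) ⊆ {0} := by rintro _ ⟨y, _, rfl⟩; simp
  rw [canonicalAbs, measure_mono_null h haar_singleton_zero]
  simp

theorem canonicalAbs_mul (x y : K) : canonicalAbs (x * y) = canonicalAbs x * canonicalAbs y := by
  by_cases hx : x = 0
  · simp [hx, canonicalAbs_zero]
  by_cases hy : y = 0
  · simp [hy, canonicalAbs_zero]
  have := canonicalAbs_eq_distribHaarChar (Units.mk0 x hx * Units.mk0 y hy)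
  rw [map_mul, NNReal.coe_mul, ← canonicalAbs_eq_distribHaarChar,
    ← canonicalAbs_eq_distribHaarChar] at this
  simpa using this

theorem canonicalAbs_uniformizer_zpow (n : ℤ) :
    canonicalAbs (uniformizer K ^ n) = (residueCard K : ℝ) ^ (-n) := by
  have := canonicalAbs_eq_distribHaarChar (Units.mk0 (uniformizer K) uniformizer_ne_zero ^ n)
  rw [map_zpow, NNReal.coe_zpow, ← canonicalAbs_eq_distribHaarChar, Units.val_mk0,
    canonicalAbs_uniformizer, inv_zpow, ← zpow_neg] at this
  simpa using this

theorem canonicalAbs_le_zpow_iff (x : K) (n : ℤ) :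
    canonicalAbs x ≤ (residueCard K : ℝ) ^ (-n) ↔ x ∈ ballSet K n := by
  by_cases hx : x = 0
  · simp only [hx, canonicalAbs_zero, ballSet, Set.mem_ofPred_eq, map_zero, zero_le, iff_true]
    exact zpow_nonneg residueCard_pos.le _
  obtain ⟨m, u, hu, rfl⟩ := exists_zpow_mul_unit hx
  rw [canonicalAbs_mul, canonicalAbs_of_valuation_eq_one hu, mul_one,
    canonicalAbs_uniformizer_zpow, zpow_le_zpow_iff_right₀
      (by exact_mod_cast one_lt_residueCard (K := K)), neg_le_neg_iff]
  simp only [ballSet, Set.mem_ofPred_eq, map_mul, hu, mul_one, map_zpow₀]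
  exact (zpow_le_zpow_iff_right_of_lt_one₀ valuation_uniformizer_pos
    valuation_uniformizer_lt_one).symm

theorem canonicalAbs_eq_zero_or (x : K) :
    canonicalAbs x = 0 ∨ ∃ n : ℤ, canonicalAbs x = (residueCard K : ℝ) ^ n := by
  by_cases hx : x = 0
  · exact Or.inl (by rw [hx, canonicalAbs_zero])
  obtain ⟨m, u, hu, rfl⟩ := exists_zpow_mul_unit hx
  right
  exact ⟨-m, by rw [canonicalAbs_mul, canonicalAbs_of_valuation_eq_one hu, mul_one,
    canonicalAbs_uniformizer_zpow]⟩

theorem canonicalAbs_le_one_iff (x : K) : canonicalAbs x ≤ 1 ↔ x ∈ 𝒪[K] := by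
  have := canonicalAbs_le_zpow_iff x 0
  rwa [neg_zero, zpow_zero, ballSet_zero] at this

theorem canonicalAbs_uniformizer_mul (x : K) :
    canonicalAbs (uniformizer K * x) = (residueCard K : ℝ)⁻¹ * canonicalAbs x := by
  rw [canonicalAbs_mul, canonicalAbs_uniformizer]

theorem canonicalAbs_digit_sub {t t' : 𝓀[K]} (h : t ≠ t') {y y' : K} (hy : y ∈ 𝒪[K])
    (hy' : y' ∈ 𝒪[K]) :
    canonicalAbs (digit K t + uniformizer K * y - (digit K t' + uniformizer K * y')) = 1 :=
  canonicalAbs_of_valuation_eq_one (valuation_digit_sub h hy hy')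

/-- The absolute value takes values in $\{0\}\cup q^{\mathbb Z}$, so each sublevel set is empty, a
countable intersection of balls, or such an intersection together with a countable union of balls.
-/
theorem measurable_canonicalAbs : Measurable (canonicalAbs : K → ℝ) := by
  refine measurable_of_Iic fun t => ?_
  have hz : MeasurableSet {x : K | canonicalAbs x ≤ 0} := by
    have : {x : K | canonicalAbs x ≤ 0} = ⋂ n : ℕ, ballSet K n := by
      ext x
      simp only [Set.mem_ofPred_eq, Set.mem_iInter, ← canonicalAbs_le_zpow_iff]
      refine ⟨fun h n => h.trans (zpow_nonneg residueCard_pos.le _), fun h => ?_⟩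
      have hlim : Filter.Tendsto (fun n : ℕ => (residueCard K : ℝ) ^ (-(n : ℤ))) Filter.atTop
          (𝓝 0) := by
        simp_rw [zpow_neg, zpow_natCast, ← inv_pow]
        exact tendsto_pow_atTop_nhds_zero_of_lt_one (inv_nonneg.2 residueCard_pos.le)
          (inv_lt_one_of_one_lt₀ (by exact_mod_cast one_lt_residueCard (K := K)))
      exact ge_of_tendsto' hlim h
    rw [this]
    exact MeasurableSet.iInter fun n => (isOpen_ballSet _).measurableSet
  rcases lt_trichotomy t 0 with ht | ht | ht
  · convert MeasurableSet.empty
    ext x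
    simpa using ht.trans_le (canonicalAbs_nonneg x)
  · subst ht; exact hz
  · have : canonicalAbs ⁻¹' Set.Iic t = {x : K | canonicalAbs x ≤ 0} ∪
        ⋃ n : {n : ℤ // (residueCard K : ℝ) ^ (-n) ≤ t}, ballSet K n := by
      ext x
      simp only [Set.mem_preimage, Set.mem_Iic, Set.mem_union, Set.mem_ofPred_eq, Set.mem_iUnion,
        ← canonicalAbs_le_zpow_iff]
      constructor
      · intro h
        rcases canonicalAbs_eq_zero_or x with h0 | ⟨n, hn⟩
        · exact Or.inl h0.le
        · exact Or.inr ⟨⟨-n, by rwa [neg_neg, ← hn]⟩, by simp [hn]⟩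
      · rintro (h | ⟨n, hn⟩)
        · exact h.trans ht.le
        · exact hn.trans n.2
    rw [this]
    exact hz.union (MeasurableSet.iUnion fun n => (isOpen_ballSet _).measurableSet)

end FieldStructure

end LogCoulomb

namespace LogCoulomb

open MeasureTheory ValuativeRel Topology
open scoped Pointwise

set_option linter.unusedSectionVars false

/-! ### Product measure, its self-similarity under digits, and spheres in $K^N$ -/

section ProductMeasure

variable {K : Type*} [Field K] [ValuativeRel K] [TopologicalSpace K]
  [IsNonarchimedeanLocalField K] [MeasurableSpace K] [BorelSpace K] {N : ℕ}

instance sigmaFinite_haarPi : SigmaFinite (haarPi K N) := by unfold haarPi; infer_instance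

/-- The map `y ↦ v + c y` on `K`. -/
noncomputable def affineEquivOne (v : K) (c : Kˣ) : K ≃ᵐ K :=
  ((Homeomorph.mulLeft₀ (c : K) c.ne_zero).trans (Homeomorph.addLeft v)).toMeasurableEquiv

/-- The map `y ↦ v + c y` on `K^N`. -/
noncomputable def affineEquiv (v : Fin N → K) (c : Kˣ) : (Fin N → K) ≃ᵐ (Fin N → K) :=
  MeasurableEquiv.piCongrRight fun i => affineEquivOne (v i) c

theorem affineEquivOne_apply (v : K) (c : Kˣ) (y : K) : affineEquivOne v c y = v + c * y := rfl

theorem affineEquiv_apply (v : Fin N → K) (c : Kˣ) (y : Fin N → K) (i : Fin N) :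
    affineEquiv v c y i = v i + c * y i := rfl

theorem haar_image_affineEquivOne (v : K) (c : Kˣ) (s : Set K) :
    haar K (affineEquivOne v c '' s) = ENNReal.ofReal (canonicalAbs (c : K)) * haar K s := by
  have : affineEquivOne v c '' s = (fun x => v + x) '' (c • s) := by
    ext x
    simp only [Set.mem_image, affineEquivOne_apply, Set.mem_smul_set]
    constructor
    · rintro ⟨y, hy, rfl⟩; exact ⟨_, ⟨y, hy, rfl⟩, rfl⟩
    · rintro ⟨_, ⟨y, hy, rfl⟩, rfl⟩; exact ⟨y, hy, rfl⟩
  rw [this, Set.image_add_left, measure_preimage_add, haar_smul]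

theorem haarPi_eq_smul_map_affineEquiv (v : Fin N → K) (c : Kˣ) :
    haarPi K N = (ENNReal.ofReal (canonicalAbs (c : K)) ^ N) •
      (haarPi K N).map (affineEquiv v c) := by
  refine Measure.pi_eq fun s hs => ?_
  rw [Measure.smul_apply, (affineEquiv v c).map_apply]
  have : affineEquiv v c ⁻¹' (Set.univ.pi s) =
      Set.univ.pi fun i => affineEquivOne (v i) c ⁻¹' s i := by
    ext x
    simp [affineEquiv_apply, affineEquivOne_apply]
  rw [this, haarPi, Measure.pi_pi, smul_eq_mul]
  have h2 : ∀ i, haar K (s i) = ENNReal.ofReal (canonicalAbs (c : K)) *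
      haar K (affineEquivOne (v i) c ⁻¹' s i) := by
    intro i
    rw [← haar_image_affineEquivOne (v i) c, Set.image_preimage_eq _ (affineEquivOne _ _).surjective]
  simp_rw [h2, Finset.prod_mul_distrib]
  simp

theorem restrict_haarPi_image_affineEquiv (v : Fin N → K) (c : Kˣ) (s : Set (Fin N → K)) :
    (haarPi K N).restrict (affineEquiv v c '' s) = (ENNReal.ofReal (canonicalAbs (c : K)) ^ N) •
      ((haarPi K N).restrict s).map (affineEquiv v c) := by
  conv_lhs => rw [haarPi_eq_smul_map_affineEquiv v c]
  rw [Measure.restrict_smul, (affineEquiv v c).restrict_map,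
    Set.preimage_image_eq _ (affineEquiv v c).injective]

/-- The set `R^N`. -/
def intBox (K : Type*) [Field K] [ValuativeRel K] [TopologicalSpace K]
    [IsNonarchimedeanLocalField K] (N : ℕ) : Set (Fin N → K) := Set.univ.pi fun _ => (𝒪[K] : Set K)

theorem mem_intBox {x : Fin N → K} : x ∈ intBox K N ↔ ∀ i, x i ∈ 𝒪[K] := by
  simp [intBox]

theorem measurableSet_integers : MeasurableSet (𝒪[K] : Set K) :=
  ballSet_zero (K := K) ▸ (isOpen_ballSet 0).measurableSet

theorem measurableSet_intBox : MeasurableSet (intBox K N) :=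
  MeasurableSet.univ_pi fun _ => measurableSet_integers

theorem haarPi_intBox : haarPi K N (intBox K N) = 1 := by
  simp [haarPi, intBox, Measure.pi_pi, haar_integers]

/-- The normalized measure on `R^N`. -/
noncomputable def boxMeasure (K : Type*) [Field K] [ValuativeRel K] [TopologicalSpace K]
    [IsNonarchimedeanLocalField K] [MeasurableSpace K] [BorelSpace K] (N : ℕ) :
    Measure (Fin N → K) := (haarPi K N).restrict (intBox K N)

instance isProbabilityMeasure_boxMeasure : IsProbabilityMeasure (boxMeasure K N) :=
  ⟨by rw [boxMeasure, Measure.restrict_apply_univ, haarPi_intBox]⟩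

theorem ae_mem_intBox : ∀ᵐ x ∂(boxMeasure K N), x ∈ intBox K N :=
  ae_restrict_mem measurableSet_intBox

variable (K) in
/-- The uniformizer as a unit of `K`. -/
noncomputable def unif : Kˣ := Units.mk0 (uniformizer K) uniformizer_ne_zero

/-- The inclusion of the residue polydisc with digits `d`. -/
noncomputable def digitEquiv (d : Fin N → 𝓀[K]) : (Fin N → K) ≃ᵐ (Fin N → K) :=
  affineEquiv (fun i => digit K (d i)) (unif K)

theorem digitEquiv_apply (d : Fin N → 𝓀[K]) (y : Fin N → K) (i : Fin N) :
    digitEquiv d y i = digit K (d i) + uniformizer K * y i := rfl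

noncomputable instance fintypeResidueField : Fintype 𝓀[K] := Fintype.ofFinite _

theorem card_residueField : Fintype.card 𝓀[K] = residueCard K := (Nat.card_eq_fintype_card).symm

theorem ofReal_canonicalAbs_unif :
    ENNReal.ofReal (canonicalAbs (unif K : K)) = (residueCard K : ENNReal)⁻¹ := by
  rw [unif, Units.val_mk0, canonicalAbs_uniformizer, ENNReal.ofReal_inv_of_pos residueCard_pos,
    ENNReal.ofReal_natCast]

/-- $R^N$ is the disjoint union of $q^N$ residue polydiscs, each the image of $R^N$ under a map that
scales measure by $q^{-N}$. All the recursions below integrate over this decomposition. -/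
theorem boxMeasure_eq_sum : boxMeasure K N = ∑ d : Fin N → 𝓀[K],
    ((residueCard K : ENNReal)⁻¹ ^ N) • (boxMeasure K N).map (digitEquiv d) := by
  have hU : intBox K N = ⋃ d : Fin N → 𝓀[K], digitEquiv d '' intBox K N := by
    ext x
    simp only [Set.mem_iUnion, Set.mem_image]
    constructor
    · intro hx
      choose d y hy h using fun i => exists_digit_add (mem_intBox.1 hx i)
      exact ⟨d, y, mem_intBox.2 hy, funext fun i => (h i).symm⟩
    · rintro ⟨d, y, hy, rfl⟩
      exact mem_intBox.2 fun i => digit_add_mem (d i) (mem_intBox.1 hy i)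
  have hd : Pairwise (Function.onFun Disjoint
      fun d : Fin N → 𝓀[K] => digitEquiv d '' intBox K N) := by
    intro d d' hdd
    obtain ⟨i, hi⟩ := Function.ne_iff.1 hdd
    refine Set.disjoint_left.2 ?_
    rintro _ ⟨y, hy, rfl⟩ ⟨y', hy', h⟩
    have h1 := canonicalAbs_digit_sub hi (mem_intBox.1 hy i) (mem_intBox.1 hy' i)
    have h2 := congrFun h i
    rw [digitEquiv_apply, digitEquiv_apply] at h2
    rw [h2, sub_self, canonicalAbs_zero] at h1
    exact zero_ne_one h1
  have hm : ∀ d : Fin N → 𝓀[K], MeasurableSet (digitEquiv d '' intBox K N) := fun d =>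
    (digitEquiv d).measurableSet_image.2 measurableSet_intBox
  conv_lhs => rw [boxMeasure, hU, Measure.restrict_iUnion hd hm]
  rw [Measure.sum_fintype]
  refine Finset.sum_congr rfl fun d _ => ?_
  rw [digitEquiv, restrict_haarPi_image_affineEquiv, ofReal_canonicalAbs_unif]
  rfl

theorem lintegral_boxMeasure (f : (Fin N → K) → ENNReal) :
    ∫⁻ x, f x ∂(boxMeasure K N) = (residueCard K : ENNReal)⁻¹ ^ N *
      ∑ d : Fin N → 𝓀[K], ∫⁻ y, f (digitEquiv d y) ∂(boxMeasure K N) := by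
  conv_lhs => rw [boxMeasure_eq_sum]
  rw [lintegral_finsetSum_measure, Finset.mul_sum]
  refine Finset.sum_congr rfl fun d _ => ?_
  rw [lintegral_smul_measure, lintegral_map_equiv, smul_eq_mul]

theorem integral_boxMeasure {f : (Fin N → K) → ℂ} (hf : Integrable f (boxMeasure K N)) :
    ∫ x, f x ∂(boxMeasure K N) = ((residueCard K : ℂ)⁻¹) ^ N *
      ∑ d : Fin N → 𝓀[K], ∫ y, f (digitEquiv d y) ∂(boxMeasure K N) := by
  have hf' : ∀ d ∈ (Finset.univ : Finset (Fin N → 𝓀[K])), Integrable f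
      (((residueCard K : ENNReal)⁻¹ ^ N) • (boxMeasure K N).map (digitEquiv d)) := by
    rw [boxMeasure_eq_sum] at hf
    exact integrable_finsetSum_measure.1 hf
  conv_lhs => rw [boxMeasure_eq_sum]
  rw [integral_finsetSum_measure hf', Finset.mul_sum]
  refine Finset.sum_congr rfl fun d _ => ?_
  rw [integral_smul_measure, integral_map_equiv]
  simp

theorem measurable_canonicalAbs_sub (i j : Fin N) :
    Measurable fun x : Fin N → K => canonicalAbs (x i - x j) :=
  measurable_canonicalAbs.comp ((measurable_pi_apply i).sub (measurable_pi_apply j))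

/-- The set $x_i=x_j$ is self-similar: it misses the polydiscs with $d_i\ne d_j$ and reproduces
itself in the others. So its measure equals itself times $q^{-N}\#\{d:d_i=d_j\}<1$, and it must
vanish. -/
theorem ae_canonicalAbs_sub_ne_zero {i j : Fin N} (hij : i ≠ j) :
    ∀ᵐ x ∂(boxMeasure K N), canonicalAbs (x i - x j) ≠ 0 := by
  classical
  set S : Set (Fin N → K) := {x | canonicalAbs (x i - x j) = 0} with hSdef
  have hS : MeasurableSet S := measurable_canonicalAbs_sub i j (measurableSet_singleton 0)
  rw [ae_iff]
  simp only [not_not]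
  change boxMeasure K N S = 0
  have h := lintegral_boxMeasure (S.indicator (1 : (Fin N → K) → ENNReal))
  have hd : ∀ d : Fin N → 𝓀[K], ∫⁻ y, S.indicator (1 : (Fin N → K) → ENNReal) (digitEquiv d y)
      ∂(boxMeasure K N) = if d i = d j then boxMeasure K N S else 0 := by
    intro d
    split_ifs with hdd
    · rw [← lintegral_indicator_one hS]
      refine lintegral_congr fun y => ?_
      have : digitEquiv d y ∈ S ↔ y ∈ S := by
        simp only [hSdef, Set.mem_ofPred_eq, digitEquiv_apply, hdd, add_sub_add_left_eq_sub,
          ← mul_sub, canonicalAbs_uniformizer_mul, mul_eq_zero, inv_eq_zero,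
          residueCard_pos.ne', false_or]
      simp [Set.indicator, this]
    · refine lintegral_eq_zero_of_ae_eq_zero ?_
      filter_upwards [ae_mem_intBox] with y hy
      have : digitEquiv d y ∉ S := by
        simp only [hSdef, Set.mem_ofPred_eq, digitEquiv_apply]
        rw [canonicalAbs_digit_sub hdd (mem_intBox.1 hy i) (mem_intBox.1 hy j)]
        exact one_ne_zero
      simp [Set.indicator, this]
  rw [lintegral_indicator_one hS] at h
  simp_rw [hd] at h
  rw [← Finset.sum_filter, Finset.sum_const, nsmul_eq_mul] at h
  have hcard : (Finset.univ.filter fun d : Fin N → 𝓀[K] => d i = d j).card < residueCard K ^ N := by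
    have hcf : Fintype.card (Fin N → 𝓀[K]) = residueCard K ^ N := by
      rw [Fintype.card_fun, Fintype.card_fin, card_residueField]
    rw [← hcf]
    -- A digit vector with $d_i=1\ne0=d_j$ makes the count strictly smaller than $q^N$.
    refine Finset.card_lt_univ_of_notMem (x := Function.update 0 i 1) ?_
    simp [Function.update_of_ne hij.symm]
  have h2 := congrArg ENNReal.toReal h
  simp only [ENNReal.toReal_mul, ENNReal.toReal_pow, ENNReal.toReal_inv,
    ENNReal.toReal_natCast] at h2
  have hq : (0 : ℝ) < (residueCard K : ℝ) ^ N := pow_pos residueCard_pos N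
  have hc : ((Finset.univ.filter fun d : Fin N → 𝓀[K] => d i = d j).card : ℝ) <
      (residueCard K : ℝ) ^ N := by exact_mod_cast hcard
  by_contra h0
  have h3 : 0 < (boxMeasure K N S).toReal := ENNReal.toReal_pos h0 (measure_ne_top _ _)
  rw [inv_pow, ← mul_assoc] at h2
  have h4 : ((residueCard K : ℝ) ^ N)⁻¹ *
      ((Finset.univ.filter fun d : Fin N → 𝓀[K] => d i = d j).card : ℝ) < 1 := by
    rw [inv_mul_lt_one₀ hq]; exact hc
  nlinarith

/-- The ball of radius `q^m` in `K^N`. -/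
noncomputable def bigBox (K : Type*) [Field K] [ValuativeRel K] [TopologicalSpace K]
    [IsNonarchimedeanLocalField K] [MeasurableSpace K] [BorelSpace K] (N : ℕ) (m : ℤ) :
    Set (Fin N → K) :=
  affineEquiv (0 : Fin N → K) (unif K ^ (-m)) '' intBox K N

theorem mem_bigBox {x : Fin N → K} {m : ℤ} :
    x ∈ bigBox K N m ↔ ∀ i, canonicalAbs (x i) ≤ (residueCard K : ℝ) ^ m := by
  have hq : (0 : ℝ) < (residueCard K : ℝ) ^ m := zpow_pos residueCard_pos m
  obtain ⟨y, rfl⟩ := (affineEquiv (0 : Fin N → K) (unif K ^ (-m))).surjective x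
  rw [bigBox, (affineEquiv _ _).injective.mem_set_image, mem_intBox]
  refine forall_congr' fun i => ?_
  rw [affineEquiv_apply, Pi.zero_apply, zero_add, canonicalAbs_mul, Units.val_zpow_eq_zpow_val,
    unif, Units.val_mk0, canonicalAbs_uniformizer_zpow, neg_neg, ← canonicalAbs_le_one_iff,
    mul_le_iff_le_one_right hq]

theorem measurableSet_bigBox (m : ℤ) : MeasurableSet (bigBox K N m) :=
  (affineEquiv _ _).measurableSet_image.2 measurableSet_intBox

theorem supNorm_le_iff [NeZero N] {x : Fin N → K} {t : ℝ} :
    supNorm x ≤ t ↔ ∀ i, canonicalAbs (x i) ≤ t := by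
  rw [supNorm, ciSup_le_iff (Set.finite_range _).bddAbove]

theorem exists_supNorm_eq [NeZero N] (x : Fin N → K) : ∃ i, supNorm x = canonicalAbs (x i) := by
  obtain ⟨i, hi⟩ := exists_eq_ciSup_of_finite (f := fun i => canonicalAbs (x i))
  exact ⟨i, hi.symm⟩

/-- The sphere of radius `q^m` in `K^N`. -/
noncomputable def sphereSet (K : Type*) [Field K] [ValuativeRel K] [TopologicalSpace K]
    [IsNonarchimedeanLocalField K] [MeasurableSpace K] [BorelSpace K] (N : ℕ) (m : ℤ) :
    Set (Fin N → K) := {x | supNorm x = (residueCard K : ℝ) ^ m}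

theorem one_lt_residueCard_real : (1 : ℝ) < residueCard K := by
  exact_mod_cast one_lt_residueCard (K := K)

/-- No value of the norm lies strictly between $q^{m-1}$ and $q^m$. -/
theorem sphereSet_eq [NeZero N] (m : ℤ) :
    sphereSet K N m = bigBox K N m \ bigBox K N (m - 1) := by
  ext x
  rw [Set.mem_sdiff, mem_bigBox, mem_bigBox, ← supNorm_le_iff, ← supNorm_le_iff, not_le]
  change supNorm x = _ ↔ _
  constructor
  · intro h
    rw [h]
    exact ⟨le_rfl, zpow_lt_zpow_right₀ one_lt_residueCard_real (by omega)⟩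
  · rintro ⟨h1, h2⟩
    obtain ⟨i, hi⟩ := exists_supNorm_eq x
    rw [hi] at h1 h2 ⊢
    rcases canonicalAbs_eq_zero_or (x i) with h0 | ⟨n, hn⟩
    · rw [h0] at h2
      exact absurd h2 (not_lt.2 (zpow_nonneg residueCard_pos.le _))
    · rw [hn, zpow_le_zpow_iff_right₀ one_lt_residueCard_real] at h1
      rw [hn, zpow_lt_zpow_iff_right₀ one_lt_residueCard_real] at h2
      rw [hn]
      congr 1
      omega

theorem ae_mem_iUnion_sphereSet [NeZero N] :
    ∀ᵐ x ∂(haarPi K N), x ∈ ⋃ m : ℤ, sphereSet K N m := by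
  -- Only the origin lies on no sphere.
  refine measure_mono_null (t := Set.univ.pi fun _ => {(0 : K)}) ?_ ?_
  · intro x hx
    simp only [Set.mem_compl_iff, Set.mem_ofPred_eq, Set.mem_iUnion, not_exists] at hx
    simp only [Set.mem_univ_pi, Set.mem_singleton_iff]
    by_contra! hne
    obtain ⟨j, hj⟩ := hne
    obtain ⟨i, hi⟩ := exists_supNorm_eq x
    rcases canonicalAbs_eq_zero_or (x i) with h0 | ⟨n, hn⟩
    · have := (supNorm_le_iff.1 (hi.trans h0).le) j
      exact absurd this (not_le.2 (canonicalAbs_pos hj))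
    · exact hx n (hi.trans hn)
  · simp [haarPi, Measure.pi_pi, haar_singleton_zero, NeZero.ne N]

theorem sphereSet_disjoint : Pairwise (Function.onFun Disjoint (sphereSet K N)) := by
  intro m n hmn
  refine Set.disjoint_left.2 fun x hx hx' => hmn ?_
  have : (residueCard K : ℝ) ^ m = (residueCard K : ℝ) ^ n := hx.symm.trans hx'
  exact zpow_right_injective₀ residueCard_pos one_lt_residueCard_real.ne' this

theorem ofReal_canonicalAbs_unif_zpow (m : ℤ) :
    (ENNReal.ofReal (canonicalAbs ((unif K ^ (-m) : Kˣ) : K))) =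
      ENNReal.ofReal ((residueCard K : ℝ) ^ m) := by
  rw [Units.val_zpow_eq_zpow_val, unif, Units.val_mk0, canonicalAbs_uniformizer_zpow, neg_neg]

/-! ### Radial integration of homogeneous functions -/

section Homogeneous

variable {F : (Fin N → K) → ℂ} {w : ℂ}
  (hw : ∀ (m : ℤ) (y : Fin N → K), F (affineEquiv 0 (unif K ^ (-m)) y) =
    (residueCard K : ℂ) ^ ((m : ℂ) * w) * F y)
  (hF : Integrable F (boxMeasure K N))

include hw hF

theorem integrableOn_bigBox (m : ℤ) : IntegrableOn F (bigBox K N m) (haarPi K N) := by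
  rw [IntegrableOn, bigBox, restrict_haarPi_image_affineEquiv, ofReal_canonicalAbs_unif_zpow]
  refine Integrable.smul_measure ?_ (by finiteness)
  rw [integrable_map_equiv]
  refine Integrable.congr (hF.const_mul ((residueCard K : ℂ) ^ ((m : ℂ) * w))) ?_
  exact Filter.Eventually.of_forall fun y => (hw m y).symm

omit hw hF in
theorem residueCard_cpow_mul_add (m : ℤ) :
    (residueCard K : ℂ) ^ ((m : ℂ) * (N + w)) =
      (((residueCard K : ℝ) ^ m : ℝ) : ℂ) ^ N * (residueCard K : ℂ) ^ ((m : ℂ) * w) := by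
  have h0 : (residueCard K : ℂ) ≠ 0 := by exact_mod_cast (residueCard_pos (K := K)).ne'
  have h1 : (m : ℂ) * N = ((m * N : ℤ) : ℂ) := by push_cast; rfl
  rw [mul_add, Complex.cpow_add _ _ h0, h1, Complex.cpow_intCast, zpow_mul, zpow_natCast]
  push_cast
  rfl

theorem integral_bigBox (m : ℤ) : ∫ x in bigBox K N m, F x ∂(haarPi K N) =
    (residueCard K : ℂ) ^ ((m : ℂ) * (N + w)) * ∫ x, F x ∂(boxMeasure K N) := by
  rw [bigBox, restrict_haarPi_image_affineEquiv, ofReal_canonicalAbs_unif_zpow,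
    integral_smul_measure, integral_map_equiv, residueCard_cpow_mul_add]
  simp_rw [hw]
  rw [integral_const_mul, ENNReal.toReal_pow,
    ENNReal.toReal_ofReal (zpow_nonneg residueCard_pos.le _), Complex.real_smul,
    Complex.ofReal_pow, mul_assoc]
  rfl

theorem integral_norm_bigBox (m : ℤ) : ∫ x in bigBox K N m, ‖F x‖ ∂(haarPi K N) =
    ‖(residueCard K : ℂ) ^ ((m : ℂ) * (N + w))‖ * ∫ x, ‖F x‖ ∂(boxMeasure K N) := by
  rw [bigBox, restrict_haarPi_image_affineEquiv, ofReal_canonicalAbs_unif_zpow,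
    integral_smul_measure, integral_map_equiv, residueCard_cpow_mul_add]
  simp_rw [hw, norm_mul]
  rw [integral_const_mul, ENNReal.toReal_pow,
    ENNReal.toReal_ofReal (zpow_nonneg residueCard_pos.le _), norm_pow, Complex.norm_real,
    Real.norm_of_nonneg (zpow_nonneg residueCard_pos.le _), smul_eq_mul, mul_assoc]
  rfl

variable [NeZero N] {ρ : ℝ → ℂ}
  (hs : Summable fun m : ℤ => ρ ((residueCard K : ℝ) ^ m) *
    (residueCard K : ℂ) ^ ((m : ℂ) * (N + w)))

theorem integrableOn_sphereSet (m : ℤ) :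
    IntegrableOn (fun x => ρ (supNorm x) * F x) (sphereSet K N m) (haarPi K N) := by
  have hm : MeasurableSet (sphereSet K N m) :=
    sphereSet_eq (K := K) (N := N) m ▸ (measurableSet_bigBox m).diff (measurableSet_bigBox _)
  have h1 : IntegrableOn F (sphereSet K N m) (haarPi K N) :=
    (integrableOn_bigBox hw hF m).mono_set (by rw [sphereSet_eq]; exact Set.sdiff_subset)
  refine IntegrableOn.congr_fun (h1.const_mul (ρ ((residueCard K : ℝ) ^ m))) ?_ hm
  intro x hx
  have : supNorm x = _ := hx
  simp only [this]

/-- Ball minus next smaller ball: homogeneity turns the second integral into $q^{-(N+w)}$ times the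
first, which is the origin of the numerator of the root function. -/
theorem integral_sphereSet (m : ℤ) :
    ∫ x in sphereSet K N m, ρ (supNorm x) * F x ∂(haarPi K N) =
      ρ ((residueCard K : ℝ) ^ m) * (residueCard K : ℂ) ^ ((m : ℂ) * (N + w)) *
        ((1 - (residueCard K : ℂ) ^ (-(N + w))) * ∫ x, F x ∂(boxMeasure K N)) := by
  have hm : MeasurableSet (sphereSet K N m) :=
    sphereSet_eq (K := K) (N := N) m ▸ (measurableSet_bigBox m).diff (measurableSet_bigBox _)
  have h1 : ∫ x in sphereSet K N m, ρ (supNorm x) * F x ∂(haarPi K N) =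
      ∫ x in sphereSet K N m, ρ ((residueCard K : ℝ) ^ m) * F x ∂(haarPi K N) := by
    refine setIntegral_congr_fun hm fun x hx => ?_
    have : supNorm x = _ := hx
    simp only [this]
  have hsub : bigBox K N (m - 1) ⊆ bigBox K N m := by
    intro x hx
    rw [mem_bigBox] at hx ⊢
    exact fun i => (hx i).trans (zpow_le_zpow_right₀ one_lt_residueCard_real.le (by omega))
  have h0 : (residueCard K : ℂ) ≠ 0 := by exact_mod_cast (residueCard_pos (K := K)).ne'
  rw [h1, integral_const_mul, sphereSet_eq, setIntegral_sdiff (measurableSet_bigBox _)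
    (integrableOn_bigBox hw hF m) hsub, integral_bigBox hw hF, integral_bigBox hw hF]
  have h2 : (residueCard K : ℂ) ^ (((m - 1 : ℤ) : ℂ) * (N + w)) =
      (residueCard K : ℂ) ^ ((m : ℂ) * (N + w)) * (residueCard K : ℂ) ^ (-(N + w)) := by
    rw [← Complex.cpow_add _ _ h0]
    push_cast
    ring_nf
  rw [h2]
  ring

include hs

theorem integrable_supNorm_mul :
    Integrable (fun x => ρ (supNorm x) * F x) (haarPi K N) := by
  have hm : ∀ m, MeasurableSet (sphereSet K N m) := fun m =>
    sphereSet_eq (K := K) (N := N) m ▸ (measurableSet_bigBox m).diff (measurableSet_bigBox _)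
  have h : IntegrableOn (fun x => ρ (supNorm x) * F x) (⋃ m, sphereSet K N m) (haarPi K N) := by
    refine integrableOn_iUnion_of_summable_integral_norm
      (fun m => integrableOn_sphereSet hw hF m) ?_
    refine Summable.of_nonneg_of_le (fun m => integral_nonneg fun x => norm_nonneg _) (fun m => ?_)
      (hs.norm.mul_right (∫ x, ‖F x‖ ∂(boxMeasure K N)))
    have h1 : ∫ x in sphereSet K N m, ‖ρ (supNorm x) * F x‖ ∂(haarPi K N) =
        ∫ x in sphereSet K N m, ‖ρ ((residueCard K : ℝ) ^ m)‖ * ‖F x‖ ∂(haarPi K N) := by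
      refine setIntegral_congr_fun (hm m) fun x hx => ?_
      have : supNorm x = _ := hx
      simp only [this, norm_mul]
    rw [h1, integral_const_mul, norm_mul, mul_assoc, ← integral_norm_bigBox hw hF]
    refine mul_le_mul_of_nonneg_left ?_ (norm_nonneg _)
    refine setIntegral_mono_set (integrableOn_bigBox hw hF m).norm
      (Filter.Eventually.of_forall fun x => norm_nonneg _) ?_
    rw [sphereSet_eq]
    exact Filter.Eventually.of_forall fun x hx => hx.1
  rw [IntegrableOn, Measure.restrict_eq_self_of_ae_mem ae_mem_iUnion_sphereSet] at h
  exact h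

theorem integral_supNorm_mul :
    ∫ x, ρ (supNorm x) * F x ∂(haarPi K N) = (1 - (residueCard K : ℂ) ^ (-(N + w))) *
      (∑' m : ℤ, ρ ((residueCard K : ℝ) ^ m) * (residueCard K : ℂ) ^ ((m : ℂ) * (N + w))) *
        ∫ x, F x ∂(boxMeasure K N) := by
  have hm : ∀ m, MeasurableSet (sphereSet K N m) := fun m =>
    sphereSet_eq (K := K) (N := N) m ▸ (measurableSet_bigBox m).diff (measurableSet_bigBox _)
  rw [← Measure.restrict_eq_self_of_ae_mem (ae_mem_iUnion_sphereSet (K := K) (N := N)),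
    integral_iUnion hm sphereSet_disjoint (integrable_supNorm_mul hw hF hs).integrableOn]
  simp_rw [integral_sphereSet hw hF]
  rw [tsum_mul_right]
  ring

end Homogeneous

end ProductMeasure

end LogCoulomb

namespace LogCoulomb

set_option linter.unusedSectionVars false

/-! ### Refining a partition by a colouring, and counting the colourings -/

section Partitions

open Finset

/-- Partitions of `[N]`. -/
abbrev Part (N : ℕ) : Type := Finpartition (Finset.univ : Finset (Fin N))

variable {N : ℕ} {κ : Type*} [Fintype κ] [DecidableEq κ]

/-- Two indices lie in the same part. -/
def Same (P : Part N) (i j : Fin N) : Prop := P.part i = P.part j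

instance (P : Part N) (i j : Fin N) : Decidable (Same P i j) :=
  inferInstanceAs (Decidable (P.part i = P.part j))

theorem same_iff_mem {P : Part N} {i j : Fin N} : Same P i j ↔ i ∈ P.part j :=
  (P.mem_part_iff_part_eq_part (mem_univ _) (mem_univ _)).symm

theorem part_mem_parts (P : Part N) (i : Fin N) : P.part i ∈ P.parts := P.part_mem.2 (mem_univ _)

theorem mem_part_self' (P : Part N) (i : Fin N) : i ∈ P.part i := P.mem_part_self.2 (mem_univ _)

theorem part_eq_of_mem' {P : Part N} {lam : Finset (Fin N)} (h : lam ∈ P.parts) {i : Fin N}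
    (hi : i ∈ lam) : P.part i = lam := P.part_eq_of_mem h hi

theorem exists_part_eq {P : Part N} {lam : Finset (Fin N)} (h : lam ∈ P.parts) :
    ∃ i, P.part i = lam := by
  obtain ⟨i, hi⟩ := P.nonempty_of_mem_parts h
  exact ⟨i, part_eq_of_mem' h hi⟩

theorem part_le_iff {P Q : Part N} : P ≤ Q ↔ ∀ i, P.part i ⊆ Q.part i := by
  constructor
  · intro h i
    obtain ⟨c, hc, hle⟩ := h (part_mem_parts P i)
    have : Q.part i = c := part_eq_of_mem' hc (hle (mem_part_self' P i))
    rw [this]; exact hle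
  · intro h b hb
    obtain ⟨i, rfl⟩ := exists_part_eq hb
    exact ⟨_, part_mem_parts Q i, h i⟩

theorem part_le_iff_same {P Q : Part N} : P ≤ Q ↔ ∀ i j, Same P i j → Same Q i j := by
  rw [part_le_iff]
  constructor
  · intro h i j hij
    exact same_iff_mem.2 (h j (same_iff_mem.1 hij))
  · intro h i j hj
    exact same_iff_mem.1 (h _ _ (same_iff_mem.2 hj))

theorem part_ext {P Q : Part N} (h : ∀ i j, Same P i j ↔ Same Q i j) : P = Q :=
  le_antisymm (part_le_iff_same.2 fun i j => (h i j).1) (part_le_iff_same.2 fun i j => (h i j).2)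

theorem same_bot_iff {i j : Fin N} : Same (⊥ : Part N) i j ↔ i = j := by
  constructor
  · intro h
    obtain ⟨a, _, ha⟩ := Finpartition.mem_bot_iff.1 (part_mem_parts (⊥ : Part N) j)
    have h1 := same_iff_mem.1 h
    have h2 := mem_part_self' (⊥ : Part N) j
    rw [← ha, mem_singleton] at h1 h2
    rw [h1, h2]
  · rintro rfl; rfl

theorem parts_top [NeZero N] : (⊤ : Part N).parts = {univ} := by
  have h := Finpartition.parts_top_subset (univ : Finset (Fin N))
  exact (Finset.Nonempty.subset_singleton_iff
    (Finpartition.parts_nonempty _ univ_nonempty.ne_empty)).1 h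

theorem same_top [NeZero N] (i j : Fin N) : Same (⊤ : Part N) i j := by
  have h : univ ∈ (⊤ : Part N).parts := by rw [parts_top]; simp
  rw [Same, part_eq_of_mem' h (mem_univ i), part_eq_of_mem' h (mem_univ j)]

theorem eq_top_of_parts [NeZero N] {P : Part N} (h : P.parts = {univ}) : P = ⊤ :=
  Finpartition.ext (h.trans parts_top.symm)

/-- The equivalence relation of lying in the same part and having the same colour. -/
def refineSetoid (P : Part N) (d : Fin N → κ) : Setoid (Fin N) where
  r i j := Same P i j ∧ d i = d j
  iseqv := ⟨fun _ => ⟨rfl, rfl⟩, fun h => ⟨h.1.symm, h.2.symm⟩,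
    fun h h' => ⟨h.1.trans h'.1, h.2.trans h'.2⟩⟩

instance (P : Part N) (d : Fin N → κ) : DecidableRel (refineSetoid P d).r :=
  fun i j => inferInstanceAs (Decidable (Same P i j ∧ d i = d j))

/-- The refinement of a partition by a colouring of `[N]`. -/
def refineBy (P : Part N) (d : Fin N → κ) : Part N :=
  Finpartition.ofSetoid (refineSetoid P d)

theorem same_refineBy {P : Part N} {d : Fin N → κ} {i j : Fin N} :
    Same (refineBy P d) i j ↔ Same P i j ∧ d i = d j := by
  rw [same_iff_mem, refineBy, Finpartition.mem_part_ofSetoid_iff_rel]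
  exact ⟨fun h => ⟨h.1.symm, h.2.symm⟩, fun h => ⟨h.1.symm, h.2.symm⟩⟩

theorem refineBy_le (P : Part N) (d : Fin N → κ) : refineBy P d ≤ P :=
  part_le_iff_same.2 fun _ _ h => (same_refineBy.1 h).1

theorem part_refineBy (P : Part N) (d : Fin N → κ) (i : Fin N) :
    (refineBy P d).part i = (P.part i).filter fun j => d j = d i := by
  ext j
  rw [← same_iff_mem, same_refineBy, mem_filter, same_iff_mem]

theorem mem_parts_refineBy {P : Part N} {d : Fin N → κ} {mu : Finset (Fin N)} :
    mu ∈ (refineBy P d).parts ↔ mu.Nonempty ∧ ∃ lam ∈ P.parts, ∃ t, mu = lam.filter (d · = t) := by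
  constructor
  · intro h
    refine ⟨Finpartition.nonempty_of_mem_parts _ h, ?_⟩
    obtain ⟨i, rfl⟩ := exists_part_eq h
    exact ⟨P.part i, part_mem_parts P i, d i, part_refineBy P d i⟩
  · rintro ⟨⟨i, hi⟩, lam, hlam, t, rfl⟩
    rw [mem_filter] at hi
    obtain ⟨hi, rfl⟩ := hi
    rw [← part_eq_of_mem' hlam hi, ← part_refineBy]
    exact part_mem_parts _ _

/-- The parts of `Q` contained in `lam`. -/
def children (Q : Part N) (lam : Finset (Fin N)) : Finset (Finset (Fin N)) :=
  Q.parts.filter fun mu => mu ⊆ lam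

/-- The number of ways to refine `P` to `Q` in one step, up to normalization. -/
def stepMult (q : ℕ) (P Q : Part N) : ℕ :=
  ∏ lam ∈ P.parts, (q - 1).descFactorial ((children Q lam).card - 1)

theorem part_mem_children {P Q : Part N} (hQP : Q ≤ P) {lam : Finset (Fin N)} (hlam : lam ∈ P.parts)
    {i : Fin N} (hi : i ∈ lam) : Q.part i ∈ children Q lam := by
  refine mem_filter.2 ⟨part_mem_parts _ _, ?_⟩
  rw [← part_eq_of_mem' hlam hi]
  exact part_le_iff.1 hQP i

theorem children_card_pos {P Q : Part N} (hQP : Q ≤ P) {lam : Finset (Fin N)}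
    (hlam : lam ∈ P.parts) : 0 < (children Q lam).card := by
  obtain ⟨i, hi⟩ := P.nonempty_of_mem_parts hlam
  exact card_pos.2 ⟨_, part_mem_children hQP hlam hi⟩

theorem children_of_mem {Q : Part N} {lam : Finset (Fin N)} (hlam : lam ∈ Q.parts) :
    children Q lam = {lam} := by
  ext mu
  simp only [children, mem_filter, mem_singleton]
  constructor
  · rintro ⟨h1, h2⟩
    obtain ⟨i, hi⟩ := Q.nonempty_of_mem_parts h1
    exact Q.eq_of_mem_parts h1 hlam hi (h2 hi)
  · rintro rfl
    exact ⟨hlam, Subset.rfl⟩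

theorem stepMult_self (q : ℕ) (P : Part N) : stepMult q P P = 1 :=
  prod_eq_one fun lam hlam => by simp [children_of_mem hlam]

theorem refineBy_eq_iff {P Q : Part N} (hQP : Q ≤ P) {d : Fin N → κ} :
    refineBy P d = Q ↔ (∀ i j, Same Q i j → d i = d j) ∧
      ∀ i j, Same P i j → d i = d j → Same Q i j := by
  constructor
  · rintro rfl
    exact ⟨fun i j h => (same_refineBy.1 h).2, fun i j h h' => same_refineBy.2 ⟨h, h'⟩⟩
  · rintro ⟨h1, h2⟩
    refine part_ext fun i j => ?_
    rw [same_refineBy]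
    exact ⟨fun h => h2 i j h.1 h.2, fun h => ⟨part_le_iff_same.1 hQP _ _ h, h1 i j h⟩⟩

/-- A representative of a child. -/
noncomputable def childRep {Q : Part N} {lam : Finset (Fin N)} (mu : children Q lam) : Fin N :=
  (Q.nonempty_of_mem_parts (mem_filter.1 mu.2).1).choose

theorem childRep_mem {Q : Part N} {lam : Finset (Fin N)} (mu : children Q lam) :
    childRep mu ∈ mu.1 := (Q.nonempty_of_mem_parts (mem_filter.1 mu.2).1).choose_spec

theorem part_childRep {Q : Part N} {lam : Finset (Fin N)} (mu : children Q lam) :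
    Q.part (childRep mu) = mu.1 := part_eq_of_mem' (mem_filter.1 mu.2).1 (childRep_mem mu)

/-- The type of `g lam` depends on `lam`; this lets equalities of the underlying sets be used
without transport. -/
theorem embedding_congr {P Q : Part N} (g : (lam : P.parts) → (children Q lam.1 ↪ κ))
    {lam lam' : P.parts} (h : lam.1 = lam'.1) {mu : children Q lam.1} {mu' : children Q lam'.1}
    (h' : mu.1 = mu'.1) : g lam mu = g lam' mu' := by
  obtain rfl := Subtype.ext h
  rw [Subtype.ext h']

/-- Colourings which refine `P` to `Q` are families of injective colourings of children. -/
noncomputable def colouringEquiv {P Q : Part N} (hQP : Q ≤ P) :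
    {d : Fin N → κ // refineBy P d = Q} ≃ ((lam : P.parts) → (children Q lam.1 ↪ κ)) where
  toFun d lam :=
    { toFun := fun mu => d.1 (childRep mu)
      inj' := fun mu mu' h => by
        have hP : Same P (childRep mu) (childRep mu') := by
          have h1 := part_eq_of_mem' lam.2 ((mem_filter.1 mu.2).2 (childRep_mem mu))
          have h2 := part_eq_of_mem' lam.2 ((mem_filter.1 mu'.2).2 (childRep_mem mu'))
          exact h1.trans h2.symm
        have := ((refineBy_eq_iff hQP).1 d.2).2 _ _ hP h
        rw [Same, part_childRep, part_childRep] at this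
        exact Subtype.ext this }
  invFun g := ⟨fun i => g ⟨P.part i, part_mem_parts P i⟩
      ⟨Q.part i, part_mem_children hQP (part_mem_parts P i) (mem_part_self' P i)⟩, by
    rw [refineBy_eq_iff hQP]
    constructor
    · intro i j h
      have hP : P.part i = P.part j := part_le_iff_same.1 hQP _ _ h
      exact embedding_congr g hP h
    · intro i j hP h
      have hj : Q.part j ∈ children Q (P.part i) := part_mem_children hQP (part_mem_parts P i)
        (same_iff_mem.1 hP.symm)
      rw [embedding_congr g (lam' := ⟨P.part i, part_mem_parts P i⟩) (mu' := ⟨Q.part j, hj⟩)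
        (lam := ⟨P.part j, part_mem_parts P j⟩) hP.symm rfl] at h
      exact congrArg Subtype.val ((g _).injective h)⟩
  left_inv d := by
    refine Subtype.ext (funext fun i => ?_)
    refine ((refineBy_eq_iff hQP).1 d.2).1 _ _ ?_
    rw [Same, part_childRep]
  right_inv g := by
    refine funext fun lam => ?_
    ext mu
    have h1 : P.part (childRep mu) = lam.1 :=
      part_eq_of_mem' lam.2 ((mem_filter.1 mu.2).2 (childRep_mem mu))
    exact embedding_congr g h1 (part_childRep mu)

/-- A colouring refines $P$ to $Q$ exactly when it is constant on the parts of $Q$ and injective on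
those inside a common part of $P$. A part with $k$ children admits $(q)_k=q\,(q-1)_{k-1}$ colourings
of these, independently of the other parts. -/
theorem card_refineBy_eq {P Q : Part N} (hQP : Q ≤ P) (hκ : 0 < Fintype.card κ) :
    (univ.filter fun d : Fin N → κ => refineBy P d = Q).card =
      Fintype.card κ ^ P.parts.card * stepMult (Fintype.card κ) P Q := by
  rw [← Fintype.card_subtype, Fintype.card_congr (colouringEquiv hQP), Fintype.card_pi]
  simp_rw [Fintype.card_embedding_eq, Fintype.card_coe]
  rw [Finset.prod_coe_sort P.parts fun lam =>
    (Fintype.card κ).descFactorial (children Q lam).card, stepMult, ← Finset.prod_const,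
    ← Finset.prod_mul_distrib]
  refine Finset.prod_congr rfl fun lam hlam => ?_
  have h := children_card_pos hQP hlam
  obtain ⟨k, hk⟩ := Nat.exists_eq_succ_of_ne_zero h.ne'
  obtain ⟨n, hn⟩ := Nat.exists_eq_succ_of_ne_zero hκ.ne'
  rw [hk, hn, Nat.succ_descFactorial_succ]
  rfl

/-- The colouring `d` is itself one of those that are counted. Thus exhibiting a colouring suffices
to show that a step has positive multiplicity. -/
theorem stepMult_refineBy_pos (P : Part N) (d : Fin N → κ) (hκ : 0 < Fintype.card κ) :
    0 < stepMult (Fintype.card κ) P (refineBy P d) := by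
  have h := card_refineBy_eq (refineBy_le P d) hκ
  have h2 : 0 < (univ.filter fun d' : Fin N → κ => refineBy P d' = refineBy P d).card :=
    card_pos.2 ⟨d, by simp⟩
  rw [h] at h2
  exact Nat.pos_of_mul_pos_left h2

open scoped Classical in
theorem sum_refineBy (P : Part N) (hκ : 0 < Fintype.card κ) (g : Part N → ℂ) :
    ∑ d : Fin N → κ, g (refineBy P d) = (Fintype.card κ : ℂ) ^ P.parts.card *
      ∑ Q : Part N with Q ≤ P, (stepMult (Fintype.card κ) P Q : ℂ) * g Q := by
  rw [← Finset.sum_fiberwise_of_maps_to (s := univ) (t := univ.filter fun Q : Part N => Q ≤ P)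
    (g := fun d => refineBy P d) (fun d _ => by simpa using refineBy_le P d), Finset.mul_sum]
  refine Finset.sum_congr rfl fun Q hQ => ?_
  rw [Finset.sum_congr rfl fun d hd => by rw [(mem_filter.1 hd).2], Finset.sum_const,
    card_refineBy_eq (mem_filter.1 hQ).2 hκ, nsmul_eq_mul]
  push_cast
  ring

open scoped Classical in
theorem sum_le_eq_add_sum_lt (P : Part N) (g : Part N → ℂ) :
    ∑ Q : Part N with Q ≤ P, g Q = g P + ∑ Q : Part N with Q < P, g Q := by
  have : (univ.filter fun Q : Part N => Q ≤ P) = insert P (univ.filter fun Q : Part N => Q < P) := by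
    ext Q
    simp [le_iff_eq_or_lt]
  rw [this, Finset.sum_insert (by simp)]

end Partitions

end LogCoulomb

namespace LogCoulomb

set_option linter.unusedSectionVars false

/-! ### Unrolling a triangular recursion into a sum over splitting filtrations -/

section Chains

open Finset

variable {N : ℕ}

open scoped Classical in
/-- The sum over chains of length `L` which start at `P`. -/
noncomputable def chainSum (f : Part N → Part N → ℂ) (L : ℕ) (P : Part N) (g : Part N → ℂ) : ℂ :=
  ∑ v : Fin (L + 1) → Part N, if v 0 = P then
    (∏ l : Fin L, if v l.succ < v l.castSucc then f (v l.castSucc) (v l.succ) else 0) *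
      g (v (Fin.last L)) else 0

open scoped Classical in
theorem chainSum_zero (f : Part N → Part N → ℂ) (P : Part N) (g : Part N → ℂ) :
    chainSum f 0 P g = g P := by
  rw [chainSum, Finset.sum_eq_single (fun _ => P)]
  · simp
  · intro v _ hv
    rw [if_neg]
    rintro rfl
    exact hv (funext fun i => congrArg v (Fin.ext (by omega)))
  · simp

theorem chainSum_add (f : Part N → Part N → ℂ) (L : ℕ) (P : Part N) (g g' : Part N → ℂ) :
    chainSum f L P (fun Q => g Q + g' Q) = chainSum f L P g + chainSum f L P g' := by
  simp only [chainSum, ← Finset.sum_add_distrib]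
  refine Finset.sum_congr rfl fun v _ => ?_
  split_ifs <;> ring

open scoped Classical in
theorem chainSum_succ (f : Part N → Part N → ℂ) (L : ℕ) (P : Part N) (g : Part N → ℂ) :
    chainSum f (L + 1) P g =
      chainSum f L P fun Q => ∑ Q' : Part N with Q' < Q, f Q Q' * g Q' := by
  rw [chainSum, chainSum, ← (Fin.snocEquiv fun _ => Part N).sum_comp, Fintype.sum_prod_type_right]
  refine Finset.sum_congr rfl fun v _ => ?_
  have h0 : ∀ Q : Part N, (Fin.snocEquiv fun _ : Fin (L + 2) => Part N) (Q, v) 0 = v 0 := by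
    intro Q
    exact Fin.snoc_castSucc (α := fun _ => Part N) Q v 0
  have hlast : ∀ Q : Part N,
      (Fin.snocEquiv fun _ : Fin (L + 2) => Part N) (Q, v) (Fin.last (L + 1)) = Q :=
    fun Q => Fin.snoc_last (α := fun _ => Part N) Q v
  have hcast : ∀ (Q : Part N) (i : Fin (L + 1)),
      (Fin.snocEquiv fun _ : Fin (L + 2) => Part N) (Q, v) i.castSucc = v i :=
    fun Q i => Fin.snoc_castSucc (α := fun _ => Part N) Q v i
  simp only [h0, hlast, Fin.prod_univ_castSucc, hcast, ← Fin.castSucc_succ, Fin.succ_last]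
  split_ifs with h
  · rw [Finset.sum_filter, Finset.mul_sum]
    refine Finset.sum_congr rfl fun Q _ => ?_
    split_ifs <;> ring
  · simp

/-- A nonzero term would be a strictly decreasing sequence of $L+1$ distinct partitions. -/
theorem chainSum_eq_zero (f : Part N → Part N → ℂ) {L : ℕ} (hL : Fintype.card (Part N) ≤ L)
    (P : Part N) (g : Part N → ℂ) : chainSum f L P g = 0 := by
  classical
  refine Finset.sum_eq_zero fun v _ => ?_
  split_ifs with h
  · by_cases hv : StrictAnti v
    · have := Fintype.card_le_of_injective _ hv.injective
      rw [Fintype.card_fin] at this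
      omega
    · rw [Fin.strictAnti_iff_succ_lt] at hv
      push Not at hv
      obtain ⟨i, hi⟩ := hv
      rw [Finset.prod_eq_zero (mem_univ i) (if_neg hi), zero_mul]
  · rfl

-- The recursion reads $U=\delta_\bot+TU$ with $T$ nilpotent, so $U$ is the finite Neumann series
-- $\sum_L T^L\delta_\bot$.
open scoped Classical in
theorem eq_sum_chainSum (f : Part N → Part N → ℂ) (U : Part N → ℂ) (hbot : U ⊥ = 1)
    (hU : ∀ P, P ≠ ⊥ → U P = ∑ Q : Part N with Q < P, f P Q * U Q) (P : Part N) :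
    U P = ∑ L ∈ range (Fintype.card (Part N)),
      chainSum f L P fun Q => if Q = ⊥ then 1 else 0 := by
  -- At $\bot$ the sum is empty and the indicator supplies the initial value, so one equation covers
  -- all partitions.
  have hU' : U = fun P => (if P = ⊥ then 1 else 0) + ∑ Q : Part N with Q < P, f P Q * U Q := by
    funext P
    by_cases h : P = ⊥
    · subst h; simp [hbot]
    · rw [if_neg h, zero_add, hU P h]
  have key : ∀ M, U P = (∑ L ∈ range M, chainSum f L P fun Q => if Q = ⊥ then 1 else 0) +
      chainSum f M P U := by
    intro M
    induction M with
    | zero => simp [chainSum_zero]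
    | succ M ih =>
      rw [ih, Finset.sum_range_succ, chainSum_succ, add_assoc, ← chainSum_add]
      conv_lhs => rw [hU']
  rw [key (Fintype.card (Part N)), chainSum_eq_zero f le_rfl, add_zero]

theorem SplittingFiltration.length_lt (π : SplittingFiltration N) :
    π.length < Fintype.card (Part N) := by
  have h := Fintype.card_le_of_injective _ π.level_strictAnti.injective
  rw [Fintype.card_fin] at h
  exact h

theorem SplittingFiltration.level_zero_eq [NeZero N] (π : SplittingFiltration N) :
    π.level 0 = ⊤ := eq_top_of_parts π.level_zero

-- The nonzero terms of the chain sums that begin at $\top$ and end at $\bot$ come from strict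
-- chains, which are the splitting filtrations.
open scoped Classical in
theorem eq_sum_splittingFiltration [NeZero N] (f : Part N → Part N → ℂ) (U : Part N → ℂ)
    (hbot : U ⊥ = 1) (hU : ∀ P, P ≠ ⊥ → U P = ∑ Q : Part N with Q < P, f P Q * U Q) :
    U ⊤ = ∑ π : SplittingFiltration N,
      ∏ l : Fin π.length, f (π.level l.castSucc) (π.level l.succ) := by
  rw [eq_sum_chainSum f U hbot hU, ← Fin.sum_univ_eq_sum_range
    (fun L => chainSum f L ⊤ fun Q => if Q = ⊥ then 1 else 0)]
  simp only [chainSum]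
  rw [← Fintype.sum_sigma' (fun (L : Fin (Fintype.card (Part N))) (v : Fin (L + 1) → Part N) =>
    if v 0 = ⊤ then (∏ l : Fin L, if v l.succ < v l.castSucc then f (v l.castSucc) (v l.succ)
      else 0) * (if v (Fin.last L) = ⊥ then 1 else 0) else 0)]
  symm
  refine Fintype.sum_of_injective
    (fun π : SplittingFiltration N => (⟨⟨π.length, π.length_lt⟩, π.level⟩ :
      Σ L : Fin (Fintype.card (Part N)), (Fin (L.1 + 1) → Part N))) ?_ _ _ ?_ ?_
  · rintro ⟨L, l, h1, h2, h3⟩ ⟨L', l', h1', h2', h3'⟩ h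
    simp only [Sigma.mk.injEq, Fin.mk.injEq] at h
    obtain ⟨rfl, h⟩ := h
    obtain rfl := eq_of_heq h
    rfl
  · rintro ⟨L, v⟩ hv
    by_contra hne
    have h0 : v 0 = ⊤ := by
      by_contra h; simp [h] at hne
    have hlast : v (Fin.last L) = ⊥ := by
      by_contra h; simp [h] at hne
    have hanti : StrictAnti v := by
      rw [Fin.strictAnti_iff_succ_lt]
      intro i
      by_contra h
      apply hne
      have h1 : (∏ l : Fin L, if v l.succ < v l.castSucc then f (v l.castSucc) (v l.succ)
          else 0) = 0 := Finset.prod_eq_zero (mem_univ i) (if_neg h)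
      simp only [h1, zero_mul, ite_self]
    exact hv ⟨⟨L, v, hanti, h0 ▸ parts_top, hlast⟩, rfl⟩
  · intro π
    simp only [π.level_zero_eq, π.level_last, if_true, mul_one]
    refine Finset.prod_congr rfl fun l _ => ?_
    rw [if_pos (π.level_strictAnti (Fin.castSucc_lt_succ))]

/-! ### Multiplicity and reducedness read level by level -/

namespace SplittingFiltration

variable (π : SplittingFiltration N)

/-- Parts only shrink along the filtration, so a part present at both ends of a range is unchanged
throughout: the levels containing it form an interval. -/
theorem mem_level_of_between {lam : Finset (Fin N)} {i j k : Fin (π.length + 1)}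
    (hij : i ≤ j) (hjk : j ≤ k) (hi : lam ∈ (π.level i).parts) (hk : lam ∈ (π.level k).parts) :
    lam ∈ (π.level j).parts := by
  obtain ⟨x, hx⟩ := (π.level i).nonempty_of_mem_parts hi
  have h1 := part_le_iff.1 (π.level_strictAnti.antitone hij) x
  have h2 := part_le_iff.1 (π.level_strictAnti.antitone hjk) x
  rw [part_eq_of_mem' hi hx] at h1
  rw [part_eq_of_mem' hk hx] at h2
  rw [← h1.antisymm h2]
  exact part_mem_parts _ _

theorem card_le_one_of_mem_last {lam : Finset (Fin N)}
    (h : lam ∈ (π.level (Fin.last π.length)).parts) : lam.card = 1 := by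
  rw [π.level_last] at h
  obtain ⟨a, _, rfl⟩ := Finpartition.mem_bot_iff.1 h
  simp

theorem mem_branches {lam : Finset (Fin N)} : lam ∈ π.branches ↔
    (∃ l : Fin π.length, lam ∈ (π.level l.castSucc).parts) ∧ 1 < lam.card := by
  simp [branches]

theorem mem_branchesAt {lam : Finset (Fin N)} {l : Fin π.length} : lam ∈ π.branchesAt l ↔
    lam ∈ (π.level l.castSucc).parts ∧ 1 < lam.card := by
  rw [branchesAt, mem_inter, mem_branches]
  exact ⟨fun h => ⟨h.2, h.1.2⟩, fun h => ⟨⟨⟨l, h.1⟩, h.2⟩, h.1⟩⟩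

theorem depth_mem (lam : π.branches) : lam.1 ∈ (π.level (π.depth lam).castSucc).parts :=
  (mem_filter.1 (Finset.max'_mem _ (π.levelsOf_nonempty lam))).2

theorem le_depth (lam : π.branches) {l : Fin π.length}
    (hl : lam.1 ∈ (π.level l.castSucc).parts) : l ≤ π.depth lam :=
  Finset.le_max' (π.levelsOf lam) l (mem_filter.2 ⟨mem_univ _, hl⟩)

theorem card_children_eq_one {lam : Finset (Fin N)} (hlam : lam.card ≤ 1) {P Q : Part N}
    (hQP : Q ≤ P) (h : lam ∈ P.parts) : (children Q lam).card = 1 := by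
  have hmem : lam ∈ Q.parts := by
    obtain ⟨i, hi⟩ := P.nonempty_of_mem_parts h
    have h1 := part_le_iff.1 hQP i
    rw [part_eq_of_mem' h hi] at h1
    have h2 : lam = {i} := by
      refine (Finset.eq_singleton_iff_unique_mem).2 ⟨hi, fun x hx => Finset.card_le_one.1 hlam x hx i hi⟩
    have h3 : Q.part i = lam := by
      rw [h2] at h1 ⊢
      exact (Finset.Nonempty.subset_singleton_iff ⟨i, mem_part_self' Q i⟩).1 h1
    rw [← h3]
    exact part_mem_parts _ _
  rw [children_of_mem hmem, card_singleton]

theorem prod_prod_parts_eq {M : Type*} [CommMonoid M] (x : Fin π.length → Finset (Fin N) → M) :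
    ∏ l : Fin π.length, ∏ lam ∈ (π.level l.castSucc).parts with 1 < lam.card, x l lam =
      ∏ lam ∈ π.branches, ∏ l ∈ π.levelsOf lam, x l lam := by
  refine Finset.prod_comm' fun l lam => ?_
  simp only [mem_univ, mem_filter, true_and, levelsOf, mem_branches]
  exact ⟨fun h => ⟨h.1, ⟨l, h.1⟩, h.2⟩, fun h => ⟨h.1, h.2.2⟩⟩

/-- Before its last level a branch passes unsplit to the next level, so it has one child there and
contributes $(q-1)_0=1$; only the level at its depth contributes. Singletons contribute 1 for the
same reason. -/
theorem mult_eq_prod (q : ℕ) :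
    π.mult q = ∏ l : Fin π.length, stepMult q (π.level l.castSucc) (π.level l.succ) := by
  have h1 : ∀ l : Fin π.length, stepMult q (π.level l.castSucc) (π.level l.succ) =
      ∏ lam ∈ (π.level l.castSucc).parts with 1 < lam.card,
        (q - 1).descFactorial ((children (π.level l.succ) lam).card - 1) := by
    intro l
    rw [stepMult]
    symm
    refine Finset.prod_filter_of_ne fun lam hlam hne => ?_
    by_contra h
    apply hne
    rw [card_children_eq_one (not_lt.1 h)
      (π.level_strictAnti (Fin.castSucc_lt_succ)).le hlam]
    simp
  simp_rw [h1]
  rw [prod_prod_parts_eq π fun l lam =>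
    (q - 1).descFactorial ((children (π.level l.succ) lam).card - 1), mult,
    ← Finset.prod_coe_sort π.branches fun lam => ∏ l ∈ π.levelsOf lam,
      (q - 1).descFactorial ((children (π.level l.succ) lam).card - 1)]
  refine Finset.prod_congr rfl fun lam _ => ?_
  rw [Finset.prod_eq_single (π.depth lam)]
  · rfl
  · intro l hl hne
    have hl' : lam.1 ∈ (π.level l.castSucc).parts := (mem_filter.1 hl).2
    have hlt : l < π.depth lam := lt_of_le_of_ne (π.le_depth lam hl') hne
    have : lam.1 ∈ (π.level l.succ).parts :=
      π.mem_level_of_between (Fin.castSucc_lt_succ).le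
        (Fin.succ_le_castSucc_iff.2 hlt) hl' (π.depth_mem lam)
    rw [children_of_mem this]
    simp
  · intro h
    exact (h (mem_filter.2 ⟨mem_univ _, π.depth_mem lam⟩)).elim

/-- The levels containing a branch form an interval, so lying in two levels is the same as surviving
one step. This makes reducedness a condition on consecutive levels. -/
theorem isReduced_iff : π.IsReduced ↔ ∀ l : Fin π.length,
    ∀ lam ∈ (π.level l.castSucc).parts, 1 < lam.card → lam ∉ (π.level l.succ).parts := by
  constructor
  · intro h l lam hlam hcard hmem
    obtain ⟨k, -, huniq⟩ := h lam (π.mem_branches.2 ⟨⟨l, hlam⟩, hcard⟩)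
    -- The definition of reducedness ignores the last level; there the parts are singletons, so no
    -- branch can occur.
    by_cases hl : l.1 + 1 < π.length
    · have h1 : (⟨l.1 + 1, hl⟩ : Fin π.length) = k := huniq _ hmem
      have h2 : l = k := huniq _ hlam
      have := congrArg Fin.val (h2.trans h1.symm)
      simp at this
    · have : l.succ = Fin.last π.length := by
        ext
        simp
        omega
      rw [this] at hmem
      have := π.card_le_one_of_mem_last hmem
      omega
  · intro h lam hlam
    obtain ⟨⟨l, hl⟩, hcard⟩ := π.mem_branches.1 hlam
    have key : ∀ i j : Fin π.length, i < j → lam ∈ (π.level i.castSucc).parts →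
        lam ∈ (π.level j.castSucc).parts → False := by
      intro i j hij hi hj
      exact h i lam hi hcard (π.mem_level_of_between (Fin.castSucc_lt_succ).le
        (Fin.succ_le_castSucc_iff.2 hij) hi hj)
    refine ⟨l, hl, fun k hk => ?_⟩
    rcases lt_trichotomy k l with hkl | hkl | hkl
    · exact (key _ _ hkl hk hl).elim
    · exact hkl
    · exact (key _ _ hkl hl hk).elim

theorem length_pos (hN : 2 ≤ N) : 0 < π.length := by
  by_contra h
  have h0 : (0 : Fin (π.length + 1)) = Fin.last π.length := by
    ext; simp; omega
  have h1 := π.level_zero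
  rw [h0] at h1
  have := π.card_le_one_of_mem_last (lam := univ) (by rw [h1]; simp)
  simp at this
  omega

theorem level_castSucc_ne_bot (l : Fin π.length) : π.level l.castSucc ≠ ⊥ := by
  have h := π.level_strictAnti (Fin.castSucc_lt_last l)
  exact (bot_le.trans_lt h).ne'

end SplittingFiltration

end Chains

end LogCoulomb

namespace LogCoulomb

set_option linter.unusedSectionVars false

/-! ### Enough filtrations of positive multiplicity, from two colours -/

section Existence

open Finset

variable {N : ℕ} {κ : Type*} [Fintype κ] [DecidableEq κ]

/-- There is a chain from `P` to the finest partition with steps in `r`, one of whose members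
satisfies `X`. -/
def HasChain (r : Part N → Part N → Prop) (X : Part N → Prop) (P : Part N) : Prop :=
  ∃ (L : ℕ) (v : Fin (L + 1) → Part N), v 0 = P ∧ v (Fin.last L) = ⊥ ∧
    (∀ l : Fin L, r (v l.castSucc) (v l.succ)) ∧ ∃ i, X (v i)

theorem HasChain.bot (r : Part N → Part N → Prop) : HasChain r (fun _ => True) ⊥ :=
  ⟨0, fun _ => ⊥, rfl, rfl, fun l => l.elim0, 0, trivial⟩

theorem HasChain.cons {r : Part N → Part N → Prop} {X : Part N → Prop} {P Q : Part N}
    (h : HasChain r X Q) (hr : r P Q) : HasChain r X P := by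
  obtain ⟨L, v, h0, hlast, hs, i, hi⟩ := h
  refine ⟨L + 1, Fin.cons P v, rfl, ?_, ?_, i.succ, by rwa [Fin.cons_succ]⟩
  · rw [← Fin.succ_last, Fin.cons_succ, hlast]
  · intro l
    refine Fin.cases ?_ (fun k => ?_) l
    · simpa [h0] using hr
    · rw [Fin.castSucc_succ, Fin.cons_succ, Fin.cons_succ]
      exact hs k

theorem HasChain.self {r : Part N → Part N → Prop} {X : Part N → Prop} {P : Part N}
    (h : HasChain r X P) : HasChain r (fun Q => Q = P) P := by
  obtain ⟨L, v, h0, hlast, hs, -⟩ := h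
  exact ⟨L, v, h0, hlast, hs, 0, h0⟩

theorem HasChain.exists_splittingFiltration [NeZero N] {r : Part N → Part N → Prop}
    (hr : ∀ P Q, r P Q → Q < P) {X : Part N → Prop} (h : HasChain r X ⊤) :
    ∃ π : SplittingFiltration N, (∀ l : Fin π.length, r (π.level l.castSucc) (π.level l.succ)) ∧
      ∃ i, X (π.level i) := by
  obtain ⟨L, v, h0, hlast, hs, hX⟩ := h
  exact ⟨⟨L, v, Fin.strictAnti_iff_succ_lt.2 fun i => hr _ _ (hs i), h0 ▸ parts_top, hlast⟩, hs, hX⟩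

/-- The colouring by the indicator function of a set. -/
def indicatorColouring (t₀ t₁ : κ) (lam : Finset (Fin N)) : Fin N → κ :=
  fun i => if i ∈ lam then t₁ else t₀

theorem indicatorColouring_eq_iff {t₀ t₁ : κ} (ht : t₀ ≠ t₁) {lam : Finset (Fin N)} {i j : Fin N} :
    indicatorColouring t₀ t₁ lam i = indicatorColouring t₀ t₁ lam j ↔ (i ∈ lam ↔ j ∈ lam) := by
  unfold indicatorColouring
  split_ifs with h1 h2 h2 <;> simp [h1, h2, ht, ht.symm]

theorem exists_mem_parts_notMem {P P' : Part N} (hle : P ≤ P') (hne : P ≠ P') :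
    ∃ lam ∈ P.parts, lam ∉ P'.parts := by
  by_contra! h
  refine hne (le_antisymm hle (part_le_iff.2 fun i => ?_))
  rw [part_eq_of_mem' (h _ (part_mem_parts P i)) (mem_part_self' P i)]

/-- If $P<P'$, some part $\lambda$ of $P$ is not a part of $P'$. Colouring $\lambda$ against its
complement refines $P'$ strictly and stays above $P$, so a chain from $P'$ down to $P$ can be built
with two colours only. -/
theorem hasChain_of_le {r : Part N → Part N → Prop} (t₀ t₁ : κ) (ht : t₀ ≠ t₁)
    (hr : ∀ (P : Part N) (d : Fin N → κ), refineBy P d ≠ P → r P (refineBy P d))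
    {X : Part N → Prop} {P : Part N} (hP : HasChain r X P) {P' : Part N} (hle : P ≤ P') :
    HasChain r X P' := by
  induction P' using WellFoundedLT.induction with
  | _ P' ih =>
    by_cases hne : P = P'
    · exact hne ▸ hP
    obtain ⟨lam, hlam, hlam'⟩ := exists_mem_parts_notMem hle hne
    set d := indicatorColouring t₀ t₁ lam
    have h1 : P ≤ refineBy P' d := by
      rw [part_le_iff_same]
      intro i j hij
      rw [same_refineBy]
      refine ⟨part_le_iff_same.1 hle _ _ hij, (indicatorColouring_eq_iff ht).2 ?_⟩
      rw [← P.part_eq_iff_mem hlam, ← P.part_eq_iff_mem hlam, show P.part i = P.part j from hij]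
    have h2 : refineBy P' d ≠ P' := by
      intro heq
      apply hlam'
      obtain ⟨i, hi⟩ := P.nonempty_of_mem_parts hlam
      have h3 : P'.part i = lam := by
        refine Finset.Subset.antisymm (fun j hj => ?_) ?_
        · have h4 : Same (refineBy P' d) j i := by rw [heq]; exact same_iff_mem.2 hj
          exact ((indicatorColouring_eq_iff ht).1 (same_refineBy.1 h4).2).2 hi
        · rw [← part_eq_of_mem' hlam hi]
          exact part_le_iff.1 hle i
      rw [← h3]
      exact part_mem_parts _ _
    exact (ih _ (lt_of_le_of_ne (refineBy_le P' d) h2) h1).cons (hr P' d h2)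

/-- Join a chain from $P$ to $\bot$ with one from $\top$ to $P$. This is why the level abscissae
constrain every partition. -/
theorem exists_splittingFiltration_level_eq [NeZero N] {q : ℕ} (hq : 2 ≤ q) (P : Part N) :
    ∃ π : SplittingFiltration N, 0 < π.mult q ∧ ∃ i, π.level i = P := by
  have hr : ∀ (P : Part N) (d : Fin N → Fin q), refineBy P d ≠ P →
      (refineBy P d < P ∧ 0 < stepMult q P (refineBy P d)) := by
    intro P d hd
    have := stepMult_refineBy_pos P d (by rw [Fintype.card_fin]; omega)
    rw [Fintype.card_fin] at this
    exact ⟨lt_of_le_of_ne (refineBy_le P d) hd, this⟩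
  have h01 : (⟨0, by omega⟩ : Fin q) ≠ ⟨1, by omega⟩ := by simp
  have h1 := hasChain_of_le (r := fun P Q => Q < P ∧ 0 < stepMult q P Q) _ _ h01 hr
    (HasChain.bot _) (bot_le (a := P))
  have h2 := hasChain_of_le _ _ h01 hr h1.self (le_top (a := P))
  obtain ⟨π, hs, hi⟩ := h2.exists_splittingFiltration fun _ _ h => h.1
  refine ⟨π, ?_, hi⟩
  rw [π.mult_eq_prod]
  exact Finset.prod_pos fun l _ => (hs l).2

/-- Every part of `P` with more than one element is split in `Q`. -/
def SplitsAll (P Q : Part N) : Prop := ∀ lam ∈ P.parts, 1 < lam.card → lam ∉ Q.parts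

theorem notMem_refineBy_of_ne {P : Part N} {d : Fin N → κ} {lam : Finset (Fin N)} {i j : Fin N}
    (hi : i ∈ lam) (hj : j ∈ lam) (h : d i ≠ d j) : lam ∉ (refineBy P d).parts := by
  intro hlam
  have : Same (refineBy P d) i j := by
    rw [Same, part_eq_of_mem' hlam hi, part_eq_of_mem' hlam hj]
  exact h (same_refineBy.1 this).2

theorem eq_bot_of_card_le_one {P : Part N} (h : ∀ lam ∈ P.parts, lam.card ≤ 1) : P = ⊥ := by
  refine le_bot_iff.1 (part_le_iff_same.2 fun i j hij => same_bot_iff.2 ?_)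
  exact Finset.card_le_one.1 (h _ (part_mem_parts P j)) i (same_iff_mem.1 hij) j
    (mem_part_self' P j)

theorem exists_branch_of_ne_bot {P : Part N} (h : P ≠ ⊥) : ∃ lam ∈ P.parts, 1 < lam.card := by
  by_contra! h'
  exact h (eq_bot_of_card_le_one h')

theorem ne_of_splitsAll {P Q : Part N} (hP : P ≠ ⊥) (h : SplitsAll P Q) : Q ≠ P := by
  rintro rfl
  obtain ⟨lam, hlam, hcard⟩ := exists_branch_of_ne_bot hP
  exact h lam hlam hcard hlam

theorem hasChain_splitsAll {q : ℕ} (hq : 2 ≤ q) (P : Part N) :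
    HasChain (fun P Q => Q < P ∧ SplitsAll P Q ∧ 0 < stepMult q P Q) (fun _ => True) P := by
  induction P using WellFoundedLT.induction with
  | _ P ih =>
    by_cases hP : P = ⊥
    · exact hP ▸ HasChain.bot _
    have h01 : (⟨0, by omega⟩ : Fin q) ≠ ⟨1, by omega⟩ := by simp
    -- Giving the least element of each part one colour and the remaining elements the other splits
    -- all parts with at least two elements simultaneously.
    set rep : Fin N → Fin N := fun i => (P.part i).min' ⟨i, mem_part_self' P i⟩ with hrep
    set d : Fin N → Fin q := indicatorColouring ⟨0, by omega⟩ ⟨1, by omega⟩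
      (univ.filter fun i => rep i = i) with hd
    have hsplit : SplitsAll P (refineBy P d) := by
      intro lam hlam hcard
      obtain ⟨a, ha⟩ := P.nonempty_of_mem_parts hlam
      have hr : ∀ i ∈ lam, rep i = rep a := by
        intro i hi
        simp only [hrep, part_eq_of_mem' hlam hi, part_eq_of_mem' hlam ha]
      have hra : rep a ∈ lam :=
        (part_eq_of_mem' hlam ha).subset (Finset.min'_mem _ _)
      obtain ⟨b, hb, hne⟩ := Finset.exists_mem_ne hcard (rep a)
      refine notMem_refineBy_of_ne hra hb fun h => ?_
      rw [hd, indicatorColouring_eq_iff h01] at h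
      simp only [mem_filter, mem_univ, true_and, hr _ hra, hr _ hb] at h
      exact hne (h.1 trivial).symm
    have hpos := stepMult_refineBy_pos P d (by rw [Fintype.card_fin]; omega)
    rw [Fintype.card_fin] at hpos
    have hlt := lt_of_le_of_ne (refineBy_le P d) (ne_of_splitsAll hP hsplit)
    exact (ih _ hlt).cons ⟨hlt, hsplit, hpos⟩

/-- The first step splits $[N]$ into $\lambda$ and its complement, and the later ones split every
branch at once. So the branch abscissae of reduced filtrations constrain every proper subset with at
least two elements. -/
theorem exists_isReduced_mem_branches [NeZero N] {q : ℕ} (hq : 2 ≤ q) {lam : Finset (Fin N)}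
    (hcard : 1 < lam.card) (hne : lam ≠ univ) :
    ∃ π : SplittingFiltration N, π.IsReduced ∧ 0 < π.mult q ∧ lam ∈ π.properBranches := by
  have h01 : (⟨0, by omega⟩ : Fin q) ≠ ⟨1, by omega⟩ := by simp
  set d : Fin N → Fin q := indicatorColouring ⟨0, by omega⟩ ⟨1, by omega⟩ lam with hd
  obtain ⟨i, hi⟩ : lam.Nonempty := card_pos.1 (by omega)
  obtain ⟨j, hj⟩ : ∃ j, j ∉ lam := by
    by_contra! h
    exact hne (eq_univ_iff_forall.2 h)
  have hmem : lam ∈ (refineBy ⊤ d).parts := by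
    refine mem_parts_refineBy.2 ⟨⟨i, hi⟩, univ, by rw [parts_top]; simp, ⟨1, by omega⟩, ?_⟩
    ext k
    simp [hd, indicatorColouring]
  have hsplit : SplitsAll ⊤ (refineBy ⊤ d) := by
    intro mu hmu _
    rw [parts_top, mem_singleton] at hmu
    subst hmu
    refine notMem_refineBy_of_ne (mem_univ i) (mem_univ j) fun h => ?_
    rw [hd, indicatorColouring_eq_iff h01] at h
    exact hj (h.1 hi)
  have hpos := stepMult_refineBy_pos ⊤ d (by rw [Fintype.card_fin]; omega)
  rw [Fintype.card_fin] at hpos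
  have htop : (⊤ : Part N) ≠ ⊥ := by
    intro h
    have := same_bot_iff.1 (h ▸ same_top i j)
    exact hj (this ▸ hi)
  have hlt := lt_of_le_of_ne (refineBy_le ⊤ d) (ne_of_splitsAll htop hsplit)
  obtain ⟨π, hs, k, hk⟩ := ((hasChain_splitsAll hq (refineBy ⊤ d)).self.cons
    ⟨hlt, hsplit, hpos⟩).exists_splittingFiltration fun _ _ h => h.1
  refine ⟨π, π.isReduced_iff.2 fun l => (hs l).2.1, ?_, ?_⟩
  · rw [π.mult_eq_prod]
    exact Finset.prod_pos fun l _ => (hs l).2.2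
  · refine mem_sdiff.2 ⟨π.mem_branches.2 ⟨?_, hcard⟩, by simpa using hne⟩
    rw [← hk] at hmem
    induction k using Fin.lastCases with
    | last => have := π.card_le_one_of_mem_last hmem; omega
    | cast l => exact ⟨l, hmem⟩

end Existence

/-! ### The digit recursion: solution and uniqueness -/

section Recursion

open Finset

variable {N : ℕ} {κ : Type*} [Fintype κ] [DecidableEq κ]

/-- Colourings that leave $P$ unrefined contribute $B(P)$ itself; moving this term to the left gives
the denominator $h(P)-1$ and a recursion over strictly finer partitions. -/
theorem eq_sum_of_recursion [NeZero N] (hκ : 0 < Fintype.card κ) (B h : Part N → ℂ)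
    (hbot : B ⊥ = 1)
    (hrec : ∀ P, P ≠ ⊥ → (Fintype.card κ : ℂ) ^ P.parts.card * h P * B P =
      ∑ d : Fin N → κ, B (refineBy P d)) (hne : ∀ P, P ≠ ⊥ → h P ≠ 1) :
    B ⊤ = ∑ π : SplittingFiltration N, (π.mult (Fintype.card κ) : ℂ) *
      ∏ l : Fin π.length, 1 / (h (π.level l.castSucc) - 1) := by
  classical
  have hκ' : (Fintype.card κ : ℂ) ≠ 0 := by exact_mod_cast hκ.ne'
  rw [eq_sum_splittingFiltration
    (fun P Q => (stepMult (Fintype.card κ) P Q : ℂ) * (1 / (h P - 1))) B hbot]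
  · refine Finset.sum_congr rfl fun π _ => ?_
    rw [Finset.prod_mul_distrib, π.mult_eq_prod, Nat.cast_prod]
  · intro P hP
    have h1 := hrec P hP
    rw [sum_refineBy P hκ, sum_le_eq_add_sum_lt, stepMult_self, mul_assoc] at h1
    have h2 := mul_left_cancel₀ (pow_ne_zero _ hκ') h1
    have h3 : h P - 1 ≠ 0 := sub_ne_zero.2 (hne P hP)
    have h4 : B P = (1 / (h P - 1)) *
        ∑ Q : Part N with Q < P, (stepMult (Fintype.card κ) P Q : ℂ) * B Q := by
      rw [one_div, eq_inv_mul_iff_mul_eq₀ h3, sub_mul, h2]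
      push_cast
      ring
    rw [h4, Finset.mul_sum]
    exact Finset.sum_congr rfl fun Q _ => by ring

theorem recursion_unique (hκ : 0 < Fintype.card κ) (B W h : Part N → ℂ)
    (hB : B ⊥ = 1) (hW : W ⊥ = 1)
    (hBrec : ∀ P, P ≠ ⊥ → (Fintype.card κ : ℂ) ^ P.parts.card * h P * B P =
      ∑ d : Fin N → κ, B (refineBy P d))
    (hWrec : ∀ P, P ≠ ⊥ → (Fintype.card κ : ℂ) ^ P.parts.card * h P * W P =
      ∑ d : Fin N → κ, W (refineBy P d)) (hne : ∀ P, P ≠ ⊥ → h P ≠ 1) (P : Part N) :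
    B P = W P := by
  classical
  have hκ' : (Fintype.card κ : ℂ) ≠ 0 := by exact_mod_cast hκ.ne'
  induction P using WellFoundedLT.induction with
  | _ P ih =>
    by_cases hP : P = ⊥
    · rw [hP, hB, hW]
    have h1 := hBrec P hP
    have h2 := hWrec P hP
    rw [sum_refineBy P hκ, sum_le_eq_add_sum_lt, stepMult_self, mul_assoc] at h1 h2
    have h3 := mul_left_cancel₀ (pow_ne_zero _ hκ') h1
    have h4 := mul_left_cancel₀ (pow_ne_zero _ hκ') h2
    have h5 : ∑ Q : Part N with Q < P, (stepMult (Fintype.card κ) P Q : ℂ) * B Q =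
        ∑ Q : Part N with Q < P, (stepMult (Fintype.card κ) P Q : ℂ) * W Q :=
      Finset.sum_congr rfl fun Q hQ => by rw [ih Q (mem_filter.1 hQ).2]
    rw [h5] at h3
    have h6 : (h P - 1) * (B P - W P) = 0 := by
      push_cast at h3 h4
      linear_combination h3 - h4
    rcases mul_eq_zero.1 h6 with h7 | h7
    · exact absurd (sub_eq_zero.1 h7) (hne P hP)
    · exact sub_eq_zero.1 h7

end Recursion

end LogCoulomb

namespace LogCoulomb

set_option linter.unusedSectionVars false

/-! ### Multiplicative weights: from all filtrations to reduced ones -/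

section Trees

open Finset

variable {N : ℕ} {κ : Type*} [Fintype κ] [DecidableEq κ]

/-- The elements of `lam` of a given colour. -/
def fibre (lam : Finset (Fin N)) (d : lam → κ) (t : κ) : Finset (Fin N) :=
  (univ.filter fun i => d i = t).map (Function.Embedding.subtype _)

theorem mem_fibre {lam : Finset (Fin N)} {d : lam → κ} {t : κ} {i : Fin N} :
    i ∈ fibre lam d t ↔ ∃ h : i ∈ lam, d ⟨i, h⟩ = t := by
  simp [fibre]

theorem fibre_subset (lam : Finset (Fin N)) (d : lam → κ) (t : κ) : fibre lam d t ⊆ lam :=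
  fun _ hi => (mem_fibre.1 hi).1

theorem fibre_restrict (lam : Finset (Fin N)) (d : Fin N → κ) (t : κ) :
    fibre lam (fun i => d i) t = lam.filter (d · = t) := by
  ext i; simp [mem_fibre]

/-- The tree function: the solution of the recursion over the branches of trees. -/
noncomputable def treeFun (κ : Type*) [Fintype κ] [DecidableEq κ] (g : Finset (Fin N) → ℂ)
    (lam : Finset (Fin N)) : ℂ :=
  if lam.card ≤ 1 then 1 else
    ((Fintype.card κ : ℂ) * (g lam - 1))⁻¹ * ∑ d : lam → κ,
      if h : ∀ t, (fibre lam d t).card < lam.card then ∏ t, treeFun κ g (fibre lam d t) else 0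
termination_by lam.card
decreasing_by exact h t

variable (g : Finset (Fin N) → ℂ)

theorem treeFun_of_card_le_one {lam : Finset (Fin N)} (h : lam.card ≤ 1) :
    treeFun κ g lam = 1 := by
  rw [treeFun, if_pos h]

theorem forall_card_fibre_lt_iff {lam : Finset (Fin N)} {d : lam → κ} :
    (∀ t, (fibre lam d t).card < lam.card) ↔ ∀ t, fibre lam d t ≠ lam := by
  refine forall_congr' fun t => ⟨fun h h' => by rw [h'] at h; exact lt_irrefl _ h, fun h => ?_⟩
  exact card_lt_card (lt_of_le_of_ne (fibre_subset lam d t) h)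

theorem treeFun_of_one_lt_card (hκ : 0 < Fintype.card κ) {lam : Finset (Fin N)} (h : 1 < lam.card)
    (hg : g lam ≠ 1) : (Fintype.card κ : ℂ) * ((g lam - 1) * treeFun κ g lam) =
      ∑ d : lam → κ, if ∀ t, fibre lam d t ≠ lam then ∏ t, treeFun κ g (fibre lam d t) else 0 := by
  have hκ' : (Fintype.card κ : ℂ) ≠ 0 := by exact_mod_cast hκ.ne'
  rw [treeFun, if_neg (not_le.2 h), ← mul_assoc, ← mul_assoc,
    mul_inv_cancel₀ (mul_ne_zero hκ' (sub_ne_zero.2 hg)), one_mul]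
  refine Finset.sum_congr rfl fun d _ => ?_
  rw [dite_eq_ite]
  simp only [forall_card_fibre_lt_iff]

/-- The defining recursion omits the constant colourings. Each of these has one fibre equal to
$\lambda$ and the others empty, of value 1; adding all of them turns $g(\lambda)-1$ into
$g(\lambda)$. -/
theorem treeFun_sum_all (hκ : 0 < Fintype.card κ) {lam : Finset (Fin N)} (h : 1 < lam.card)
    (hg : g lam ≠ 1) : (Fintype.card κ : ℂ) * (g lam * treeFun κ g lam) =
      ∑ d : lam → κ, ∏ t, treeFun κ g (fibre lam d t) := by
  have h1 := treeFun_of_one_lt_card (κ := κ) g hκ h hg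
  have h2 : ∑ d : lam → κ, (if ∀ t, fibre lam d t ≠ lam then 0 else
      ∏ t, treeFun κ g (fibre lam d t)) = (Fintype.card κ : ℂ) * treeFun κ g lam := by
    obtain ⟨i, hi⟩ : lam.Nonempty := card_pos.1 (by omega)
    have hconst : ∀ t t' : κ, fibre lam (fun _ => t) t' = if t = t' then lam else ∅ := by
      intro t t'
      ext j
      split_ifs with h <;> simp [mem_fibre, h]
    have hsum : ∑ _t : κ, treeFun κ g lam = ∑ d : lam → κ, (if ∀ t, fibre lam d t ≠ lam then 0 else
        ∏ t, treeFun κ g (fibre lam d t)) := by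
      refine Fintype.sum_of_injective (fun (t : κ) (_ : lam) => t)
        (fun t t' htt => congrFun htt ⟨i, hi⟩) _ _ (fun d hd => if_pos fun t ht => hd ⟨t, ?_⟩)
        fun t => ?_
      · funext j
        have hj : j.1 ∈ fibre lam d t := by rw [ht]; exact j.2
        exact (mem_fibre.1 hj).2.symm
      · rw [if_neg (by push Not; exact ⟨t, by simp [hconst]⟩), Finset.prod_eq_single t]
        · simp [hconst]
        · intro t' _ hne
          rw [hconst, if_neg hne.symm]
          exact treeFun_of_card_le_one g (by simp)
        · simp
    rw [← hsum]
    simp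
  rw [← sub_eq_zero] at h1 h2 ⊢
  have h3 : ∑ d : lam → κ, ∏ t, treeFun κ g (fibre lam d t) =
      (∑ d : lam → κ, if ∀ t, fibre lam d t ≠ lam then ∏ t, treeFun κ g (fibre lam d t) else 0) +
      ∑ d : lam → κ, (if ∀ t, fibre lam d t ≠ lam then 0 else
        ∏ t, treeFun κ g (fibre lam d t)) := by
    rw [← Finset.sum_add_distrib]
    exact Finset.sum_congr rfl fun d _ => by split_ifs <;> simp
  linear_combination h1 - h2 - h3

theorem treeFun_sum_small {lam : Finset (Fin N)} (h : lam.card = 1) :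
    (Fintype.card κ : ℂ) * treeFun κ g lam = ∑ d : lam → κ, ∏ t, treeFun κ g (fibre lam d t) := by
  have h1 : ∀ (d : lam → κ) (t : κ), treeFun κ g (fibre lam d t) = 1 := fun d t =>
    treeFun_of_card_le_one g ((card_le_card (fibre_subset lam d t)).trans h.le)
  simp [h1, treeFun_of_card_le_one g h.le, h]

/-- A colouring of $[N]$ is an independent choice of a colouring on each part; the rest is
distributivity. -/
theorem sum_prod_restrict (P : Part N) (G : (lam : P.parts) → (lam.1 → κ) → ℂ) :
    ∑ d : Fin N → κ, ∏ lam : P.parts, G lam (fun i => d i) =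
      ∏ lam : P.parts, ∑ d : lam.1 → κ, G lam d := by
  rw [Finset.prod_univ_sum]
  let e : (Fin N → κ) ≃ ((lam : P.parts) → lam.1 → κ) :=
    { toFun := fun d lam i => d i
      invFun := fun d i => d ⟨P.part i, part_mem_parts P i⟩ ⟨i, mem_part_self' P i⟩
      left_inv := fun d => rfl
      right_inv := fun d => by
        funext lam i
        have key : ∀ (lam lam' : P.parts) (_ : lam = lam') (i : Fin N) (hi : i ∈ lam.1)
            (hi' : i ∈ lam'.1), d lam ⟨i, hi⟩ = d lam' ⟨i, hi'⟩ := by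
          rintro lam _ rfl i hi hi'
          rfl
        exact key _ _ (Subtype.ext (part_eq_of_mem' lam.2 i.2)) i.1 _ _ }
  rw [Fintype.piFinset_univ, ← e.sum_comp]
  rfl

/-- The product of the tree function over the parts of a partition. -/
noncomputable def forestFun (κ : Type*) [Fintype κ] [DecidableEq κ] (g : Finset (Fin N) → ℂ)
    (P : Part N) : ℂ := ∏ lam ∈ P.parts, treeFun κ g lam

theorem forestFun_bot : forestFun κ g ⊥ = 1 := by
  refine Finset.prod_eq_one fun lam hlam => ?_
  obtain ⟨a, _, rfl⟩ := Finpartition.mem_bot_iff.1 hlam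
  exact treeFun_of_card_le_one g (by simp)

/-- The parts of the refinement are the nonempty colour fibres, and empty fibres contribute 1. -/
theorem forestFun_refineBy (P : Part N) (d : Fin N → κ) :
    forestFun κ g (refineBy P d) =
      ∏ lam : P.parts, ∏ t, treeFun κ g (fibre lam.1 (fun i => d i) t) := by
  simp_rw [fibre_restrict]
  rw [Finset.prod_coe_sort P.parts fun lam => ∏ t, treeFun κ g (lam.filter (d · = t)),
    ← Finset.prod_product' P.parts univ fun lam t => treeFun κ g (lam.filter (d · = t)), forestFun]
  rw [← Finset.prod_filter_of_ne (s := P.parts ×ˢ univ)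
    (p := fun x : Finset (Fin N) × κ => (x.1.filter (d · = x.2)).Nonempty)]
  · symm
    refine Finset.prod_nbij (fun x => x.1.filter (d · = x.2)) ?_ ?_ ?_ fun _ _ => rfl
    · rintro ⟨lam, t⟩ hx
      rw [mem_filter, mem_product] at hx
      exact mem_parts_refineBy.2 ⟨hx.2, lam, hx.1.1, t, rfl⟩
    · rintro ⟨lam, t⟩ hx ⟨lam', t'⟩ hx' h
      simp only [coe_filter, mem_product, mem_univ, and_true, Set.mem_ofPred_eq] at hx hx' h
      obtain ⟨i, hi⟩ := hx.2
      have hi' := hi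
      rw [h] at hi'
      rw [mem_filter] at hi hi'
      rw [P.eq_of_mem_parts hx.1 hx'.1 hi.1 hi'.1, ← hi.2, ← hi'.2]
    · intro mu hmu
      obtain ⟨hne, lam, hlam, t, rfl⟩ := mem_parts_refineBy.1 hmu
      exact ⟨(lam, t), by simpa using ⟨hlam, hne⟩, rfl⟩
  · intro x _ hx
    by_contra h
    rw [not_nonempty_iff_eq_empty] at h
    apply hx
    rw [h]
    exact treeFun_of_card_le_one g (by simp)

/-- The branches evolve independently, so the forest satisfies the same recursion as the integrals,
with $h(P)=\prod g(\lambda)$. -/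
theorem forestFun_recursion (hκ : 0 < Fintype.card κ) (P : Part N)
    (hg : ∀ lam, 1 < lam.card → g lam ≠ 1) :
    (Fintype.card κ : ℂ) ^ P.parts.card * (∏ lam ∈ P.parts with 1 < lam.card, g lam) *
      forestFun κ g P = ∑ d : Fin N → κ, forestFun κ g (refineBy P d) := by
  simp_rw [forestFun_refineBy]
  rw [sum_prod_restrict P fun lam d => ∏ t, treeFun κ g (fibre lam.1 d t),
    Finset.prod_coe_sort P.parts fun lam => ∑ d : lam → κ, ∏ t, treeFun κ g (fibre lam d t),
    Finset.prod_filter, forestFun, ← Finset.prod_const, ← Finset.prod_mul_distrib,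
    ← Finset.prod_mul_distrib]
  refine Finset.prod_congr rfl fun lam hlam => ?_
  split_ifs with h
  · rw [mul_assoc, treeFun_sum_all g hκ h (hg lam h)]
  · have := card_pos.2 (P.nonempty_of_mem_parts hlam)
    rw [mul_one, treeFun_sum_small g (by omega)]

theorem splitsAll_refineBy_iff {P : Part N} {d : Fin N → κ} : SplitsAll P (refineBy P d) ↔
    ∀ lam : P.parts, 1 < lam.1.card → ∀ t, fibre lam.1 (fun i => d i) t ≠ lam.1 := by
  simp_rw [fibre_restrict]
  constructor
  · intro h lam hcard t ht
    refine h lam.1 lam.2 hcard (mem_parts_refineBy.2 ⟨?_, lam.1, lam.2, t, ht.symm⟩)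
    exact P.nonempty_of_mem_parts lam.2
  · intro h lam hlam hcard hmem
    obtain ⟨⟨i, hi⟩, lam', hlam', t, ht⟩ := mem_parts_refineBy.1 hmem
    have : i ∈ lam' := by rw [ht] at hi; exact (mem_filter.1 hi).1
    obtain rfl := P.eq_of_mem_parts hlam hlam' hi this
    exact h ⟨lam, hlam⟩ hcard t ht.symm

-- The same factorization with constant colourings of branches forbidden: each branch then carries
-- $g(\lambda)-1$ in place of $g(\lambda)$.
open scoped Classical in
theorem forestFun_recursion_splitsAll (hκ : 0 < Fintype.card κ) (P : Part N)
    (hg : ∀ lam, 1 < lam.card → g lam ≠ 1) :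
    (Fintype.card κ : ℂ) ^ P.parts.card * ((∏ lam ∈ P.parts with 1 < lam.card, (g lam - 1)) *
      forestFun κ g P) =
        ∑ d : Fin N → κ, if SplitsAll P (refineBy P d) then forestFun κ g (refineBy P d) else 0 := by
  have h1 : ∀ d : Fin N → κ,
      (if SplitsAll P (refineBy P d) then forestFun κ g (refineBy P d) else 0) =
      ∏ lam : P.parts, if 1 < lam.1.card → ∀ t, fibre lam.1 (fun i => d i) t ≠ lam.1 then
        ∏ t, treeFun κ g (fibre lam.1 (fun i => d i) t) else 0 := by
    intro d
    rw [Fintype.prod_ite_zero, forestFun_refineBy]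
    simp only [splitsAll_refineBy_iff]
  simp_rw [h1]
  rw [sum_prod_restrict P fun lam d => if 1 < lam.1.card → ∀ t, fibre lam.1 d t ≠ lam.1 then
      ∏ t, treeFun κ g (fibre lam.1 d t) else 0,
    Finset.prod_coe_sort P.parts fun lam => ∑ d : lam → κ,
      if 1 < lam.card → ∀ t, fibre lam d t ≠ lam then ∏ t, treeFun κ g (fibre lam d t) else 0,
    Finset.prod_filter, forestFun, ← Finset.prod_const, ← Finset.prod_mul_distrib,
    ← Finset.prod_mul_distrib]
  refine Finset.prod_congr rfl fun lam hlam => ?_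
  split_ifs with h
  · rw [treeFun_of_one_lt_card g hκ h (hg lam h)]
    simp [h]
  · have := card_pos.2 (P.nonempty_of_mem_parts hlam)
    rw [one_mul, treeFun_sum_small g (by omega)]
    simp [h]

/-- By uniqueness $B$ is the forest function, whose second recursion has kernel zero unless every
branch splits. Its chains are therefore the reduced filtrations, and each branch lies in exactly one
level, so the product over levels is a product over branches. -/
theorem eq_sum_reducedFiltrations [NeZero N] (hκ : 0 < Fintype.card κ) (B : Part N → ℂ)
    (hbot : B ⊥ = 1)
    (hrec : ∀ P, P ≠ ⊥ → (Fintype.card κ : ℂ) ^ P.parts.card *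
      (∏ lam ∈ P.parts with 1 < lam.card, g lam) * B P = ∑ d : Fin N → κ, B (refineBy P d))
    (hg : ∀ lam, 1 < lam.card → g lam ≠ 1)
    (hne : ∀ P : Part N, P ≠ ⊥ → ∏ lam ∈ P.parts with 1 < lam.card, g lam ≠ 1) :
    B ⊤ = ∑ π ∈ reducedFiltrations N, (π.mult (Fintype.card κ) : ℂ) *
      ∏ lam ∈ π.branches, 1 / (g lam - 1) := by
  have hκ' : (Fintype.card κ : ℂ) ≠ 0 := by exact_mod_cast hκ.ne'
  obtain ⟨h, hh⟩ : ∃ h : Part N → ℂ, ∀ P, h P = ∏ lam ∈ P.parts with 1 < lam.card, g lam :=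
    ⟨_, fun _ => rfl⟩
  have hBW := recursion_unique hκ B (forestFun κ g) h hbot (forestFun_bot g)
    (fun P hP => by rw [hh]; exact hrec P hP)
    (fun P _ => by rw [hh]; exact forestFun_recursion g hκ P hg)
    (fun P hP => by rw [hh]; exact hne P hP) ⊤
  classical
  have hsum := eq_sum_splittingFiltration (fun P Q => if SplitsAll P Q then
      (stepMult (Fintype.card κ) P Q : ℂ) * ∏ lam ∈ P.parts with 1 < lam.card, 1 / (g lam - 1)
      else 0) (forestFun κ g) (forestFun_bot g) ?_
  · rw [hBW, hsum, reducedFiltrations, Finset.sum_filter]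
    refine Finset.sum_congr rfl fun π _ => ?_
    by_cases hred : π.IsReduced
    · have hs : ∀ l : Fin π.length, SplitsAll (π.level l.castSucc) (π.level l.succ) :=
        π.isReduced_iff.1 hred
      rw [if_pos hred, Finset.prod_congr rfl fun l _ => if_pos (hs l),
        Finset.prod_mul_distrib, π.mult_eq_prod, Nat.cast_prod,
        π.prod_prod_parts_eq fun _ lam => 1 / (g lam - 1)]
      congr 1
      refine Finset.prod_congr rfl fun lam hlam => ?_
      obtain ⟨l, hl, huniq⟩ := hred lam hlam
      have : π.levelsOf lam = {l} := by
        ext k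
        rw [SplittingFiltration.levelsOf, mem_filter, mem_singleton]
        exact ⟨fun h => huniq k h.2, fun h => ⟨mem_univ _, h ▸ hl⟩⟩
      rw [this, Finset.prod_singleton]
    · rw [if_neg hred]
      rw [π.isReduced_iff] at hred
      push Not at hred
      obtain ⟨l, lam, h1, h2, h3⟩ := hred
      exact Finset.prod_eq_zero (mem_univ l) (if_neg fun h => h lam h1 h2 h3)
  · intro P hP
    have h1 := forestFun_recursion_splitsAll g hκ P hg
    rw [sum_refineBy P hκ fun Q => if SplitsAll P Q then forestFun κ g Q else 0,
      sum_le_eq_add_sum_lt, if_neg fun h => ne_of_splitsAll hP h rfl, mul_zero, zero_add] at h1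
    have h2 := mul_left_cancel₀ (pow_ne_zero _ hκ') h1
    have h3 : ∏ lam ∈ P.parts with 1 < lam.card, (g lam - 1) ≠ 0 :=
      Finset.prod_ne_zero_iff.2 fun lam hlam => sub_ne_zero.2 (hg lam (mem_filter.1 hlam).2)
    rw [← eq_inv_mul_iff_mul_eq₀ h3] at h2
    rw [h2, Finset.mul_sum]
    refine Finset.sum_congr rfl fun Q _ => ?_
    simp only [one_div, Finset.prod_inv_distrib]
    split_ifs <;> ring

end Trees

end LogCoulomb

namespace LogCoulomb

open MeasureTheory ValuativeRel Topology

set_option linter.unusedSectionVars false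

/-! ### Pairs inside the parts of a partition -/

section Pairs

open Finset

variable {N : ℕ}

/-- The pairs of indices which lie in the same part of `P`. -/
def pairsOf (P : Part N) : Finset (Pair N) := univ.filter fun p => Same P p.1.1 p.1.2

theorem mem_pairsOf {P : Part N} {p : Pair N} : p ∈ pairsOf P ↔ Same P p.1.1 p.1.2 := by
  simp [pairsOf]

theorem same_of_pairs {P : Part N} {i j : Fin N} (h : i ≠ j) (hij : Same P i j) :
    ∃ p ∈ pairsOf P, (p.1.1 = i ∧ p.1.2 = j) ∨ (p.1.1 = j ∧ p.1.2 = i) := by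
  rcases lt_or_gt_of_ne h with hlt | hlt
  · exact ⟨⟨(i, j), hlt⟩, mem_pairsOf.2 hij, Or.inl ⟨rfl, rfl⟩⟩
  · exact ⟨⟨(j, i), hlt⟩, mem_pairsOf.2 hij.symm, Or.inr ⟨rfl, rfl⟩⟩

theorem pairsOf_nonempty_iff {P : Part N} : (pairsOf P).Nonempty ↔ P ≠ ⊥ := by
  constructor
  · rintro ⟨p, hp⟩ rfl
    exact p.2.ne (same_bot_iff.1 (mem_pairsOf.1 hp))
  · intro h
    by_contra h'
    apply h
    refine le_bot_iff.1 (part_le_iff_same.2 fun i j hij => same_bot_iff.2 ?_)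
    by_contra hne
    obtain ⟨p, hp, -⟩ := same_of_pairs hne hij
    exact h' ⟨p, hp⟩

theorem mem_pairsOf_refineBy {κ : Type*} [Fintype κ] [DecidableEq κ] {P : Part N} {d : Fin N → κ}
    {p : Pair N} : p ∈ pairsOf (refineBy P d) ↔ p ∈ pairsOf P ∧ d p.1.1 = d p.1.2 := by
  rw [mem_pairsOf, same_refineBy, mem_pairsOf]

theorem pairsOf_top [NeZero N] : pairsOf (⊤ : Part N) = univ := by
  ext p; simp [mem_pairsOf, same_top]

theorem eq_top_iff_pairs [NeZero N] {P : Part N} : P = ⊤ ↔ ∀ p : Pair N, p ∈ pairsOf P := by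
  constructor
  · rintro rfl p
    rw [pairsOf_top]; exact mem_univ p
  · intro h
    refine top_le_iff.1 (part_le_iff_same.2 fun i j _ => ?_)
    rcases lt_trichotomy i j with hij | hij | hij
    · exact mem_pairsOf.1 (h ⟨(i, j), hij⟩)
    · rw [hij]; rfl
    · exact (mem_pairsOf.1 (h ⟨(j, i), hij⟩)).symm

theorem bot_ne_top (hN : 2 ≤ N) : (⊥ : Part N) ≠ ⊤ := by
  have : NeZero N := ⟨by omega⟩
  intro h
  have := same_top (⟨0, by omega⟩ : Fin N) ⟨1, by omega⟩
  rw [← h, same_bot_iff] at this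
  simp at this

theorem nonempty_pair (hN : 2 ≤ N) : Nonempty (Pair N) :=
  ⟨⟨(⟨0, by omega⟩, ⟨1, by omega⟩), by simp [Fin.lt_def]⟩⟩

/-- The exponent by which `potential` scales. -/
noncomputable def weight (a b : ℂ) (s : Pair N → ℂ) (P : Part N) : ℂ :=
  (if P = ⊤ then a else 0) + (if P = ⊥ then 0 else b) + ∑ p ∈ pairsOf P, s p

end Pairs

theorem cpow_finset_sum {ι : Type*} {z : ℂ} (hz : z ≠ 0) (t : Finset ι) (f : ι → ℂ) :
    z ^ ∑ i ∈ t, f i = ∏ i ∈ t, z ^ f i := by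
  classical
  induction t using Finset.induction_on with
  | empty => simp
  | insert i t hi ih => rw [Finset.sum_insert hi, Finset.prod_insert hi, Complex.cpow_add _ _ hz, ih]

/-! ### Behaviour of the integrand under a digit expansion -/

section Potential

variable {K : Type*} [Field K] [ValuativeRel K] [TopologicalSpace K]
  [IsNonarchimedeanLocalField K] [MeasurableSpace K] [BorelSpace K] {N : ℕ}

/-- The distance of the coordinates in a pair. -/
noncomputable def pairDist (x : Fin N → K) (p : Pair N) : ℝ := canonicalAbs (x p.1.1 - x p.1.2)

theorem pairDist_nonneg (x : Fin N → K) (p : Pair N) : 0 ≤ pairDist x p := canonicalAbs_nonneg _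

theorem pairDist_le_one {x : Fin N → K} (hx : x ∈ intBox K N) (p : Pair N) : pairDist x p ≤ 1 :=
  (canonicalAbs_le_one_iff _).2 (sub_mem (mem_intBox.1 hx _) (mem_intBox.1 hx _))

theorem measurable_pairDist (p : Pair N) : Measurable fun x : Fin N → K => pairDist x p :=
  measurable_canonicalAbs_sub _ _

theorem pairDist_digitEquiv_of_eq {d : Fin N → 𝓀[K]} {p : Pair N} (h : d p.1.1 = d p.1.2)
    (y : Fin N → K) :
    pairDist (digitEquiv d y) p = (residueCard K : ℝ)⁻¹ * pairDist y p := by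
  rw [pairDist, digitEquiv_apply, digitEquiv_apply, h, add_sub_add_left_eq_sub, ← mul_sub,
    canonicalAbs_uniformizer_mul]
  rfl

theorem pairDist_digitEquiv_of_ne {d : Fin N → 𝓀[K]} {p : Pair N} (h : d p.1.1 ≠ d p.1.2)
    {y : Fin N → K} (hy : y ∈ intBox K N) : pairDist (digitEquiv d y) p = 1 :=
  canonicalAbs_digit_sub h (mem_intBox.1 hy _) (mem_intBox.1 hy _)

theorem digitEquiv_mem_intBox {d : Fin N → 𝓀[K]} {y : Fin N → K} (hy : y ∈ intBox K N) :
    digitEquiv d y ∈ intBox K N :=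
  mem_intBox.2 fun i => digit_add_mem (d i) (mem_intBox.1 hy i)

theorem maxDist_eq (x : Fin N → K) : maxDist x = ⨆ p, pairDist x p := rfl

theorem minDist_eq (x : Fin N → K) : minDist x = ⨅ p, pairDist x p := rfl

theorem maxDist_nonneg (x : Fin N → K) : 0 ≤ maxDist x :=
  Real.iSup_nonneg fun _ => canonicalAbs_nonneg _

theorem minDist_nonneg (x : Fin N → K) : 0 ≤ minDist x :=
  Real.iInf_nonneg fun _ => canonicalAbs_nonneg _

theorem measurable_maxDist : Measurable (maxDist : (Fin N → K) → ℝ) :=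
  Measurable.iSup fun p => measurable_pairDist p

theorem residueCard_cpow_scale {t : ℝ} (ht : 0 ≤ t) (a : ℂ) :
    (((residueCard K : ℝ)⁻¹ * t : ℝ) : ℂ) ^ a = (residueCard K : ℂ) ^ (-a) * (t : ℂ) ^ a := by
  rw [Complex.ofReal_mul, Complex.mul_cpow_ofReal_nonneg (inv_nonneg.2 residueCard_pos.le) ht,
    Complex.ofReal_inv, Complex.ofReal_natCast, Complex.inv_cpow, Complex.cpow_neg]
  -- Inverting the base of a complex power requires its argument to differ from $\pi$.
  rw [Complex.natCast_arg]
  exact Real.pi_pos.ne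

/-- The part of the integrand which comes from the pairs of indices in the same part of `P`. -/
noncomputable def potential (a b : ℂ) (s : Pair N → ℂ) (P : Part N) (x : Fin N → K) : ℂ :=
  (if P = ⊤ then (maxDist x : ℂ) ^ a else 1) *
    (if h : (pairsOf P).Nonempty then (((pairsOf P).inf' h (pairDist x) : ℝ) : ℂ) ^ b else 1) *
      ∏ p ∈ pairsOf P, (pairDist x p : ℂ) ^ s p

variable (a b : ℂ) (s : Pair N → ℂ)

theorem measurable_potential (P : Part N) :
    Measurable (potential a b s P : (Fin N → K) → ℂ) := by
  unfold potential
  refine (Measurable.mul ?_ ?_).mul ?_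
  · split_ifs
    · exact (Complex.measurable_ofReal.comp measurable_maxDist).pow_const a
    · exact measurable_const
  · split_ifs with h
    · have h1 : Measurable fun x : Fin N → K => (pairsOf P).inf' h (pairDist x) := by
        refine measurable_of_Ici fun t => ?_
        have : (fun x : Fin N → K => (pairsOf P).inf' h (pairDist x)) ⁻¹' Set.Ici t =
            ⋂ p ∈ pairsOf P, {x | t ≤ pairDist x p} := by
          ext x
          simp [Finset.le_inf'_iff]
        rw [this]
        exact Finset.measurableSet_biInter _ fun p _ =>
          measurableSet_le measurable_const (measurable_pairDist p)
      exact (Complex.measurable_ofReal.comp h1).pow_const b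
    · exact measurable_const
  · exact Finset.measurable_prod _ fun p _ =>
      (Complex.measurable_ofReal.comp (measurable_pairDist p)).pow_const _

theorem potential_bot (hN : 2 ≤ N) (x : Fin N → K) : potential a b s ⊥ x = 1 := by
  have h : ¬ (pairsOf (⊥ : Part N)).Nonempty := fun h => pairsOf_nonempty_iff.1 h rfl
  rw [potential, if_neg (bot_ne_top hN), dif_neg h, Finset.not_nonempty_iff_eq_empty.1 h]
  simp

theorem weight_bot (hN : 2 ≤ N) : weight a b s ⊥ = 0 := by
  have h : ¬ (pairsOf (⊥ : Part N)).Nonempty := fun h => pairsOf_nonempty_iff.1 h rfl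
  rw [weight, if_neg (bot_ne_top hN), Finset.not_nonempty_iff_eq_empty.1 h]
  simp

/-- If all digits agree, every distance shrinks by $q$; otherwise some pair is at distance 1, the
maximum is 1 and the factor disappears. So the maximum is needed only for $P=\top$. -/
theorem maxFactor_digitEquiv (hN : 2 ≤ N) (P : Part N) (d : Fin N → 𝓀[K]) [DecidableEq 𝓀[K]]
    {y : Fin N → K} (hy : y ∈ intBox K N) :
    (if P = ⊤ then (maxDist (digitEquiv d y) : ℂ) ^ a else 1) =
      (residueCard K : ℂ) ^ (-(if refineBy P d = ⊤ then a else 0)) *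
        (if refineBy P d = ⊤ then (maxDist y : ℂ) ^ a else 1) := by
  have : NeZero N := ⟨by omega⟩
  have := nonempty_pair hN
  by_cases hQ : refineBy P d = ⊤
  · have hP : P = ⊤ := top_le_iff.1 (hQ ▸ refineBy_le P d)
    rw [if_pos hQ, if_pos hQ, if_pos hP, ← residueCard_cpow_scale (maxDist_nonneg y)]
    congr 2
    rw [maxDist_eq, maxDist_eq, Real.mul_iSup_of_nonneg (inv_nonneg.2 residueCard_pos.le)]
    exact congrArg _ (funext fun p => pairDist_digitEquiv_of_eq
      (mem_pairsOf_refineBy.1 (eq_top_iff_pairs.1 hQ p)).2 y)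
  · rw [if_neg hQ, if_neg hQ]
    split_ifs with hP
    · rw [eq_top_iff_pairs] at hQ
      push Not at hQ
      obtain ⟨p, hp⟩ := hQ
      have hdp : d p.1.1 ≠ d p.1.2 := by
        intro h
        exact hp (mem_pairsOf_refineBy.2 ⟨eq_top_iff_pairs.1 hP p, h⟩)
      have hmax : maxDist (digitEquiv d y) = 1 := by
        rw [maxDist_eq]
        refine le_antisymm (ciSup_le fun p => pairDist_le_one (digitEquiv_mem_intBox hy) p) ?_
        rw [← pairDist_digitEquiv_of_ne hdp hy]
        exact le_ciSup (f := fun p => pairDist (digitEquiv d y) p) (Set.finite_range _).bddAbove p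
      simp [hmax]
    · simp

/-- Pairs with equal digits are at distance at most $q^{-1}$ and the others at distance 1, so the
minimum is taken over the pairs of the refinement whenever there are any, and is 1 otherwise. -/
theorem minFactor_digitEquiv (P : Part N) (d : Fin N → 𝓀[K]) [DecidableEq 𝓀[K]]
    {y : Fin N → K} (hy : y ∈ intBox K N) :
    (if h : (pairsOf P).Nonempty then
      (((pairsOf P).inf' h (pairDist (digitEquiv d y)) : ℝ) : ℂ) ^ b else 1) =
      (residueCard K : ℂ) ^ (-(if refineBy P d = ⊥ then 0 else b)) *
        (if h : (pairsOf (refineBy P d)).Nonempty then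
          (((pairsOf (refineBy P d)).inf' h (pairDist y) : ℝ) : ℂ) ^ b else 1) := by
  by_cases hQ : refineBy P d = ⊥
  · have hQ' : ¬ (pairsOf (refineBy P d)).Nonempty := fun h => pairsOf_nonempty_iff.1 h hQ
    rw [if_pos hQ, dif_neg hQ']
    split_ifs with h
    · have h1 : (pairsOf P).inf' h (pairDist (digitEquiv d y)) = 1 := by
        obtain ⟨p, hp, he⟩ := Finset.exists_mem_eq_inf' h (pairDist (digitEquiv d y))
        rw [he]
        refine pairDist_digitEquiv_of_ne (fun hd => hQ' ⟨p, mem_pairsOf_refineBy.2 ⟨hp, hd⟩⟩) hy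
      simp [h1]
    · simp
  · have hQ' : (pairsOf (refineBy P d)).Nonempty := pairsOf_nonempty_iff.2 hQ
    have hP' : (pairsOf P).Nonempty :=
      hQ'.mono fun p hp => (mem_pairsOf_refineBy.1 hp).1
    have h0 : 0 ≤ (pairsOf (refineBy P d)).inf' hQ' (pairDist y) :=
      Finset.le_inf' _ _ fun p _ => pairDist_nonneg y p
    have hq1 : (residueCard K : ℝ)⁻¹ ≤ 1 := inv_le_one_of_one_le₀ one_lt_residueCard_real.le
    rw [if_neg hQ, dif_pos hQ', dif_pos hP', ← residueCard_cpow_scale h0]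
    congr 2
    refine le_antisymm ?_ ?_
    · obtain ⟨p, hp, he⟩ := Finset.exists_mem_eq_inf' hQ' (pairDist y)
      rw [he, ← pairDist_digitEquiv_of_eq (mem_pairsOf_refineBy.1 hp).2]
      exact Finset.inf'_le _ (mem_pairsOf_refineBy.1 hp).1
    · refine Finset.le_inf' _ _ fun p hp => ?_
      by_cases hd : d p.1.1 = d p.1.2
      · rw [pairDist_digitEquiv_of_eq hd]
        refine mul_le_mul_of_nonneg_left ?_ (inv_nonneg.2 residueCard_pos.le)
        exact Finset.inf'_le _ (mem_pairsOf_refineBy.2 ⟨hp, hd⟩)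
      · rw [pairDist_digitEquiv_of_ne hd hy]
        obtain ⟨p', hp'⟩ := hQ'
        exact mul_le_one₀ hq1 h0
          ((Finset.inf'_le _ hp').trans (pairDist_le_one hy p'))

theorem prodFactor_digitEquiv (P : Part N) (d : Fin N → 𝓀[K]) [DecidableEq 𝓀[K]]
    {y : Fin N → K} (hy : y ∈ intBox K N) :
    ∏ p ∈ pairsOf P, (pairDist (digitEquiv d y) p : ℂ) ^ s p =
      (residueCard K : ℂ) ^ (-∑ p ∈ pairsOf (refineBy P d), s p) *
        ∏ p ∈ pairsOf (refineBy P d), (pairDist y p : ℂ) ^ s p := by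
  have h0 : (residueCard K : ℂ) ≠ 0 := by exact_mod_cast (residueCard_pos (K := K)).ne'
  rw [← Finset.sum_neg_distrib, cpow_finset_sum h0, ← Finset.prod_mul_distrib]
  have h1 : pairsOf (refineBy P d) = (pairsOf P).filter fun p => d p.1.1 = d p.1.2 := by
    ext p; rw [mem_pairsOf_refineBy, Finset.mem_filter]
  rw [h1, Finset.prod_filter]
  refine Finset.prod_congr rfl fun p _ => ?_
  split_ifs with h
  · rw [pairDist_digitEquiv_of_eq h, residueCard_cpow_scale (pairDist_nonneg y p)]
  · rw [pairDist_digitEquiv_of_ne h hy]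
    simp

theorem potential_digitEquiv (hN : 2 ≤ N) (P : Part N) (d : Fin N → 𝓀[K]) [DecidableEq 𝓀[K]]
    {y : Fin N → K} (hy : y ∈ intBox K N) :
    potential a b s P (digitEquiv d y) =
      (residueCard K : ℂ) ^ (-weight a b s (refineBy P d)) *
        potential a b s (refineBy P d) y := by
  have h0 : (residueCard K : ℂ) ≠ 0 := by exact_mod_cast (residueCard_pos (K := K)).ne'
  rw [potential, maxFactor_digitEquiv a hN P d hy, minFactor_digitEquiv b P d hy,
    prodFactor_digitEquiv s P d hy, potential, weight, neg_add, neg_add,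
    Complex.cpow_add _ _ h0, Complex.cpow_add _ _ h0]
  ring

end Potential

end LogCoulomb

namespace LogCoulomb

open MeasureTheory ValuativeRel Topology

set_option linter.unusedSectionVars false

/-! ### Absolute integrability and the recursion for the integrals -/

section Integrability

variable {K : Type*} [Field K] [ValuativeRel K] [TopologicalSpace K]
  [IsNonarchimedeanLocalField K] [MeasurableSpace K] [BorelSpace K] {N : ℕ}

/-- The points whose coordinates in a common part of `P` are at distance more than `q^(-k)`. -/
def separated (K : Type*) [Field K] [ValuativeRel K] [TopologicalSpace K]
    [IsNonarchimedeanLocalField K] [MeasurableSpace K] [BorelSpace K] (P : Part N) (k : ℕ) :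
    Set (Fin N → K) := {x | ∀ p ∈ pairsOf P, (residueCard K : ℝ)⁻¹ ^ k < pairDist x p}

theorem measurableSet_separated (P : Part N) (k : ℕ) : MeasurableSet (separated K P k) := by
  have : separated K P k =
      ⋂ p ∈ pairsOf P, {x | (residueCard K : ℝ)⁻¹ ^ k < pairDist x p} := by
    ext x; simp [separated]
  rw [this]
  exact Finset.measurableSet_biInter _ fun p _ =>
    measurableSet_lt measurable_const (measurable_pairDist p)

theorem inv_residueCard_pos : (0 : ℝ) < (residueCard K : ℝ)⁻¹ := inv_pos.2 residueCard_pos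

theorem inv_residueCard_lt_one : (residueCard K : ℝ)⁻¹ < 1 :=
  inv_lt_one_of_one_lt₀ one_lt_residueCard_real

theorem separated_mono (P : Part N) : Monotone (separated K P) := fun _ _ hkl _ hx p hp =>
  (pow_le_pow_of_le_one inv_residueCard_pos.le inv_residueCard_lt_one.le hkl).trans_lt (hx p hp)

theorem ae_mem_iUnion_separated (P : Part N) :
    ∀ᵐ x ∂(boxMeasure K N), ∃ k, x ∈ separated K P k := by
  have h : ∀ p : Pair N, ∀ᵐ x ∂(boxMeasure K N), pairDist x p ≠ 0 :=
    fun p => ae_canonicalAbs_sub_ne_zero p.2.ne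
  filter_upwards [ae_all_iff.2 h] with x hx
  have h1 : ∀ p : Pair N, ∀ᶠ k : ℕ in Filter.atTop, (residueCard K : ℝ)⁻¹ ^ k < pairDist x p := by
    intro p
    exact (tendsto_pow_atTop_nhds_zero_of_lt_one inv_residueCard_pos.le
      inv_residueCard_lt_one).eventually_lt_const
        (lt_of_le_of_ne (pairDist_nonneg x p) (hx p).symm)
  obtain ⟨k, hk⟩ := (Filter.eventually_all.2 h1).exists
  exact ⟨k, fun p _ => hk p⟩

variable (a b : ℂ) (s : Pair N → ℂ)

/-- The truncated absolute integral of a potential. -/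
noncomputable def truncInt (K : Type*) [Field K] [ValuativeRel K] [TopologicalSpace K]
    [IsNonarchimedeanLocalField K] [MeasurableSpace K] [BorelSpace K] (a b : ℂ) (s : Pair N → ℂ)
    (P : Part N) (k : ℕ) : ENNReal :=
  ∫⁻ x : Fin N → K, (separated K P k).indicator (fun x => ‖potential a b s P x‖ₑ) x ∂(boxMeasure K N)

/-- Monotone convergence, since almost every point has nonzero pairwise distances. The truncation is
needed because an inequality $T\le cT+D$ says nothing when $T=\infty$. -/
theorem lintegral_potential_eq_iSup (P : Part N) :
    ∫⁻ x : Fin N → K, ‖potential a b s P x‖ₑ ∂(boxMeasure K N) = ⨆ k, truncInt K a b s P k := by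
  unfold truncInt
  rw [← lintegral_iSup]
  · refine lintegral_congr_ae ?_
    filter_upwards [ae_mem_iUnion_separated P] with x hx
    obtain ⟨k, hk⟩ := hx
    refine le_antisymm (le_iSup_of_le k ?_) (iSup_le fun k => Set.indicator_le_self _ _ _)
    rw [Set.indicator_of_mem hk]
  · exact fun k => (measurable_potential a b s P).enorm.indicator (measurableSet_separated P k)
  · exact fun k l hkl x => Set.indicator_le_indicator_of_subset (separated_mono P hkl)
      (fun _ => zero_le) x

theorem truncInt_le (P : Part N) (k : ℕ) :
    truncInt K a b s P k ≤ ∫⁻ x : Fin N → K, ‖potential a b s P x‖ₑ ∂(boxMeasure K N) := by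
  rw [lintegral_potential_eq_iSup]
  exact le_iSup _ k

/-- At $k=0$ the distances would have to exceed 1, which is impossible on $R^N$; this starts the
induction from a finite value. -/
theorem truncInt_zero {P : Part N} (hP : P ≠ ⊥) : truncInt K a b s P 0 = 0 := by
  refine lintegral_eq_zero_of_ae_eq_zero ?_
  filter_upwards [ae_mem_intBox] with x hx
  obtain ⟨p, hp⟩ := pairsOf_nonempty_iff.2 hP
  refine Set.indicator_of_notMem (fun h => ?_) _
  have := h p hp
  rw [pow_zero] at this
  exact absurd (pairDist_le_one hx p) (not_le.2 this)

theorem digitEquiv_mem_separated [DecidableEq 𝓀[K]] {P : Part N} {d : Fin N → 𝓀[K]}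
    {y : Fin N → K} {k : ℕ} (h : digitEquiv d y ∈ separated K P (k + 1)) :
    y ∈ separated K (refineBy P d) k := by
  intro p hp
  rw [mem_pairsOf_refineBy] at hp
  have h1 := h p hp.1
  rw [pairDist_digitEquiv_of_eq hp.2, pow_succ'] at h1
  exact lt_of_mul_lt_mul_left h1 inv_residueCard_pos.le

/-- Removing one digit multiplies the distances that remain by $q$, so it lowers the truncation
index by one. -/
theorem truncInt_succ_le (hN : 2 ≤ N) [DecidableEq 𝓀[K]] (P : Part N) (k : ℕ) :
    truncInt K a b s P (k + 1) ≤ (residueCard K : ENNReal)⁻¹ ^ N * ∑ d : Fin N → 𝓀[K],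
      ‖(residueCard K : ℂ) ^ (-weight a b s (refineBy P d))‖ₑ * truncInt K a b s (refineBy P d) k := by
  rw [truncInt, lintegral_boxMeasure]
  refine mul_le_mul_right (Finset.sum_le_sum fun d _ => ?_) _
  rw [truncInt, ← lintegral_const_mul' _ _ enorm_ne_top]
  refine lintegral_mono_ae ?_
  filter_upwards [ae_mem_intBox] with y hy
  by_cases h : digitEquiv d y ∈ separated K P (k + 1)
  · rw [Set.indicator_of_mem h, Set.indicator_of_mem (digitEquiv_mem_separated h),
      potential_digitEquiv a b s hN P d hy, enorm_mul]
  · rw [Set.indicator_of_notMem h]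
    exact zero_le

theorem enorm_residueCard_cpow (w : ℂ) :
    ‖(residueCard K : ℂ) ^ w‖ₑ = ENNReal.ofReal ((residueCard K : ℝ) ^ w.re) := by
  rw [← ofReal_norm, Complex.norm_natCast_cpow_of_pos
    (zero_lt_one.trans one_lt_residueCard)]

/-- The left side is $q^{-(N-\#P+\operatorname{Re}w)}$: there are $q^{\#P}$ digit vectors that leave
$P$ unrefined, each of measure $q^{-N}$. -/
theorem selfCoeff_lt_one {P : Part N} {w : ℂ}
    (hre : 0 < (N : ℝ) - P.parts.card + w.re) :
    (residueCard K : ENNReal)⁻¹ ^ N * ((residueCard K : ENNReal) ^ P.parts.card *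
      ‖(residueCard K : ℂ) ^ (-w)‖ₑ) < 1 := by
  have hq := residueCard_pos (K := K)
  have h1 : (residueCard K : ENNReal)⁻¹ ^ N * ((residueCard K : ENNReal) ^ P.parts.card *
      ‖(residueCard K : ℂ) ^ (-w)‖ₑ) =
      ENNReal.ofReal ((residueCard K : ℝ) ^ (-((N : ℝ) - P.parts.card + w.re))) := by
    rw [enorm_residueCard_cpow, ← ENNReal.ofReal_natCast, ← ENNReal.ofReal_inv_of_pos hq,
      ← ENNReal.ofReal_pow (by positivity), ← ENNReal.ofReal_pow hq.le,
      ← ENNReal.ofReal_mul (by positivity), ← ENNReal.ofReal_mul (by positivity)]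
    congr 1
    rw [← Real.rpow_natCast, ← Real.rpow_natCast, Real.inv_rpow hq.le, ← Real.rpow_neg hq.le,
      ← Real.rpow_add hq, ← Real.rpow_add hq, Complex.neg_re]
    congr 1
    ring
  rw [h1, ENNReal.ofReal_lt_one]
  exact Real.rpow_lt_one_of_one_lt_of_neg one_lt_residueCard_real (by linarith)

/-- The fixed point $D/(1-c)$ of $t\mapsto ct+D$ bounds every iterate that starts at 0. -/
theorem ennreal_bounded_of_le {T : ℕ → ENNReal} {c D : ENNReal} (hc : c < 1) (hD : D ≠ ⊤)
    (h0 : T 0 = 0) (hT : ∀ k, T (k + 1) ≤ c * T k + D) : ⨆ k, T k < ⊤ := by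
  set E : ℝ := D.toReal / (1 - c.toReal)
  have hc1 : c.toReal < 1 := by
    have := (ENNReal.toReal_lt_toReal (ne_top_of_lt hc) ENNReal.one_ne_top).2 hc
    simpa using this
  have hE : 0 ≤ E := div_nonneg ENNReal.toReal_nonneg (by linarith)
  have hEeq : c * ENNReal.ofReal E + D = ENNReal.ofReal E := by
    rw [← ENNReal.ofReal_toReal (ne_top_of_lt hc), ← ENNReal.ofReal_toReal hD,
      ← ENNReal.ofReal_mul ENNReal.toReal_nonneg,
      ← ENNReal.ofReal_add (mul_nonneg ENNReal.toReal_nonneg hE) ENNReal.toReal_nonneg]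
    congr 1
    have : 1 - c.toReal ≠ 0 := by linarith
    simp only [E]
    field_simp
    ring
  refine lt_of_le_of_lt (iSup_le fun k => ?_) (ENNReal.ofReal_lt_top (r := E))
  induction k with
  | zero => rw [h0]; exact zero_le
  | succ k ih =>
    refine (hT k).trans ?_
    rw [← hEeq]
    gcongr

theorem lintegral_potential_lt_top (hN : 2 ≤ N)
    (hre : ∀ P : Part N, P ≠ ⊥ → 0 < (N : ℝ) - P.parts.card + (weight a b s P).re) (P : Part N) :
    ∫⁻ x : Fin N → K, ‖potential a b s P x‖ₑ ∂(boxMeasure K N) < ⊤ := by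
  classical
  induction P using WellFoundedLT.induction with
  | _ P ih =>
    by_cases hP : P = ⊥
    · subst hP
      simp [potential_bot a b s hN]
    rw [lintegral_potential_eq_iSup]
    -- The constant $D$ collects the digit vectors that refine $P$ strictly; it is finite by
    -- induction.
    refine ennreal_bounded_of_le (selfCoeff_lt_one (K := K) (hre P hP))
      (D := (residueCard K : ENNReal)⁻¹ ^ N * ∑ d : Fin N → 𝓀[K] with refineBy P d ≠ P,
        ‖(residueCard K : ℂ) ^ (-weight a b s (refineBy P d))‖ₑ *
          ∫⁻ x : Fin N → K, ‖potential a b s (refineBy P d) x‖ₑ ∂(boxMeasure K N)) ?_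
      (truncInt_zero a b s hP) fun k => ?_
    · refine ENNReal.mul_ne_top (ENNReal.pow_ne_top (ENNReal.inv_ne_top.2 ?_))
        (ENNReal.sum_ne_top.2 fun d hd => ENNReal.mul_ne_top enorm_ne_top (ih _ ?_).ne)
      · exact_mod_cast (zero_lt_one.trans (one_lt_residueCard (K := K))).ne'
      · exact lt_of_le_of_ne (refineBy_le P d) (Finset.mem_filter.1 hd).2
    · refine (truncInt_succ_le a b s hN P k).trans ?_
      rw [← Finset.sum_filter_add_sum_filter_not Finset.univ (fun d => refineBy P d = P), mul_add]
      refine add_le_add (le_of_eq ?_) ?_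
      · rw [Finset.sum_congr rfl fun d hd => by rw [(Finset.mem_filter.1 hd).2], Finset.sum_const,
          card_refineBy_eq le_rfl Fintype.card_pos, stepMult_self, card_residueField]
        simp only [nsmul_eq_mul, mul_one, Nat.cast_pow, mul_assoc]
      · gcongr with d hd
        exact truncInt_le a b s _ k

variable {a b s}

theorem integrable_potential (hN : 2 ≤ N)
    (hre : ∀ P : Part N, P ≠ ⊥ → 0 < (N : ℝ) - P.parts.card + (weight a b s P).re) (P : Part N) :
    Integrable (potential a b s P : (Fin N → K) → ℂ) (boxMeasure K N) :=
  ⟨(measurable_potential a b s P).aestronglyMeasurable,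
    lintegral_potential_lt_top a b s hN hre P⟩

variable (a b s) in
/-- The normalized integral of a potential. -/
noncomputable def potInt (K : Type*) [Field K] [ValuativeRel K] [TopologicalSpace K]
    [IsNonarchimedeanLocalField K] [MeasurableSpace K] [BorelSpace K] (P : Part N) : ℂ :=
  (residueCard K : ℂ) ^ (-weight a b s P) * ∫ x : Fin N → K, potential a b s P x ∂(boxMeasure K N)

theorem potInt_bot (hN : 2 ≤ N) : potInt a b s K ⊥ = 1 := by
  simp [potInt, weight_bot a b s hN, potential_bot a b s hN]

theorem potInt_recursion (hN : 2 ≤ N) [DecidableEq 𝓀[K]]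
    (hre : ∀ P : Part N, P ≠ ⊥ → 0 < (N : ℝ) - P.parts.card + (weight a b s P).re) (P : Part N) :
    (residueCard K : ℂ) ^ P.parts.card *
      (residueCard K : ℂ) ^ ((N : ℂ) - P.parts.card + weight a b s P) * potInt a b s K P =
        ∑ d : Fin N → 𝓀[K], potInt a b s K (refineBy P d) := by
  have h0 : (residueCard K : ℂ) ≠ 0 := by exact_mod_cast (residueCard_pos (K := K)).ne'
  have h1 : (residueCard K : ℂ) ^ P.parts.card *
      (residueCard K : ℂ) ^ ((N : ℂ) - P.parts.card + weight a b s P) =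
      (residueCard K : ℂ) ^ N * (residueCard K : ℂ) ^ (weight a b s P) := by
    rw [← Complex.cpow_natCast, ← Complex.cpow_natCast, ← Complex.cpow_add _ _ h0,
      ← Complex.cpow_add _ _ h0]
    congr 1
    ring
  have h2 : (residueCard K : ℂ) ^ (weight a b s P) * (residueCard K : ℂ) ^ (-weight a b s P) = 1 := by
    rw [← Complex.cpow_add _ _ h0, add_neg_cancel, Complex.cpow_zero]
  rw [h1, potInt, integral_boxMeasure (integrable_potential hN hre P)]
  have h3 : ∀ d : Fin N → 𝓀[K], ∫ y, potential a b s P (digitEquiv d y) ∂(boxMeasure K N) =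
      potInt a b s K (refineBy P d) := by
    intro d
    rw [potInt, ← integral_const_mul]
    refine integral_congr_ae ?_
    filter_upwards [ae_mem_intBox] with y hy
    exact potential_digitEquiv a b s hN P d hy
  simp_rw [h3]
  have h4 : (residueCard K : ℂ) ^ N * ((residueCard K : ℂ)⁻¹) ^ N = 1 := by
    rw [← mul_pow, mul_inv_cancel₀ h0, one_pow]
  linear_combination ((residueCard K : ℂ) ^ N * ((residueCard K : ℂ)⁻¹) ^ N *
    ∑ d : Fin N → 𝓀[K], potInt a b s K (refineBy P d)) * h2 +
    (∑ d : Fin N → 𝓀[K], potInt a b s K (refineBy P d)) * h4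

end Integrability

end LogCoulomb

namespace LogCoulomb

open MeasureTheory ValuativeRel Topology

set_option linter.unusedSectionVars false

/-! ### Convergence of the series in the root function -/

section Growth

open Filter

theorem eventually_norm_le_rpow {u : ℕ → ℂ} {C : ℝ}
    (h : limsup (fun n : ℕ => ENNReal.log ‖u n‖ₑ / ((Real.log n : ℝ) : EReal)) atTop < (C : EReal)) :
    ∀ᶠ n : ℕ in atTop, ‖u n‖ ≤ (n : ℝ) ^ C := by
  filter_upwards [eventually_lt_of_limsup_lt h, eventually_gt_atTop 1] with n hn hn1
  have hlog : 0 < Real.log n := Real.log_pos (by exact_mod_cast hn1)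
  rw [EReal.div_lt_iff (by exact_mod_cast hlog) (EReal.coe_ne_top _), ← EReal.coe_mul] at hn
  have hpos : (0 : ℝ) < (n : ℝ) ^ C := Real.rpow_pos_of_pos (by exact_mod_cast (by omega)) C
  have h2 : ENNReal.log (ENNReal.ofReal ((n : ℝ) ^ C)) = ((C * Real.log n : ℝ) : EReal) := by
    rw [ENNReal.log_ofReal_of_pos hpos, Real.log_rpow (by exact_mod_cast (by omega))]
  rw [← h2, ENNReal.log_lt_log_iff, ← ofReal_norm] at hn
  exact ((ENNReal.ofReal_lt_ofReal_iff hpos).1 hn).le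

theorem summable_rootTerm {q : ℕ} (hq : 2 ≤ q) {ρ : normValues → ℂ} (hρ : GrowthDecay ρ) {z : ℂ}
    (hz : 1 < z.re) : Summable (rootTerm q ρ z) := by
  have hq0 : (0 : ℝ) < q := by exact_mod_cast (by omega)
  have hq1 : (1 : ℝ) < q := by exact_mod_cast (by omega)
  have htend : Tendsto (fun k : ℕ => q ^ k) atTop atTop :=
    tendsto_pow_atTop_atTop_of_one_lt (by omega)
  have hgeom : ∀ e : ℝ, e < 0 → Summable fun k : ℕ => ((q : ℝ) ^ e) ^ k := fun e he =>
    summable_geometric_of_lt_one (Real.rpow_nonneg hq0.le _)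
      (Real.rpow_lt_one_of_one_lt_of_neg hq1 he)
  have hnorm : ∀ w : ℂ, ‖(q : ℂ) ^ w‖ = (q : ℝ) ^ w.re := fun w =>
    Complex.norm_natCast_cpow_of_pos (by omega) w
  have hpow : ∀ (k : ℕ) (e : ℝ), ((q ^ k : ℕ) : ℝ) ^ e = ((q : ℝ) ^ e) ^ k := by
    intro k e
    rw [Nat.cast_pow, ← Real.rpow_natCast, ← Real.rpow_mul hq0.le, mul_comm, Real.rpow_mul hq0.le,
      Real.rpow_natCast]
  refine Summable.of_nat_of_neg ?_ ?_
  -- Any exponent below $-\operatorname{Re}z$ would do; this one bounds the terms by $q^{-k}$.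
  · have h1 := eventually_norm_le_rpow (u := fun n => evalAt ρ n) (C := -(z.re + 1))
      (by rw [hρ.2]; exact EReal.bot_lt_coe _)
    refine Summable.of_norm_bounded_eventually_nat (hgeom (-1) (by norm_num)) ?_
    filter_upwards [htend.eventually h1] with k hk
    rw [hpow] at hk
    rw [rootTerm, norm_mul, hnorm]
    have h2 : ((k : ℤ) : ℂ) * z = ((k : ℝ) : ℂ) * z := by push_cast; rfl
    rw [h2, Complex.re_ofReal_mul, mul_comm (k : ℝ), Real.rpow_mul hq0.le, Real.rpow_natCast,
      zpow_natCast, ← Nat.cast_pow]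
    refine (mul_le_mul_of_nonneg_right hk (by positivity)).trans (le_of_eq ?_)
    rw [← mul_pow, ← Real.rpow_add hq0]
    congr 2
    ring
  -- The midpoint of 1 and $\operatorname{Re}z$ exceeds the growth exponent and still leaves the
  -- ratio $q^{(1-\operatorname{Re}z)/2}<1$.
  · have h1 := eventually_norm_le_rpow (u := fun n => evalAt ρ (1 / (n : ℝ))) (C := (1 + z.re) / 2)
      (hρ.1.trans_lt (by exact_mod_cast (by linarith)))
    refine Summable.of_norm_bounded_eventually_nat (hgeom ((1 - z.re) / 2) (by linarith)) ?_
    filter_upwards [htend.eventually h1] with k hk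
    rw [hpow] at hk
    rw [rootTerm, norm_mul, hnorm]
    have h2 : ((-(k : ℤ) : ℤ) : ℂ) * z = ((k : ℝ) : ℂ) * (-z) := by push_cast; ring
    have h3 : (q : ℝ) ^ (-(k : ℤ)) = 1 / ((q ^ k : ℕ) : ℝ) := by
      rw [zpow_neg, zpow_natCast, Nat.cast_pow, one_div]
    rw [h2, Complex.re_ofReal_mul, mul_comm (k : ℝ), Real.rpow_mul hq0.le, Real.rpow_natCast, h3]
    refine (mul_le_mul_of_nonneg_right hk (by positivity)).trans (le_of_eq ?_)
    rw [← mul_pow, ← Real.rpow_add hq0, Complex.neg_re]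
    congr 2
    ring

end Growth

/-! ### From $K^N$ to the unit polydisc -/

section Global

variable {K : Type*} [Field K] [ValuativeRel K] [TopologicalSpace K]
  [IsNonarchimedeanLocalField K] [MeasurableSpace K] [BorelSpace K] {N : ℕ}

theorem residueCard_zpow_mul_cpow (m : ℤ) {t : ℝ} (ht : 0 ≤ t) (a : ℂ) :
    (((residueCard K : ℝ) ^ m * t : ℝ) : ℂ) ^ a =
      (residueCard K : ℂ) ^ ((m : ℂ) * a) * (t : ℂ) ^ a := by
  have h0 : (residueCard K : ℂ) ≠ 0 := by exact_mod_cast (residueCard_pos (K := K)).ne'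
  have hp : (0 : ℝ) < (residueCard K : ℝ) ^ m := zpow_pos residueCard_pos m
  rw [Complex.ofReal_mul, Complex.mul_cpow_ofReal_nonneg hp.le ht]
  congr 1
  rw [Complex.cpow_def_of_ne_zero (by exact_mod_cast hp.ne'), Complex.cpow_def_of_ne_zero h0,
    ← Complex.ofReal_log hp.le, Real.log_zpow, Complex.ofReal_mul, Complex.ofReal_intCast,
    Complex.ofReal_log residueCard_pos.le, Complex.ofReal_natCast]
  congr 1
  ring

theorem pairDist_dilation (m : ℤ) (y : Fin N → K) (p : Pair N) :
    pairDist (affineEquiv 0 (unif K ^ (-m)) y) p = (residueCard K : ℝ) ^ m * pairDist y p := by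
  rw [pairDist, affineEquiv_apply, affineEquiv_apply, Pi.zero_apply, Pi.zero_apply, zero_add,
    zero_add, ← mul_sub, canonicalAbs_mul, Units.val_zpow_eq_zpow_val, unif, Units.val_mk0,
    canonicalAbs_uniformizer_zpow, neg_neg]
  rfl

variable (a b : ℂ) (s : Pair N → ℂ)

theorem potential_top (hN : 2 ≤ N) (x : Fin N → K) : potential a b s ⊤ x =
    (maxDist x : ℂ) ^ a * (minDist x : ℂ) ^ b * ∏ p, (pairDist x p : ℂ) ^ s p := by
  have : NeZero N := ⟨by omega⟩
  have := nonempty_pair hN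
  rw [potential, if_pos rfl, dif_pos (pairsOf_nonempty_iff.2 (bot_ne_top hN).symm)]
  simp only [pairsOf_top, minDist_eq, Finset.inf'_univ_eq_ciInf]

theorem integrand_eq (hN : 2 ≤ N) (ρ : normValues → ℂ) (x : Fin N → K) :
    integrand ρ a b s x = evalAt ρ (supNorm x) * potential a b s ⊤ x := by
  rw [potential_top a b s hN, integrand]
  simp only [pairDist]
  ring

theorem potential_top_dilation (hN : 2 ≤ N) (m : ℤ) (y : Fin N → K) :
    potential a b s ⊤ (affineEquiv 0 (unif K ^ (-m)) y) =
      (residueCard K : ℂ) ^ ((m : ℂ) * (a + b + ∑ p, s p)) * potential a b s ⊤ y := by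
  have hp : (0 : ℝ) ≤ (residueCard K : ℝ) ^ m := zpow_nonneg residueCard_pos.le m
  have h0 : (residueCard K : ℂ) ≠ 0 := by exact_mod_cast (residueCard_pos (K := K)).ne'
  have hmax : maxDist (affineEquiv 0 (unif K ^ (-m)) y) = (residueCard K : ℝ) ^ m * maxDist y := by
    rw [maxDist_eq, maxDist_eq, Real.mul_iSup_of_nonneg hp]
    exact congrArg _ (funext fun p => pairDist_dilation m y p)
  have hmin : minDist (affineEquiv 0 (unif K ^ (-m)) y) = (residueCard K : ℝ) ^ m * minDist y := by
    rw [minDist_eq, minDist_eq, Real.mul_iInf_of_nonneg hp]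
    exact congrArg _ (funext fun p => pairDist_dilation m y p)
  rw [potential_top a b s hN, potential_top a b s hN, hmax, hmin,
    residueCard_zpow_mul_cpow m (maxDist_nonneg y), residueCard_zpow_mul_cpow m (minDist_nonneg y)]
  simp only [pairDist_dilation, residueCard_zpow_mul_cpow m (pairDist_nonneg y _)]
  rw [Finset.prod_mul_distrib, ← cpow_finset_sum h0, mul_add, mul_add, Finset.mul_sum,
    Complex.cpow_add _ _ h0, Complex.cpow_add _ _ h0]
  ring

theorem weight_top (hN : 2 ≤ N) : weight a b s ⊤ = a + b + ∑ p, s p := by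
  have : NeZero N := ⟨by omega⟩
  rw [weight, if_pos rfl, if_neg (bot_ne_top hN).symm, pairsOf_top]

theorem card_parts_top (hN : 2 ≤ N) : (⊤ : Part N).parts.card = 1 := by
  have : NeZero N := ⟨by omega⟩
  rw [parts_top, Finset.card_singleton]

variable {a b s}

theorem integrable_and_Z_eq (hN : 2 ≤ N) {ρ : normValues → ℂ} (hρ : GrowthDecay ρ)
    (hre : ∀ P : Part N, P ≠ ⊥ → 0 < (N : ℝ) - P.parts.card + (weight a b s P).re) {z : ℂ}
    (hz : z = N + (a + b + ∑ p, s p)) :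
    Integrable (integrand (K := K) ρ a b s) (haarPi K N) ∧
      Summable (rootTerm (residueCard K) ρ z) ∧
      Z K ρ a b s = rootFun (residueCard K) ρ z * ((1 - (residueCard K : ℂ) ^ (-(z - 1))) *
        (residueCard K : ℂ) ^ (a + b + ∑ p, s p) * potInt a b s K ⊤) ∧
      1 < z.re := by
  have : NeZero N := ⟨by omega⟩
  have h0 : (residueCard K : ℂ) ≠ 0 := by exact_mod_cast (residueCard_pos (K := K)).ne'
  have hz1 : 1 < z.re := by
    have := hre ⊤ (bot_ne_top hN).symm
    rw [card_parts_top hN, weight_top a b s hN] at this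
    rw [hz, Complex.add_re, Complex.natCast_re]
    push_cast at this
    linarith
  have hs : Summable (rootTerm (residueCard K) ρ z) :=
    summable_rootTerm one_lt_residueCard hρ hz1
  have hs' : Summable fun m : ℤ => evalAt ρ ((residueCard K : ℝ) ^ m) *
      (residueCard K : ℂ) ^ ((m : ℂ) * (N + (a + b + ∑ p, s p))) := by
    rw [← hz]; exact hs
  have hF := integrable_potential (K := K) hN hre ⊤
  have heq : integrand (K := K) ρ a b s =
      fun x => evalAt ρ (supNorm x) * potential a b s ⊤ x :=
    funext fun x => integrand_eq a b s hN ρ x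
  refine ⟨?_, hs, ?_, hz1⟩
  · rw [heq]
    exact integrable_supNorm_mul (potential_top_dilation a b s hN) hF hs'
  -- The root function divides by this factor, which must be restored next to the integral over
  -- $R^N$.
  · have h1 : (1 - (residueCard K : ℂ) ^ (-(z - 1))) ≠ 0 := by
      intro h
      have h2 : (residueCard K : ℂ) ^ (-(z - 1)) = 1 := (sub_eq_zero.1 h).symm
      have h3 := congrArg norm h2
      rw [Complex.norm_natCast_cpow_of_pos (zero_lt_one.trans one_lt_residueCard), norm_one] at h3
      refine absurd h3 (ne_of_lt (Real.rpow_lt_one_of_one_lt_of_neg one_lt_residueCard_real ?_))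
      simp only [Complex.neg_re, Complex.sub_re, Complex.one_re]
      linarith
    have h2 : ∫ x : Fin N → K, potential a b s ⊤ x ∂(boxMeasure K N) =
        (residueCard K : ℂ) ^ (a + b + ∑ p, s p) * potInt a b s K ⊤ := by
      rw [potInt, weight_top a b s hN, ← mul_assoc, ← Complex.cpow_add _ _ h0, add_neg_cancel,
        Complex.cpow_zero, one_mul]
    rw [Z, heq, integral_supNorm_mul (potential_top_dilation a b s hN) hF hs', h2, rootFun, ← hz]
    simp only [rootTerm]
    field_simp

end Global

end LogCoulomb

namespace LogCoulomb

open MeasureTheory ValuativeRel Topology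

set_option linter.unusedSectionVars false

/-! ### Exponents of levels and branches, and their positivity beyond the abscissae -/

section Exponents

open Finset

variable {N : ℕ}

theorem pairsIn_eq_empty {lam : Finset (Fin N)} (h : lam.card ≤ 1) : pairsIn lam = ∅ := by
  refine filter_eq_empty_iff.2 fun p _ hp => ?_
  exact p.2.ne (card_le_one.1 h _ hp.1 _ hp.2)

theorem sum_sum_pairsIn {M : Type*} [AddCommMonoid M] (P : Part N) (f : Pair N → M) :
    ∑ lam ∈ P.parts with 1 < lam.card, ∑ p ∈ pairsIn lam, f p = ∑ p ∈ pairsOf P, f p := by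
  rw [Finset.sum_filter_of_ne fun lam _ hne => by
    by_contra h
    exact hne (by rw [pairsIn_eq_empty (not_lt.1 h), sum_empty]),
    ← Finset.sum_fiberwise_of_maps_to (s := pairsOf P) (t := P.parts) (g := fun p => P.part p.1.1)
      fun p _ => part_mem_parts P _]
  refine Finset.sum_congr rfl fun lam hlam => Finset.sum_congr ?_ fun _ _ => rfl
  ext p
  simp only [pairsIn, mem_filter, mem_univ, true_and, mem_pairsOf, Same]
  rw [← P.part_eq_iff_mem hlam, ← P.part_eq_iff_mem hlam]
  constructor
  · rintro ⟨h1, h2⟩; exact ⟨h1.trans h2.symm, h1⟩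
  · rintro ⟨h1, h2⟩; exact ⟨h2, h1 ▸ h2⟩

theorem sum_card_sub_one (P : Part N) :
    ∑ lam ∈ P.parts with 1 < lam.card, ((lam.card : ℂ) - 1) = N - P.parts.card := by
  rw [Finset.sum_filter_of_ne]
  · have h := P.sum_card_parts
    rw [Finset.sum_sub_distrib, ← Nat.cast_sum, h]
    simp
  · intro lam hlam hne
    by_contra h
    have h1 := card_pos.2 (P.nonempty_of_mem_parts hlam)
    have h2 : lam.card = 1 := by omega
    exact hne (by rw [h2]; simp)

theorem sum_branchExponent (P : Part N) (s : Pair N → ℂ) :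
    ∑ lam ∈ P.parts with 1 < lam.card, branchExponent lam s =
      N - P.parts.card + ∑ p ∈ pairsOf P, s p := by
  simp only [branchExponent]
  rw [Finset.sum_add_distrib, sum_card_sub_one, sum_sum_pairsIn]

theorem SplittingFiltration.branchesAt_eq (π : SplittingFiltration N) (l : Fin π.length) :
    π.branchesAt l = (π.level l.castSucc).parts.filter fun lam => 1 < lam.card := by
  ext lam
  rw [π.mem_branchesAt, mem_filter]

theorem levelExponent_eq (π : SplittingFiltration N) (l : Fin π.length) (s : Pair N → ℂ) :
    levelExponent π l s =
      N - (π.level l.castSucc).parts.card + ∑ p ∈ pairsOf (π.level l.castSucc), s p := by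
  rw [levelExponent, π.branchesAt_eq, sum_branchExponent]

theorem SplittingFiltration.level_castSucc_eq_top_iff [NeZero N] (π : SplittingFiltration N)
    (l : Fin π.length) : π.level l.castSucc = ⊤ ↔ l.val = 0 := by
  rw [← π.level_zero_eq, π.level_strictAnti.injective.eq_iff, Fin.ext_iff]
  simp

theorem prod_levels_eq (hN : 2 ≤ N) (π : SplittingFiltration N) (x : Fin π.length → ℂ) :
    ∏ l, x l = x ⟨0, π.length_pos hN⟩ * ∏ l : Fin π.length with 1 ≤ l.val, x l := by
  have h : (univ.filter fun l : Fin π.length => 1 ≤ l.val) =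
      univ.erase ⟨0, π.length_pos hN⟩ := by
    ext l
    simp only [mem_filter, mem_univ, true_and, mem_erase, and_true, ne_eq, Fin.ext_iff]
    omega
  rw [h, Finset.mul_prod_erase _ _ (mem_univ _)]

/-- Below the root the exponent $a$ is absent, and ranks and pair sums are additive over branches,
so the exponent of the recursion is the one in the level function. -/
theorem weight_level (hN : 2 ≤ N) (a b : ℂ) (s : Pair N → ℂ) (π : SplittingFiltration N)
    {l : Fin π.length} (hl : 1 ≤ l.val) :
    (N : ℂ) - (π.level l.castSucc).parts.card + weight a b s (π.level l.castSucc) =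
      b + levelExponent π l s := by
  have : NeZero N := ⟨by omega⟩
  have h1 : π.level l.castSucc ≠ ⊤ := by
    rw [Ne, π.level_castSucc_eq_top_iff]; omega
  rw [weight, if_neg h1, if_neg (π.level_castSucc_ne_bot l), levelExponent_eq]
  ring

theorem univ_mem_branches (hN : 2 ≤ N) (π : SplittingFiltration N) : univ ∈ π.branches := by
  have : NeZero N := ⟨by omega⟩
  refine π.mem_branches.2 ⟨⟨⟨0, π.length_pos hN⟩, ?_⟩, by rw [card_univ, Fintype.card_fin]; omega⟩
  rw [(π.level_castSucc_eq_top_iff _).2 rfl, parts_top]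
  simp

theorem branchExponent_univ (s : Pair N → ℂ) :
    branchExponent univ s = (N : ℂ) - 1 + ∑ p, s p := by
  rw [branchExponent, card_univ, Fintype.card_fin]
  congr 2
  simp [pairsIn]

theorem natCast_cpow_ne_one {q : ℕ} (hq : 2 ≤ q) {w : ℂ} (hw : 0 < w.re) : (q : ℂ) ^ w ≠ 1 := by
  intro h
  have h3 := congrArg norm h
  rw [Complex.norm_natCast_cpow_of_pos (by omega), norm_one] at h3
  exact absurd h3 (Real.one_lt_rpow (by exact_mod_cast (by omega)) hw).ne'

variable {c : Fin N → ℝ} {β : ℂ}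

theorem scaled_re (p : Pair N) : (scaled c β p).re = chargeProd c p * β.re := by
  rw [scaled, Complex.re_ofReal_mul]

theorem sum_scaled_re (t : Finset (Pair N)) :
    (∑ p ∈ t, scaled c β p).re = (∑ p ∈ t, chargeProd c p) * β.re := by
  rw [Complex.re_sum, Finset.sum_mul]
  exact Finset.sum_congr rfl fun p _ => scaled_re p

theorem chargeProd_pos (hc : ∀ i, 0 < c i) (p : Pair N) : 0 < chargeProd c p :=
  mul_pos (hc _) (hc _)

theorem lt_mul_of_neg_div_lt {u e t : ℝ} (he : 0 < e) (h : -(u / e) < t) : 0 < u + e * t := by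
  rw [← neg_div, div_lt_iff₀ he] at h
  linarith

theorem rootAbscissa_pos (hN : 2 ≤ N) (hc : ∀ i, 0 < c i) {a b : ℂ}
    (h : rootAbscissa c a b < ((β.re : ℝ) : EReal)) :
    0 < (N : ℝ) - 1 + (a + b + ∑ p, scaled c β p).re := by
  have := nonempty_pair hN
  rw [rootAbscissa, EReal.coe_lt_coe_iff] at h
  have := lt_mul_of_neg_div_lt
    (Finset.sum_pos (fun p _ => chargeProd_pos hc p) univ_nonempty) h
  rw [Complex.add_re (a + b), sum_scaled_re]
  linarith

theorem levelAbscissa_pos (hc : ∀ i, 0 < c i) {b : ℂ} {π : SplittingFiltration N}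
    (h : levelAbscissa c π b < ((β.re : ℝ) : EReal)) {l : Fin π.length} (hl : 1 ≤ l.val) :
    0 < (N : ℝ) - (π.level l.castSucc).parts.card +
      (b + ∑ p ∈ pairsOf (π.level l.castSucc), scaled c β p).re := by
  have h1 : (⨅ (l : Fin π.length) (_ : 1 ≤ l.val),
      (((π.rank l + b.re) / ∑ lam ∈ π.branchesAt l, eps c lam : ℝ) : EReal)) ≤
      (((π.rank l + b.re) / ∑ lam ∈ π.branchesAt l, eps c lam : ℝ) : EReal) :=
    iInf₂_le l hl
  have h2 := (EReal.neg_le_neg_iff.2 h1).trans_lt h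
  rw [← EReal.coe_neg, EReal.coe_lt_coe_iff] at h2
  have h3 : ∑ lam ∈ π.branchesAt l, eps c lam =
      ∑ p ∈ pairsOf (π.level l.castSucc), chargeProd c p := by
    rw [π.branchesAt_eq, ← sum_sum_pairsIn]
    rfl
  rw [h3] at h2
  have := lt_mul_of_neg_div_lt (Finset.sum_pos (fun p _ => chargeProd_pos hc p)
    (pairsOf_nonempty_iff.2 (π.level_castSucc_ne_bot l))) h2
  rw [Complex.add_re, sum_scaled_re]
  rw [SplittingFiltration.rank] at this
  linarith

theorem branchAbscissa_pos (hc : ∀ i, 0 < c i) {π : SplittingFiltration N}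
    (h : branchAbscissa c π < ((β.re : ℝ) : EReal)) {lam : Finset (Fin N)}
    (hlam : lam ∈ π.properBranches) : 0 < (branchExponent lam (scaled c β)).re := by
  have h1 : (⨅ lam ∈ π.properBranches, ((((lam.card : ℝ) - 1) / eps c lam : ℝ) : EReal)) ≤
      ((((lam.card : ℝ) - 1) / eps c lam : ℝ) : EReal) := iInf₂_le lam hlam
  have h2 := (EReal.neg_le_neg_iff.2 h1).trans_lt h
  rw [← EReal.coe_neg, EReal.coe_lt_coe_iff] at h2
  have hcard : 1 < lam.card := (π.mem_branches.1 (mem_sdiff.1 hlam).1).2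
  have hne : (pairsIn lam).Nonempty := by
    obtain ⟨i, hi, j, hj, hij⟩ := one_lt_card.1 hcard
    rcases lt_or_gt_of_ne hij with hlt | hlt
    · exact ⟨⟨(i, j), hlt⟩, by simp [pairsIn, hi, hj]⟩
    · exact ⟨⟨(j, i), hlt⟩, by simp [pairsIn, hi, hj]⟩
  have := lt_mul_of_neg_div_lt (Finset.sum_pos (fun p _ => chargeProd_pos hc p) hne) h2
  rw [branchExponent, Complex.add_re, sum_scaled_re]
  simpa using this

/-- The root abscissa handles $\top$; any other $P\ne\bot$ is a non-root level of a filtration of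
positive multiplicity, whose level abscissa applies. -/
theorem pos_of_levelAbscissa {q : ℕ} (hq : 2 ≤ q) (hN : 2 ≤ N) (hc : ∀ i, 0 < c i) {a b : ℂ}
    (h : (rootAbscissa c a b ⊔ ⨆ (π : SplittingFiltration N) (_ : 0 < π.mult q),
      levelAbscissa c π b) < ((β.re : ℝ) : EReal)) {P : Part N} (hP : P ≠ ⊥) :
    0 < (N : ℝ) - P.parts.card + (weight a b (scaled c β) P).re := by
  have : NeZero N := ⟨by omega⟩
  by_cases htop : P = ⊤
  · subst htop
    rw [card_parts_top hN, weight_top _ _ _ hN, Nat.cast_one]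
    exact rootAbscissa_pos hN hc (le_sup_left.trans_lt h)
  · obtain ⟨π, hπ, i, rfl⟩ := exists_splittingFiltration_level_eq hq P
    induction i using Fin.lastCases with
    | last => exact absurd π.level_last hP
    | cast l =>
      have hl : 1 ≤ l.val := by
        rw [π.level_castSucc_eq_top_iff] at htop; omega
      have h1 : levelAbscissa c π b ≤ _ :=
        le_iSup₂ (f := fun (π : SplittingFiltration N) (_ : 0 < π.mult q) =>
          levelAbscissa c π b) π hπ
      have := levelAbscissa_pos hc ((h1.trans le_sup_right).trans_lt h) hl
      rw [weight, if_neg htop, if_neg hP, zero_add]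
      exact this

/-- The exponent of a branch, corrected by `a` at the root. -/
noncomputable def rootedExponent (a : ℂ) (s : Pair N → ℂ) (lam : Finset (Fin N)) : ℂ :=
  branchExponent lam s + if lam = univ then a else 0

/-- With $b=0$ the exponent of the recursion is a sum over branches, once $a$ is charged to the
branch $[N]$. This is the multiplicativity that the reduced form requires. -/
theorem sum_rootedExponent (hN : 2 ≤ N) (a : ℂ) (s : Pair N → ℂ) (P : Part N) :
    ∑ lam ∈ P.parts with 1 < lam.card, rootedExponent a s lam =
      N - P.parts.card + weight a 0 s P := by
  have : NeZero N := ⟨by omega⟩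
  have h1 : (∑ lam ∈ P.parts with 1 < lam.card, if lam = univ then a else 0) =
      if P = ⊤ then a else 0 := by
    rw [Finset.sum_ite_eq']
    refine if_congr ⟨fun h => ?_, ?_⟩ rfl rfl
    · refine top_le_iff.1 (part_le_iff_same.2 fun i j _ => ?_)
      rw [mem_filter] at h
      rw [Same, part_eq_of_mem' h.1 (mem_univ i), part_eq_of_mem' h.1 (mem_univ j)]
    · rintro rfl
      rw [mem_filter, parts_top, mem_singleton, card_univ, Fintype.card_fin]
      exact ⟨rfl, by omega⟩
  simp only [rootedExponent]
  rw [Finset.sum_add_distrib, sum_branchExponent, h1, weight, ite_self]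
  ring

theorem rootedExponent_pos {q : ℕ} (hq : 2 ≤ q) (hN : 2 ≤ N) (hc : ∀ i, 0 < c i) {a : ℂ}
    (h : (rootAbscissa c a 0 ⊔ ⨆ (π ∈ reducedFiltrations N) (_ : 0 < π.mult q),
      branchAbscissa c π) < ((β.re : ℝ) : EReal)) {lam : Finset (Fin N)} (hlam : 1 < lam.card) :
    0 < (rootedExponent a (scaled c β) lam).re := by
  have : NeZero N := ⟨by omega⟩
  by_cases hu : lam = univ
  · subst hu
    have := rootAbscissa_pos hN hc (le_sup_left.trans_lt h)
    rw [rootedExponent, if_pos rfl, branchExponent_univ]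
    simp only [Complex.add_re, Complex.sub_re, Complex.natCast_re, Complex.one_re,
      Complex.zero_re] at this ⊢
    linarith
  · obtain ⟨π, hred, hπ, hmem⟩ := exists_isReduced_mem_branches hq hlam hu
    have h1 : branchAbscissa c π ≤ ⨆ (π ∈ reducedFiltrations N) (_ : 0 < π.mult q),
        branchAbscissa c π :=
      le_iSup₂_of_le π (by simp [reducedFiltrations, hred])
        (le_iSup (fun _ : 0 < π.mult q => branchAbscissa c π) hπ)
    rw [rootedExponent, if_neg hu, add_zero]
    exact branchAbscissa_pos hc ((h1.trans le_sup_right).trans_lt h) hmem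

end Exponents

/-! ### Assembling the two formulas -/

section Final

variable {K : Type*} [Field K] [ValuativeRel K] [TopologicalSpace K]
  [IsNonarchimedeanLocalField K] [MeasurableSpace K] [BorelSpace K] {N : ℕ}

/-- Since $q^{z-1}=q^{N-1}q^w$, the denominator at the root cancels against $1-q^{-(z-1)}$ and
leaves the constant $q^{-(N-1)}$. -/
theorem root_factor {q : ℕ} (hq : 2 ≤ q) (hN : 2 ≤ N) {w z : ℂ} (hz : z = N + w)
    (hz1 : 1 < z.re) :
    (1 - (q : ℂ) ^ (-(z - 1))) * (q : ℂ) ^ w * (1 / ((q : ℂ) ^ (z - 1) - 1)) =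
      1 / (q : ℂ) ^ (N - 1) := by
  have h0 : (q : ℂ) ≠ 0 := by exact_mod_cast (by omega)
  have h1 : (q : ℂ) ^ (z - 1) - 1 ≠ 0 := sub_ne_zero.2 (natCast_cpow_ne_one hq (by
    rw [Complex.sub_re, Complex.one_re]; linarith))
  have h2 : (q : ℂ) ^ (z - 1) = (q : ℂ) ^ (N - 1) * (q : ℂ) ^ w := by
    rw [← Complex.cpow_natCast, ← Complex.cpow_add _ _ h0, hz, Nat.cast_sub (by omega)]
    congr 1
    push_cast
    ring
  have h3 : (q : ℂ) ^ w ≠ 0 := by rw [Complex.cpow_ne_zero_iff]; exact Or.inl h0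
  have h4 : (q : ℂ) ^ (N - 1) ≠ 0 := pow_ne_zero _ h0
  rw [h2] at h1
  rw [Complex.cpow_neg, h2]
  field_simp

theorem potInt_top_eq_sum_levelFun (hN : 2 ≤ N) {a b : ℂ} {s : Pair N → ℂ}
    (hre : ∀ P : Part N, P ≠ ⊥ → 0 < (N : ℝ) - P.parts.card + (weight a b s P).re) {z : ℂ}
    (hz : z = N + (a + b + ∑ p, s p)) (hz1 : 1 < z.re) :
    (1 - (residueCard K : ℂ) ^ (-(z - 1))) * (residueCard K : ℂ) ^ (a + b + ∑ p, s p) *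
      potInt a b s K ⊤ =
      ∑ π : SplittingFiltration N with 0 < π.mult (residueCard K),
        levelFun π (residueCard K) b s := by
  classical
  have : NeZero N := ⟨by omega⟩
  have h1 := eq_sum_of_recursion (κ := 𝓀[K]) Fintype.card_pos (potInt a b s K)
    (fun P => (residueCard K : ℂ) ^ ((N : ℂ) - P.parts.card + weight a b s P)) (potInt_bot hN)
    (fun P _ => by rw [card_residueField]; exact potInt_recursion hN hre P)
    (fun P hP => natCast_cpow_ne_one one_lt_residueCard (by simpa using hre P hP))
  -- Filtrations with $M_{\pi,q}=0$ contribute zero, so the restriction to positive multiplicity is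
  -- harmless.
  rw [h1, Finset.mul_sum, Finset.sum_filter_of_ne fun π _ hne => by
    by_contra h
    apply hne
    rw [levelFun, Nat.eq_zero_of_not_pos h]
    simp]
  refine Finset.sum_congr rfl fun π _ => ?_
  rw [prod_levels_eq hN π, (π.level_castSucc_eq_top_iff _).2 rfl, card_parts_top hN,
    weight_top a b s hN, card_residueField, levelFun]
  have h2 : (N : ℂ) - (1 : ℕ) + (a + b + ∑ p, s p) = z - 1 := by
    rw [hz]; push_cast; ring
  rw [h2]
  have h3 : ∏ l : Fin π.length with 1 ≤ l.val, 1 / ((residueCard K : ℂ) ^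
      ((N : ℂ) - (π.level l.castSucc).parts.card + weight a b s (π.level l.castSucc)) - 1) =
      ∏ l : Fin π.length with 1 ≤ l.val,
        1 / ((residueCard K : ℂ) ^ (b + levelExponent π l s) - 1) :=
    Finset.prod_congr rfl fun l hl => by
      rw [weight_level hN a b s π (Finset.mem_filter.1 hl).2]
  rw [h3]
  have h4 := root_factor (q := residueCard K) one_lt_residueCard hN hz hz1
  linear_combination ((π.mult (residueCard K) : ℂ) * ∏ l : Fin π.length with 1 ≤ l.val,
        1 / ((residueCard K : ℂ) ^ (b + levelExponent π l s) - 1)) * h4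

theorem potInt_top_eq_sum_branchFun (hN : 2 ≤ N) {a : ℂ} {s : Pair N → ℂ}
    (hre : ∀ P : Part N, P ≠ ⊥ → 0 < (N : ℝ) - P.parts.card + (weight a 0 s P).re)
    (hbr : ∀ lam : Finset (Fin N), 1 < lam.card → 0 < (rootedExponent a s lam).re) {z : ℂ}
    (hz : z = N + (a + 0 + ∑ p, s p)) (hz1 : 1 < z.re) :
    (1 - (residueCard K : ℂ) ^ (-(z - 1))) * (residueCard K : ℂ) ^ (a + 0 + ∑ p, s p) *
      potInt a 0 s K ⊤ =
      ∑ π ∈ reducedFiltrations N with 0 < π.mult (residueCard K),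
        branchFun π (residueCard K) s := by
  classical
  have : NeZero N := ⟨by omega⟩
  have h0 : (residueCard K : ℂ) ≠ 0 := by exact_mod_cast (residueCard_pos (K := K)).ne'
  have hprod : ∀ P : Part N, ∏ lam ∈ P.parts with 1 < lam.card,
      (residueCard K : ℂ) ^ rootedExponent a s lam =
        (residueCard K : ℂ) ^ ((N : ℂ) - P.parts.card + weight a 0 s P) := by
    intro P
    rw [← cpow_finset_sum h0, sum_rootedExponent hN]
  have h1 := eq_sum_reducedFiltrations (κ := 𝓀[K])
    (fun lam => (residueCard K : ℂ) ^ rootedExponent a s lam) Fintype.card_pos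
    (potInt a 0 s K) (potInt_bot hN)
    (fun P _ => by rw [card_residueField, hprod]; exact potInt_recursion hN hre P)
    (fun lam hlam => natCast_cpow_ne_one one_lt_residueCard (hbr lam hlam))
    (fun P hP => by
      rw [hprod]
      exact natCast_cpow_ne_one one_lt_residueCard (by simpa using hre P hP))
  rw [h1, Finset.mul_sum, Finset.sum_filter_of_ne fun π _ hne => by
    by_contra h
    apply hne
    rw [branchFun, Nat.eq_zero_of_not_pos h]
    simp]
  refine Finset.sum_congr rfl fun π _ => ?_
  have h2 : rootedExponent a s Finset.univ = z - 1 := by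
    rw [rootedExponent, if_pos rfl, branchExponent_univ, hz]; ring
  have h3 : ∏ lam ∈ π.branches, 1 / ((residueCard K : ℂ) ^ rootedExponent a s lam - 1) =
      1 / ((residueCard K : ℂ) ^ (z - 1) - 1) *
        ∏ lam ∈ π.properBranches, 1 / ((residueCard K : ℂ) ^ branchExponent lam s - 1) := by
    rw [← Finset.mul_prod_erase _ _ (univ_mem_branches hN π), h2,
      SplittingFiltration.properBranches, ← Finset.erase_eq]
    congr 1
    refine Finset.prod_congr rfl fun lam hlam => ?_
    rw [rootedExponent, if_neg (Finset.ne_of_mem_erase hlam), add_zero]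
  rw [h3, card_residueField, branchFun]
  have h4 := root_factor (q := residueCard K) one_lt_residueCard hN hz hz1
  linear_combination ((π.mult (residueCard K) : ℂ) * ∏ lam ∈ π.properBranches,
        1 / ((residueCard K : ℂ) ^ branchExponent lam s - 1)) * h4

/-- The exponent of $P$ is the sum of the exponents of its branches, and a partition other than
$\bot$ has at least one. -/
theorem pos_of_rootedExponent (hN : 2 ≤ N) {a : ℂ} {s : Pair N → ℂ}
    (hbr : ∀ lam : Finset (Fin N), 1 < lam.card → 0 < (rootedExponent a s lam).re)
    {P : Part N} (hP : P ≠ ⊥) : 0 < (N : ℝ) - P.parts.card + (weight a 0 s P).re := by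
  have h := congrArg Complex.re (sum_rootedExponent hN a s P)
  rw [Complex.re_sum] at h
  have h2 : 0 < ∑ lam ∈ P.parts with 1 < lam.card, (rootedExponent a s lam).re := by
    obtain ⟨lam, hlam, hcard⟩ := exists_branch_of_ne_bot hP
    exact Finset.sum_pos (fun lam hlam => hbr lam (Finset.mem_filter.1 hlam).2)
      ⟨lam, Finset.mem_filter.2 ⟨hlam, hcard⟩⟩
  rw [h] at h2
  simpa using h2

end Final

end LogCoulomb

theorem mainTheorem3 {K : Type*} [Field K] [ValuativeRel K] [TopologicalSpace K]
    [IsNonarchimedeanLocalField K] [MeasurableSpace K] [BorelSpace K]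
    (q : ℕ) (hq : Nat.card 𝓀[K] = q)
    (N : ℕ) (hN : 2 ≤ N) (a b β : ℂ)
    (ρ : LogCoulomb.normValues → ℂ) (hρ : LogCoulomb.GrowthDecay ρ)
    (c : Fin N → ℝ) (hc : ∀ i, 0 < c i) :
    -- part (a)
    ((LogCoulomb.rootAbscissa c a b ⊔
        ⨆ (π : LogCoulomb.SplittingFiltration N) (_ : 0 < π.mult q),
          LogCoulomb.levelAbscissa c π b) < ((β.re : ℝ) : EReal) →
      MeasureTheory.Integrable
        (LogCoulomb.integrand (K := K) ρ a b (LogCoulomb.scaled c β)) (LogCoulomb.haarPi K N) ∧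
      Summable (LogCoulomb.rootTerm q ρ (N + a + b + ∑ p, LogCoulomb.scaled c β p)) ∧
      LogCoulomb.Z K ρ a b (LogCoulomb.scaled c β) =
        LogCoulomb.rootFun q ρ (N + a + b + ∑ p, LogCoulomb.scaled c β p) *
          ∑ π : LogCoulomb.SplittingFiltration N with 0 < π.mult q,
            LogCoulomb.levelFun π q b (LogCoulomb.scaled c β)) ∧
    -- part (b)
    ((LogCoulomb.rootAbscissa c a 0 ⊔
        ⨆ (π ∈ LogCoulomb.reducedFiltrations N) (_ : 0 < π.mult q),
          LogCoulomb.branchAbscissa c π) < ((β.re : ℝ) : EReal) →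
      MeasureTheory.Integrable
        (LogCoulomb.integrand (K := K) ρ a 0 (LogCoulomb.scaled c β)) (LogCoulomb.haarPi K N) ∧
      Summable (LogCoulomb.rootTerm q ρ (N + a + ∑ p, LogCoulomb.scaled c β p)) ∧
      LogCoulomb.Z K ρ a 0 (LogCoulomb.scaled c β) =
        LogCoulomb.rootFun q ρ (N + a + ∑ p, LogCoulomb.scaled c β p) *
          ∑ π ∈ LogCoulomb.reducedFiltrations N with 0 < π.mult q,
            LogCoulomb.branchFun π q (LogCoulomb.scaled c β)) := by

  subst hq
  have hq2 : 2 ≤ Nat.card 𝓀[K] := LogCoulomb.one_lt_residueCard (K := K)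
  refine ⟨fun h => ?_, fun h => ?_⟩
  · have hre := fun (P : LogCoulomb.Part N) (hP : P ≠ ⊥) =>
      LogCoulomb.pos_of_levelAbscissa hq2 hN hc h hP
    have hz : (N : ℂ) + a + b + ∑ p, LogCoulomb.scaled c β p =
        N + (a + b + ∑ p, LogCoulomb.scaled c β p) := by ring
    obtain ⟨h1, h2, h3, h4⟩ := LogCoulomb.integrable_and_Z_eq (K := K) hN hρ hre hz
    refine ⟨h1, h2, ?_⟩
    rw [h3, LogCoulomb.potInt_top_eq_sum_levelFun hN hre hz h4]
  · have hbr := fun (lam : Finset (Fin N)) (hlam : 1 < lam.card) =>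
      LogCoulomb.rootedExponent_pos hq2 hN hc h hlam
    have hre := fun (P : LogCoulomb.Part N) (hP : P ≠ ⊥) =>
      LogCoulomb.pos_of_rootedExponent hN hbr hP
    have hz : (N : ℂ) + a + ∑ p, LogCoulomb.scaled c β p =
        N + (a + 0 + ∑ p, LogCoulomb.scaled c β p) := by ring
    obtain ⟨h1, h2, h3, h4⟩ := LogCoulomb.integrable_and_Z_eq (K := K) hN hρ hre hz
    refine ⟨h1, h2, ?_⟩
    rw [h3, LogCoulomb.potInt_top_eq_sum_branchFun hN hre hbr hz h4]
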